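/- Let $d\ge 1$, $0\le M<N$ and $0\le L\le N$ be integers. For a unit vector $\psi\in\mathbb{C}^d$ and $S\subseteq\{1,\dots,N\}$ let $T_S(\psi)$ be the operator on $(\mathbb{C}^d)^{\otimes N}$ that acts as $|\psi\rangle\langle\psi|$ on the sites in $S$ and as the identity on the other sites. For a quantum channel (completely positive trace-preserving linear map) $\mathcal{E}$ from operators on $(\mathbb{C}^d)^{\otimes M}$ to operators on $(\mathbb{C}^d)^{\otimes N}$ let $$F_S(\mathcal{E})=\int \mathrm{Tr}\big(T_S(\psi)\,\mathcal{E}(|\psi\rangle\langle\psi|^{\otimes M})\big)\,d\psi ,$$ where $\psi=U|0\rangle$ with $U$ distributed according to the Haar probability measure on $SU(d)$, and let $$F_{\mathrm{av}}(\mathcal{E})=\int \mathrm{Tr}\Big(\tbinom{N}{L}^{-1}\sum_{|S|=L}T_S(\psi)\;\mathcal{E}(|\psi\rangle\langle\psi|^{\otimes M})\Big)\,d\psi .$$ Binomial coefficients are $\binom{n}{k}=n(n-1)\cdots(n-k+1)/k!$ for integers $n$ and $k\ge 0$, and $\binom nk=0$ for $k<0$; a sum whose upper limit is negative is empty. Then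 the maximum of $F_{\mathrm{av}}(\mathcal{E})$ over all channels $\mathcal{E}$ exists, and so does the maximum of the common value $f$ over all channels $\mathcal{E}$ with $F_S(\mathcal{E})=f$ for every $S$ with $|S|=L$. Both maxima are equal to the same number $F$ (the optimal symmetric $M\to N$ cloning fidelity measured on $L$-spin subsets), and $$F=\frac{1}{\binom{N}{L}}\frac{\binom{M+d-1}{M}}{\binom{N+d-1}{M}}\sum_{i=0}^M\binom{M}{i}\binom{N-M}{M-i}\sum_{q=0}^{N+i-2M}\frac{\binom{N+i-2M}{q}\binom{2M-i}{L-q}}{\binom{M+d-1-i+q}{d-1}},$$ $$F=\frac{1}{\binom{N}{L}\binom{N+d-1}{N-M}}\sum_{i=0}^M\sum_{q=0}^N\binom{M}{i}\binom{q-M}{i}\binom{N-M+d-1}{N-q}\binom{M+i}{q-L}.$$ If $L=1$, then $F=\dfrac{M}{N}+\dfrac{(N-M)(M+1)}{N(M+d)}$. If $L=N$, then $F=\binom{M+d-1}{M}\big/\binom{N+d-1}{N}$. -/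

import Mathlib

open MeasureTheory
open scoped ComplexOrder

/-- The binomial coefficient for integer arguments: `n (n - 1) ⋯ (n - k + 1) / k!` for `0 ≤ k`, and
`0` for `k < 0`. -/
def zbinom (n k : ℤ) : ℤ := if 0 ≤ k then Ring.choose n k.toNat else 0

/-! ### Haar measure on the special unitary group -/

/-- The special unitary group `SU(d)`. -/
abbrev SUGroup (d : ℕ) : Type := Matrix.specialUnitaryGroup (Fin d) ℂ

noncomputable instance SUGroup.instMeasurableSpace (d : ℕ) : MeasurableSpace (SUGroup d) := borel _

instance SUGroup.instBorelSpace (d : ℕ) : BorelSpace (SUGroup d) := ⟨rfl⟩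

instance SUGroup.instIsTopologicalGroup (d : ℕ) : IsTopologicalGroup (SUGroup d) where
  continuous_mul := continuous_mul
  continuous_inv := by
    refine Continuous.subtype_mk (f := fun U : SUGroup d => star (U : Matrix (Fin d) (Fin d) ℂ)) ?_ _
    exact continuous_star.comp continuous_subtype_val

instance SUGroup.instCompactSpace (d : ℕ) : CompactSpace (SUGroup d) := by
  have hK : IsCompact (Set.pi Set.univ (fun _ : Fin d => Set.pi Set.univ
      (fun _ : Fin d => Metric.closedBall (0 : ℂ) 1))) :=
    isCompact_univ_pi fun _ => isCompact_univ_pi fun _ => isCompact_closedBall _ _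
  have hS : IsClosed {A : Matrix (Fin d) (Fin d) ℂ | A * star A = 1 ∧ A.det = 1} :=
    (isClosed_eq (continuous_id.mul continuous_star) continuous_const).inter
      (isClosed_eq continuous_id.matrix_det continuous_const)
  have hset : ((Matrix.specialUnitaryGroup (Fin d) ℂ : Set (Matrix (Fin d) (Fin d) ℂ)))
      = {A : Matrix (Fin d) (Fin d) ℂ | A * star A = 1 ∧ A.det = 1} := by
    ext A
    simp only [SetLike.mem_coe, Matrix.mem_specialUnitaryGroup_iff, Matrix.mem_unitaryGroup_iff,
      Set.mem_ofPred_eq]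
  refine isCompact_iff_compactSpace.mp (hK.of_isClosed_subset (hset ▸ hS) ?_)
  intro A hA i _ j _
  rw [mem_closedBall_zero_iff]
  exact entry_norm_bound_of_unitary (Matrix.specialUnitaryGroup_le_unitaryGroup hA) i j

/-- The Haar probability measure on `SU(d)`. -/
noncomputable def haarSU (d : ℕ) : Measure (SUGroup d) := Measure.haarMeasure ⊤

/-! ### States, tests and channels on tensor powers of `ℂ^d` -/

/-- Operators on `(ℂ^d)^{⊗ n}`, as matrices in the computational basis, which is indexed by the
strings `Fin n → Fin d`. -/
abbrev TensorOp (d n : ℕ) : Type := Matrix (Fin n → Fin d) (Fin n → Fin d) ℂ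

/-- The tensor product `A 0 ⊗ ⋯ ⊗ A (n - 1)` of operators on `ℂ^d`. -/
def tensorProd {d n : ℕ} (A : Fin n → Matrix (Fin d) (Fin d) ℂ) : TensorOp d n :=
  Matrix.of fun a b => ∏ i, A i (a i) (b i)

/-- The projector `U |0⟩⟨0| U†`. -/
def pureState {d : ℕ} [NeZero d] (U : SUGroup d) : Matrix (Fin d) (Fin d) ℂ :=
  (U : Matrix (Fin d) (Fin d) ℂ) * Matrix.single 0 0 1 *
    (U : Matrix (Fin d) (Fin d) ℂ).conjTranspose

/-- `n` copies of the pure state with projector `ρ`. -/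
def copies {d : ℕ} (n : ℕ) (ρ : Matrix (Fin d) (Fin d) ℂ) : TensorOp d n :=
  tensorProd fun _ => ρ

/-- The test operator on `n` spins that has `ρ` at the sites in `S` and the identity elsewhere. -/
def siteTest {d n : ℕ} (S : Finset (Fin n)) (ρ : Matrix (Fin d) (Fin d) ℂ) : TensorOp d n :=
  tensorProd fun i => if i ∈ S then ρ else 1

/-- The test operator for symmetric cloning: the uniform average of the tests on all the `L`-element
sets of sites. -/
noncomputable def symTest {d : ℕ} (n L : ℕ) (ρ : Matrix (Fin d) (Fin d) ℂ) : TensorOp d n :=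
  ((n.choose L : ℂ)⁻¹) • ∑ S ∈ Finset.powersetCard L (Finset.univ : Finset (Fin n)), siteTest S ρ

/-- Complete positivity: every ampliation `E ⊗ id_k` maps positive semidefinite operators to
positive semidefinite operators. -/
def IsCompletelyPositive {ι κ : Type} [Fintype ι] [Fintype κ]
    (E : Matrix ι ι ℂ →ₗ[ℂ] Matrix κ κ ℂ) : Prop :=
  ∀ (k : ℕ) (X : Matrix (ι × Fin k) (ι × Fin k) ℂ), X.PosSemidef →
    (Matrix.of fun a b : κ × Fin k =>
      E (Matrix.of fun i j => X (i, a.2) (j, b.2)) a.1 b.1).PosSemidef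

/-- Quantum channels: completely positive trace preserving linear maps. -/
def IsChannel {ι κ : Type} [Fintype ι] [Fintype κ]
    (E : Matrix ι ι ℂ →ₗ[ℂ] Matrix κ κ ℂ) : Prop :=
  IsCompletelyPositive E ∧ ∀ X, (E X).trace = X.trace

/-- The fidelity `∫ Tr (T(ψ) E(ψ^{⊗ M})) dψ` of a map `E` from `M` to `N` spins with respect to the
test operators `T(ψ)`, for `ψ` distributed uniformly over the pure states of `ℂ^d`. -/
noncomputable def cloningFidelity {d M N : ℕ} [NeZero d]
    (T : Matrix (Fin d) (Fin d) ℂ → TensorOp d N) (E : TensorOp d M →ₗ[ℂ] TensorOp d N) : ℝ :=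
  ∫ U, (T (pureState U) * E (copies M (pureState U))).trace.re ∂(haarSU d)

/-! Both optima are squeezed between an upper bound for the average fidelity of any channel and the
fidelity of one explicit channel.

Upper bound. Moments of a Haar random pure state are multiples of the symmetric projection
(`haar_moment`), and the symmetric projection is, up to a factorial, the Gram matrix of monomials
for the Fischer inner product (`fischer_prod_X_prod_X`). Writing the Choi matrix of the channel as a
sum of rank one terms `B k` therefore turns the fidelity on a set `S` into a sum over `k` of squared
Fischer norms (`IsCompletelyPositive.exists_cloningFidelity_eq`). In these norms each site of `S`
contributes an extra input letter. Multiplication by input letters may be replaced by the operators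
`conjCoord c = aux c + ∂ (input c)`, because these commute with their adjoints
(`commute_coord_conjCoord`, `fischer_conjCoords`). With one marker variable per site, the states of
all `L`-sets together become `(A + B) ^ L` applied to a single vector, where `A = collectSites` and
`B = contractSites`. Markers make different sets orthogonal, so no cross terms arise.

`A` and `B` commute, and the terms of the binomial expansion of `(A + B) ^ L` have different degrees
in the auxiliary variables. They are thus orthogonal, and each is estimated one step at a time. The
step that matters is the Casimir-type inequality `sum_fischerNormSq_pairAnnihilate_le`: annihilating
a pair of one input and one output letter costs at most the factor `m (n + d - 1)` in squared norm,
for `m` input and `n` output letters. Trace preservation fixes the total squared norm of the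
starting vectors (`IsChannel.sum_fischerNormSq_cloningVector`).

Lower bound. The cloner appends completely mixed sites to the input, projects onto the symmetric
subspace and renormalizes. Its output is permutation invariant, so all `L`-sets have the same
fidelity, which reduces to counting unions of sets (`cloningFidelity_cloner`). Since this channel
also satisfies the constraint of equal fidelities, it settles both maxima at once.

Vandermonde convolutions identify the two bounds (`fidelityBound_eq`) and give the two closed forms
(`sum_sum_zbinom_eq`, `sum_sum_zbinom_div_eq`). -/

/-! ### The Fischer inner product on polynomials -/

section Fischer

open MvPolynomial

variable {σ : Type*}

/-- The Fischer inner product `∑ α, α! * conj (p_α) * q_α` of two polynomials. -/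
noncomputable def fischer (p q : MvPolynomial σ ℂ) : ℂ :=
  ∑ α ∈ p.support, (starRingEnd ℂ) (coeff α p) * coeff α q * (α.prod fun _ n => (n.factorial : ℂ))

theorem fischer_eq_sum_of_subset {p : MvPolynomial σ ℂ} {s : Finset (σ →₀ ℕ)} (h : p.support ⊆ s)
    (q : MvPolynomial σ ℂ) : fischer p q =
      ∑ α ∈ s, (starRingEnd ℂ) (coeff α p) * coeff α q *
        (α.prod fun _ n => (n.factorial : ℂ)) := by
  refine Finset.sum_subset h fun α _ hα => ?_
  simp [notMem_support_iff.mp hα]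

theorem fischer_conj (p q : MvPolynomial σ ℂ) :
    (starRingEnd ℂ) (fischer p q) = fischer q p := by
  classical
  rw [fischer_eq_sum_of_subset (Finset.subset_union_left (s₂ := q.support)),
    fischer_eq_sum_of_subset (Finset.subset_union_right (s₁ := p.support)), map_sum]
  refine Finset.sum_congr rfl fun α _ => ?_
  simp only [map_mul, Complex.conj_conj, Finsupp.prod, map_prod, map_natCast]
  ring

theorem fischer_add_right (p q r : MvPolynomial σ ℂ) :
    fischer p (q + r) = fischer p q + fischer p r := by
  simp only [fischer, coeff_add, mul_add, add_mul, Finset.sum_add_distrib]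

theorem fischer_smul_right (c : ℂ) (p q : MvPolynomial σ ℂ) :
    fischer p (c • q) = c * fischer p q := by
  simp only [fischer, coeff_smul, smul_eq_mul, Finset.mul_sum]
  exact Finset.sum_congr rfl fun _ _ => by ring

theorem fischer_add_left (p q r : MvPolynomial σ ℂ) :
    fischer (p + q) r = fischer p r + fischer q r := by
  rw [← fischer_conj, fischer_add_right, map_add, fischer_conj, fischer_conj]

theorem fischer_smul_left (c : ℂ) (p q : MvPolynomial σ ℂ) :
    fischer (c • p) q = (starRingEnd ℂ) c * fischer p q := by
  rw [← fischer_conj, fischer_smul_right, map_mul, fischer_conj]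

@[simp] theorem fischer_zero_right (p : MvPolynomial σ ℂ) : fischer p 0 = 0 := by
  simp [fischer]

theorem fischer_sum_right {ι : Type*} (s : Finset ι) (p : MvPolynomial σ ℂ)
    (f : ι → MvPolynomial σ ℂ) : fischer p (∑ i ∈ s, f i) = ∑ i ∈ s, fischer p (f i) := by
  classical
  induction s using Finset.induction_on with
  | empty => simp
  | insert i s hi ih => rw [Finset.sum_insert hi, Finset.sum_insert hi, fischer_add_right, ih]

theorem fischer_sum_left {ι : Type*} (s : Finset ι) (p : MvPolynomial σ ℂ)
    (f : ι → MvPolynomial σ ℂ) : fischer (∑ i ∈ s, f i) p = ∑ i ∈ s, fischer (f i) p := by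
  rw [← fischer_conj, fischer_sum_right, map_sum]
  exact Finset.sum_congr rfl fun _ _ => fischer_conj _ _

theorem fischer_monomial_left (α : σ →₀ ℕ) (c : ℂ) (q : MvPolynomial σ ℂ) :
    fischer (monomial α c) q =
      (starRingEnd ℂ) c * coeff α q * (α.prod fun _ n => (n.factorial : ℂ)) := by
  classical
  rw [fischer_eq_sum_of_subset (s := {α}) support_monomial_subset]
  simp

theorem factorial_prod_add_single (α : σ →₀ ℕ) (i : σ) :
    ((α + Finsupp.single i 1).prod fun _ n => (n.factorial : ℂ)) =
      (α i + 1) * α.prod fun _ n => (n.factorial : ℂ) := by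
  classical
  have h1 : (α + Finsupp.single i 1).prod (fun _ n => (n.factorial : ℂ)) =
      ∏ j ∈ insert i α.support, (((α + Finsupp.single i 1 : σ →₀ ℕ) j).factorial : ℂ) := by
    refine Finset.prod_subset ?_ ?_
    · intro j hj
      by_cases h : j = i
      · simp [h]
      · simpa [h, Finsupp.single_apply, Ne.symm h] using hj
    · intro j _ hj
      simp only [Finsupp.notMem_support_iff] at hj
      simp [hj]
  have h2 : α.prod (fun _ n => (n.factorial : ℂ)) =
      ∏ j ∈ insert i α.support, ((α j).factorial : ℂ) := by
    refine Finset.prod_subset (Finset.subset_insert _ _) ?_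
    intro j _ hj
    simp only [Finsupp.notMem_support_iff] at hj
    simp [hj]
  rw [h1, h2, ← Finset.mul_prod_erase _ _ (Finset.mem_insert_self i _),
    ← Finset.mul_prod_erase _ (fun j => ((α j).factorial : ℂ)) (Finset.mem_insert_self i _),
    ← mul_assoc]
  congr 1
  · simp [Nat.factorial_succ]
  · refine Finset.prod_congr rfl fun j hj => ?_
    simp [(Finset.ne_of_mem_erase hj).symm]

/-- The weights `α!` satisfy `(α + e_i)! = (α_i + 1) α!`, which is the factor that differentiation
produces. Creation and annihilation are thus mutually adjoint; the norm estimates below rest on this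
and on positivity. -/
theorem fischer_X_mul_left (i : σ) (p q : MvPolynomial σ ℂ) :
    fischer (X i * p) q = fischer p (pderiv i q) := by
  induction p using MvPolynomial.induction_on' with
  | monomial α c =>
    rw [show X i * monomial α c = monomial (α + Finsupp.single i 1) c by
      rw [X, monomial_mul, one_mul, add_comm], fischer_monomial_left, fischer_monomial_left,
      coeff_pderiv, factorial_prod_add_single]
    ring
  | add p q hp hq => rw [mul_add, fischer_add_left, fischer_add_left, hp, hq]

theorem fischer_X_mul_right (i : σ) (p q : MvPolynomial σ ℂ) :
    fischer p (X i * q) = fischer (pderiv i p) q := by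
  rw [← fischer_conj, fischer_X_mul_left, fischer_conj]

/-- The square of the Fischer norm. -/
noncomputable def fischerNormSq (p : MvPolynomial σ ℂ) : ℝ := (fischer p p).re

theorem fischer_self (p : MvPolynomial σ ℂ) : fischer p p = fischerNormSq p :=
  (Complex.conj_eq_iff_re.mp (fischer_conj p p)).symm

theorem fischerNormSq_eq_sum (p : MvPolynomial σ ℂ) : fischerNormSq p =
    ∑ α ∈ p.support, Complex.normSq (coeff α p) * (α.prod fun _ n => (n.factorial : ℝ)) := by
  have : fischer p p = ((∑ α ∈ p.support, Complex.normSq (coeff α p) *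
      (α.prod fun _ n => (n.factorial : ℝ)) : ℝ) : ℂ) := by
    simp only [fischer, Finsupp.prod, Complex.ofReal_sum, Complex.ofReal_mul, Complex.ofReal_prod,
      Complex.ofReal_natCast, Complex.normSq_eq_conj_mul_self]
  rw [fischerNormSq, this, Complex.ofReal_re]

theorem fischerNormSq_nonneg (p : MvPolynomial σ ℂ) : 0 ≤ fischerNormSq p := by
  rw [fischerNormSq_eq_sum]
  refine Finset.sum_nonneg fun α _ => mul_nonneg (Complex.normSq_nonneg _) ?_
  exact Finset.prod_nonneg fun _ _ => Nat.cast_nonneg _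

theorem eq_zero_of_fischerNormSq {p : MvPolynomial σ ℂ} (h : fischerNormSq p = 0) : p = 0 := by
  rw [fischerNormSq_eq_sum, Finset.sum_eq_zero_iff_of_nonneg] at h
  · by_contra hp
    obtain ⟨α, hα⟩ := Finset.nonempty_of_ne_empty (mt support_eq_empty.mp hp)
    have := h α hα
    rw [mul_eq_zero, Complex.normSq_eq_zero] at this
    rcases this with h | h
    · exact mem_support_iff.mp hα h
    · exact (Finset.prod_pos fun i _ => by positivity).ne' h
  · exact fun α _ => mul_nonneg (Complex.normSq_nonneg _)
      (Finset.prod_nonneg fun _ _ => Nat.cast_nonneg _)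

@[simp] theorem fischerNormSq_zero : fischerNormSq (0 : MvPolynomial σ ℂ) = 0 := by
  simp [fischerNormSq]

theorem fischerNormSq_smul (c : ℂ) (p : MvPolynomial σ ℂ) :
    fischerNormSq (c • p) = Complex.normSq c * fischerNormSq p := by
  rw [fischerNormSq, fischer_smul_left, fischer_smul_right, ← mul_assoc,
    ← Complex.normSq_eq_conj_mul_self, Complex.re_ofReal_mul, fischerNormSq]

theorem two_mul_re_fischer_le (p q : MvPolynomial σ ℂ) :
    2 * (fischer p q).re ≤ fischerNormSq p + fischerNormSq q := by
  have h := fischerNormSq_nonneg (p + (-1 : ℂ) • q)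
  have h2 : (fischer q p).re = (fischer p q).re := by
    rw [← fischer_conj, Complex.conj_re]
  simp only [fischerNormSq, fischer_add_left, fischer_add_right, fischer_smul_left,
    fischer_smul_right, Complex.add_re] at h ⊢
  simp at h
  linarith

/-- A symmetrised Cauchy–Schwarz inequality for double families. -/
theorem re_sum_fischer_swap_le {ι : Type*} (s : Finset ι) (f : ι → ι → MvPolynomial σ ℂ) :
    (∑ i ∈ s, ∑ j ∈ s, fischer (f i j) (f j i)).re ≤ ∑ i ∈ s, ∑ j ∈ s, fischerNormSq (f i j) := by
  have h : 2 * (∑ i ∈ s, ∑ j ∈ s, fischer (f i j) (f j i)).re ≤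
      ∑ i ∈ s, ∑ j ∈ s, fischerNormSq (f i j) + ∑ i ∈ s, ∑ j ∈ s, fischerNormSq (f j i) := by
    simp only [Complex.re_sum, Finset.mul_sum, ← Finset.sum_add_distrib]
    exact Finset.sum_le_sum fun i _ => Finset.sum_le_sum fun j _ => two_mul_re_fischer_le _ _
  rw [Finset.sum_comm (f := fun i j => fischerNormSq (f j i))] at h
  linarith

theorem fischerNormSq_sum {ι : Type*} (s : Finset ι) (f : ι → MvPolynomial σ ℂ) :
    fischerNormSq (∑ i ∈ s, f i) = (∑ i ∈ s, ∑ j ∈ s, fischer (f i) (f j)).re := by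
  rw [fischerNormSq, fischer_sum_left]
  simp only [fischer_sum_right]

theorem fischerNormSq_sum_of_orthogonal {ι : Type*} (s : Finset ι) (f : ι → MvPolynomial σ ℂ)
    (h : ∀ i ∈ s, ∀ j ∈ s, i ≠ j → fischer (f i) (f j) = 0) :
    fischerNormSq (∑ i ∈ s, f i) = ∑ i ∈ s, fischerNormSq (f i) := by
  rw [fischerNormSq_sum, Complex.re_sum]
  refine Finset.sum_congr rfl fun i hi => ?_
  rw [Finset.sum_eq_single_of_mem i hi fun j hj hij => h i hi j hj hij.symm, fischerNormSq]

theorem pderiv_comm (i j : σ) (p : MvPolynomial σ ℂ) :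
    pderiv i (pderiv j p) = pderiv j (pderiv i p) := by
  classical
  ext α
  simp only [coeff_pderiv, Finsupp.add_apply, Finsupp.single_apply]
  by_cases h : i = j
  · subst h; rfl
  · rw [if_neg h, if_neg (Ne.symm h), add_right_comm]
    push_cast
    ring

theorem pderiv_X_mul_self (i : σ) (p : MvPolynomial σ ℂ) :
    pderiv i (X i * p) = p + X i * pderiv i p := by
  rw [pderiv_mul, pderiv_X_self, one_mul]

theorem pderiv_X_mul_of_ne {i j : σ} (h : j ≠ i) (p : MvPolynomial σ ℂ) :
    pderiv i (X j * p) = X j * pderiv i p := by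
  rw [pderiv_mul, pderiv_X_of_ne h, zero_mul, zero_add]

/-! ### Homogeneity with respect to a family of variables -/

variable {ι κ : Type*} [Fintype ι] [Fintype κ]

/-- `p` is homogeneous of degree `n` in the variables `x i`. -/
def HasPartialDegree (x : ι → σ) (n : ℕ) (p : MvPolynomial σ ℂ) : Prop :=
  ∑ i, X (x i) * pderiv (x i) p = (n : ℂ) • p

theorem HasPartialDegree.zero (x : ι → σ) (n : ℕ) : HasPartialDegree x n 0 := by
  simp [HasPartialDegree]

theorem HasPartialDegree.add {x : ι → σ} {n : ℕ} {p q : MvPolynomial σ ℂ}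
    (hp : HasPartialDegree x n p) (hq : HasPartialDegree x n q) :
    HasPartialDegree x n (p + q) := by
  simp only [HasPartialDegree, map_add, mul_add, Finset.sum_add_distrib, smul_add] at *
  rw [hp, hq]

theorem HasPartialDegree.smul {x : ι → σ} {n : ℕ} {p : MvPolynomial σ ℂ} (c : ℂ)
    (hp : HasPartialDegree x n p) : HasPartialDegree x n (c • p) := by
  simp only [HasPartialDegree, Derivation.map_smul, mul_smul_comm] at *
  rw [← Finset.smul_sum, hp, smul_comm]

theorem HasPartialDegree.sum {τ : Type*} {s : Finset τ} {x : ι → σ} {n : ℕ}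
    {f : τ → MvPolynomial σ ℂ} (h : ∀ t ∈ s, HasPartialDegree x n (f t)) :
    HasPartialDegree x n (∑ t ∈ s, f t) := by
  classical
  induction s using Finset.induction_on with
  | empty => exact .zero _ _
  | insert t s ht ih =>
    rw [Finset.sum_insert ht]
    exact (h t (Finset.mem_insert_self _ _)).add
      (ih fun u hu => h u (Finset.mem_insert_of_mem hu))

theorem HasPartialDegree.X_mul_of_notMem {x : ι → σ} {n : ℕ} {p : MvPolynomial σ ℂ} {j : σ}
    (hj : ∀ i, x i ≠ j) (hp : HasPartialDegree x n p) : HasPartialDegree x n (X j * p) := by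
  have h : ∀ i, X (x i) * pderiv (x i) (X j * p) = X j * (X (x i) * pderiv (x i) p) := fun i => by
    rw [pderiv_X_mul_of_ne (hj i).symm]; ring
  rw [HasPartialDegree, Finset.sum_congr rfl fun i _ => h i, ← Finset.mul_sum, hp, mul_smul_comm]

theorem HasPartialDegree.X_mul {x : ι → σ} (hx : Function.Injective x) {n : ℕ}
    {p : MvPolynomial σ ℂ} (j : ι) (hp : HasPartialDegree x n p) :
    HasPartialDegree x (n + 1) (X (x j) * p) := by
  classical
  have h : ∀ i, X (x i) * pderiv (x i) (X (x j) * p) =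
      (if i = j then X (x j) * p else 0) + X (x j) * (X (x i) * pderiv (x i) p) := fun i => by
    by_cases hij : i = j
    · subst hij; rw [pderiv_X_mul_self, if_pos rfl]; ring
    · rw [pderiv_X_mul_of_ne fun h => hij (hx h).symm, if_neg hij]; ring
  rw [HasPartialDegree, Finset.sum_congr rfl fun i _ => h i, Finset.sum_add_distrib,
    ← Finset.mul_sum, hp, mul_smul_comm, Finset.sum_ite_eq' Finset.univ j,
    if_pos (Finset.mem_univ j)]
  push_cast
  rw [add_smul, one_smul, add_comm]

theorem HasPartialDegree.pderiv_of_notMem {x : ι → σ} {n : ℕ} {p : MvPolynomial σ ℂ} {j : σ}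
    (hj : ∀ i, x i ≠ j) (hp : HasPartialDegree x n p) : HasPartialDegree x n (pderiv j p) := by
  have h := congrArg (pderiv j) hp
  rw [map_sum, Derivation.map_smul] at h
  rw [HasPartialDegree, ← h]
  refine Finset.sum_congr rfl fun i _ => ?_
  rw [pderiv_X_mul_of_ne (hj i), pderiv_comm]

/-- Pair Euler's identity with `p` and move each variable to the other side. -/
theorem HasPartialDegree.sum_fischerNormSq_pderiv {x : ι → σ} {n : ℕ} {p : MvPolynomial σ ℂ}
    (hp : HasPartialDegree x n p) : ∑ i, fischerNormSq (pderiv (x i) p) = n * fischerNormSq p := by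
  have h := congrArg (fischer p) hp
  rw [fischer_sum_right, fischer_smul_right, fischer_self] at h
  simp only [fischer_X_mul_right, fischer_self] at h
  exact_mod_cast h

theorem HasPartialDegree.pderiv_eq_zero {x : ι → σ} {p : MvPolynomial σ ℂ}
    (hp : HasPartialDegree x 0 p) (i : ι) : pderiv (x i) p = 0 := by
  have h := hp.sum_fischerNormSq_pderiv
  rw [Nat.cast_zero, zero_mul,
    Finset.sum_eq_zero_iff_of_nonneg fun i _ => fischerNormSq_nonneg _] at h
  exact eq_zero_of_fischerNormSq (h i (Finset.mem_univ i))

theorem HasPartialDegree.pderiv {x : ι → σ} (hx : Function.Injective x) {n : ℕ}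
    {p : MvPolynomial σ ℂ} (j : ι) (hp : HasPartialDegree x n p) :
    HasPartialDegree x (n - 1) (MvPolynomial.pderiv (x j) p) := by
  classical
  -- In degree `0` the truncated `n - 1` is harmless: the derivative vanishes, and the zero
  -- polynomial has every degree.
  rcases n with _ | n
  · rw [hp.pderiv_eq_zero]; exact .zero _ _
  have h := congrArg (MvPolynomial.pderiv (x j)) hp
  rw [map_sum, Derivation.map_smul] at h
  have h' : ∀ i, MvPolynomial.pderiv (x j) (X (x i) * MvPolynomial.pderiv (x i) p) =
      (if i = j then MvPolynomial.pderiv (x j) p else 0) +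
        X (x i) * MvPolynomial.pderiv (x i) (MvPolynomial.pderiv (x j) p) := fun i => by
    by_cases hij : i = j
    · subst hij; rw [pderiv_X_mul_self, if_pos rfl]
    · rw [pderiv_X_mul_of_ne fun h => hij (hx h), if_neg hij, zero_add, pderiv_comm]
  rw [Finset.sum_congr rfl fun i _ => h' i, Finset.sum_add_distrib,
    Finset.sum_ite_eq' Finset.univ j, if_pos (Finset.mem_univ j)] at h
  rw [HasPartialDegree, Nat.add_sub_cancel, ← add_right_inj (MvPolynomial.pderiv (x j) p), h]
  push_cast
  rw [add_smul, one_smul, add_comm]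

/-- The Euler operator is self-adjoint, so eigenvectors for different eigenvalues are orthogonal. -/
theorem fischer_eq_zero_of_partialDegree_ne {x : ι → σ} {m n : ℕ} (h : m ≠ n)
    {p q : MvPolynomial σ ℂ} (hp : HasPartialDegree x m p) (hq : HasPartialDegree x n q) :
    fischer p q = 0 := by
  have h1 := congrArg (fischer p) hq
  have h2 := congrArg (fun r => fischer r q) hp
  simp only [fischer_sum_right, fischer_X_mul_right, fischer_smul_right, fischer_sum_left,
    fischer_X_mul_left, fischer_smul_left, map_natCast] at h1 h2
  rw [h1] at h2
  have h3 : ((n : ℂ) - m) * fischer p q = 0 := by rw [sub_mul, h2, sub_self]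
  rcases mul_eq_zero.mp h3 with h' | h'
  · exact absurd (Nat.cast_injective (sub_eq_zero.mp h')).symm h
  · exact h'

theorem sum_comm_pairs {S : Type*} [Fintype S] {A : Type*} [AddCommMonoid A]
    (f : ι → ι → S → S → A) :
    ∑ c, ∑ c', ∑ s, ∑ t, f c c' s t = ∑ s, ∑ t, ∑ c, ∑ c', f c c' s t := by
  have h : ∀ c, ∑ c', ∑ s, ∑ t, f c c' s t = ∑ s, ∑ t, ∑ c', f c c' s t := fun c => by
    rw [Finset.sum_comm]
    exact Finset.sum_congr rfl fun s _ => Finset.sum_comm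
  simp only [h]
  rw [Finset.sum_comm]
  exact Finset.sum_congr rfl fun s _ => Finset.sum_comm

/-! ### Norm bounds for creation and pair annihilation operators -/

/-- This is the canonical commutation relation `∂_i X_j = δ_ij + X_j ∂_i` in weak form. -/
theorem fischer_X_mul_X_mul {τ : Type*} [DecidableEq τ] {x : τ → σ} (hx : Function.Injective x)
    (i j : τ)
    (p q : MvPolynomial σ ℂ) : fischer (X (x i) * p) (X (x j) * q) =
      (if i = j then fischer p q else 0) + fischer (pderiv (x j) p) (pderiv (x i) q) := by
  rw [fischer_X_mul_left]
  by_cases hij : i = j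
  · subst hij; rw [pderiv_X_mul_self, fischer_add_right, if_pos rfl, fischer_X_mul_right]
  · rw [pderiv_X_mul_of_ne fun h => hij (hx h).symm, if_neg hij, zero_add, fischer_X_mul_right]

theorem fischerNormSq_sum_X_mul (x : ι → σ) (hx : Function.Injective x)
    (w : ι → MvPolynomial σ ℂ) : fischerNormSq (∑ i, X (x i) * w i) =
      ∑ i, fischerNormSq (w i) +
        (∑ i, ∑ j, fischer (pderiv (x j) (w i)) (pderiv (x i) (w j))).re := by
  classical
  rw [fischerNormSq_sum]
  simp only [fischer_X_mul_X_mul hx, Finset.sum_add_distrib, Finset.sum_ite_eq, Finset.mem_univ,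
    if_true, Complex.add_re, Complex.re_sum]
  rfl

/-- The commutation relation leaves a diagonal part and an exchange part. The symmetrised
Cauchy–Schwarz inequality bounds the exchange part by the sum of all derivative norms, which Euler's
identity evaluates to `r` times the diagonal part. -/
theorem fischerNormSq_sum_X_mul_le {x : ι → σ} (hx : Function.Injective x) {r : ℕ}
    {w : ι → MvPolynomial σ ℂ} (hw : ∀ i, HasPartialDegree x r (w i)) :
    fischerNormSq (∑ i, X (x i) * w i) ≤ (r + 1) * ∑ i, fischerNormSq (w i) := by
  have h2 := re_sum_fischer_swap_le Finset.univ fun i j => pderiv (x j) (w i)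
  have h3 : ∀ i, ∑ j, fischerNormSq (pderiv (x j) (w i)) = r * fischerNormSq (w i) := fun i =>
    (hw i).sum_fischerNormSq_pderiv
  simp only [h3, ← Finset.mul_sum] at h2
  rw [fischerNormSq_sum_X_mul x hx]
  linarith

/-- The operator that annihilates the pairs of variables `x c`, `y (c, s)`. -/
noncomputable def pairAnnihilate {S : Type*} (x : ι → σ) (y : ι × S → σ) (s : S)
    (p : MvPolynomial σ ℂ) : MvPolynomial σ ℂ :=
  ∑ c, pderiv (x c) (pderiv (y (c, s)) p)

theorem HasPartialDegree.pairAnnihilate_left {S : Type*} {x : ι → σ} {y : ι × S → σ}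
    (hx : Function.Injective x) (hxy : ∀ i j, x i ≠ y j) {n : ℕ} {p : MvPolynomial σ ℂ} (s : S)
    (hp : HasPartialDegree x n p) : HasPartialDegree x (n - 1) (pairAnnihilate x y s p) :=
  .sum fun c _ => (hp.pderiv_of_notMem fun i => hxy i _).pderiv hx c

theorem HasPartialDegree.pairAnnihilate_right {S : Type*} [Fintype S] {x : ι → σ} {y : ι × S → σ}
    (hy : Function.Injective y) (hxy : ∀ i j, x i ≠ y j) {n : ℕ} {p : MvPolynomial σ ℂ} (s : S)
    (hp : HasPartialDegree y n p) : HasPartialDegree y (n - 1) (pairAnnihilate x y s p) :=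
  .sum fun c _ => (hp.pderiv hy (c, s)).pderiv_of_notMem fun i => (hxy c i).symm

theorem fischer_sum_X_mul_X_mul {S : Type*} [Fintype S] (x : ι → σ) (y : ι × S → σ)
    (w : S → MvPolynomial σ ℂ) (p : MvPolynomial σ ℂ) :
    fischer (∑ s, ∑ c, X (x c) * (X (y (c, s)) * w s)) p =
      ∑ s, fischer (w s) (pairAnnihilate x y s p) := by
  simp only [fischer_sum_left, pairAnnihilate, fischer_sum_right, fischer_X_mul_left, pderiv_comm]

section PairBounds

variable {S : Type*} [Fintype S] {x : ι → σ} {y : ι × S → σ}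

/-- The diagonal part occurs once for each `c`, which gives the cardinality of `ι`. The exchange
parts for all `c` together involve every derivative in a variable `y (c, t)` once, which gives `n`.
-/
theorem sum_fischerNormSq_sum_X_mul_le (hy : Function.Injective y) {n : ℕ}
    {w : S → MvPolynomial σ ℂ} (hw : ∀ s, HasPartialDegree y n (w s)) :
    ∑ c, fischerNormSq (∑ s, X (y (c, s)) * w s) ≤
      ((Fintype.card ι : ℝ) + n) * ∑ s, fischerNormSq (w s) := by
  have h1 : ∀ c, fischerNormSq (∑ s, X (y (c, s)) * w s) ≤ ∑ s, fischerNormSq (w s) +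
      ∑ s, ∑ t, fischerNormSq (pderiv (y (c, t)) (w s)) := fun c => by
    rw [fischerNormSq_sum_X_mul (fun s => y (c, s)) fun s t h => congrArg Prod.snd (hy h)]
    exact add_le_add_right (re_sum_fischer_swap_le Finset.univ
      fun s t => pderiv (y (c, t)) (w s)) _
  refine (Finset.sum_le_sum fun c _ => h1 c).trans ?_
  rw [Finset.sum_add_distrib, Finset.sum_const, Finset.card_univ, nsmul_eq_mul, add_mul]
  refine add_le_add_right (le_of_eq ?_) _
  rw [Finset.sum_comm, Finset.mul_sum]
  refine Finset.sum_congr rfl fun s _ => ?_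
  rw [← (hw s).sum_fischerNormSq_pderiv, Fintype.sum_prod_type]

/-- After the `x`-derivatives have passed the `y`-variables, the contraction term of the commutation
relation forces `c = c'` and `s = t`. In the remaining term the sums over `c` and `c'` separate into
two pair annihilations, which is what makes an induction on the `x`-degree possible. -/
theorem sum_fischer_pderiv_sum_X_mul (hy : Function.Injective y) (hxy : ∀ i j, x i ≠ y j)
    (w : S → MvPolynomial σ ℂ) :
    ∑ c, ∑ c', fischer (pderiv (x c') (∑ s, X (y (c, s)) * w s))
        (pderiv (x c) (∑ s, X (y (c', s)) * w s)) =
      ∑ s, ∑ c, fischer (pderiv (x c) (w s)) (pderiv (x c) (w s)) +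
        ∑ s, ∑ t, fischer (pairAnnihilate x y t (w s)) (pairAnnihilate x y s (w t)) := by
  classical
  have hd : ∀ c c', pderiv (x c') (∑ s, X (y (c, s)) * w s) =
      ∑ s, X (y (c, s)) * pderiv (x c') (w s) := fun c c' => by
    rw [map_sum]
    exact Finset.sum_congr rfl fun s _ => pderiv_X_mul_of_ne (hxy _ _).symm _
  have h1 : ∀ c c', fischer (pderiv (x c') (∑ s, X (y (c, s)) * w s))
        (pderiv (x c) (∑ s, X (y (c', s)) * w s)) =
      (if c = c' then ∑ s, fischer (pderiv (x c) (w s)) (pderiv (x c) (w s)) else 0) +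
      ∑ s, ∑ t, fischer (pderiv (x c') (pderiv (y (c', t)) (w s)))
        (pderiv (x c) (pderiv (y (c, s)) (w t))) := fun c c' => by
    rw [hd, hd, fischer_sum_left]
    simp only [fischer_sum_right, fischer_X_mul_X_mul hy, Finset.sum_add_distrib, Prod.mk.injEq]
    refine congrArg₂ (· + ·) ?_ ?_
    · by_cases hc : c = c'
      · subst hc; simp
      · simp [hc]
    · refine Finset.sum_congr rfl fun s _ => Finset.sum_congr rfl fun t _ => ?_
      rw [pderiv_comm, pderiv_comm (y (c, s))]
  simp only [h1, Finset.sum_add_distrib, Finset.sum_ite_eq, Finset.mem_univ, if_true]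
  congr 1
  · exact Finset.sum_comm
  · refine (sum_comm_pairs _).trans ?_
    simp only [pairAnnihilate, fischer_sum_left, fischer_sum_right]

theorem re_sum_fischer_pairAnnihilate_le {m : ℕ} {C : ℝ} {w : S → MvPolynomial σ ℂ}
    (hw : ∀ s, HasPartialDegree x m (w s))
    (hC : ∀ s, ∑ t, fischerNormSq (pairAnnihilate x y t (w s)) ≤ C * fischerNormSq (w s)) :
    (∑ s, ∑ c, fischer (pderiv (x c) (w s)) (pderiv (x c) (w s)) +
        ∑ s, ∑ t, fischer (pairAnnihilate x y t (w s)) (pairAnnihilate x y s (w t))).re ≤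
      (m + C) * ∑ s, fischerNormSq (w s) := by
  rw [Complex.add_re, add_mul, Finset.mul_sum, Finset.mul_sum]
  refine add_le_add (le_of_eq ?_) ?_
  · rw [Complex.re_sum]
    refine Finset.sum_congr rfl fun s _ => ?_
    rw [← (hw s).sum_fischerNormSq_pderiv, Complex.re_sum]; rfl
  · exact (re_sum_fischer_swap_le _ _).trans (Finset.sum_le_sum fun s _ => hC s)

/-- The Casimir-type bound for the annihilation of a pair, one half of which is at one of the
sites `s`. -/
theorem sum_fischerNormSq_pairAnnihilate_le
    (hx : Function.Injective x) (hy : Function.Injective y) (hxy : ∀ i j, x i ≠ y j)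
    (hι : 1 ≤ Fintype.card ι) (m n : ℕ) {v : MvPolynomial σ ℂ} (hvx : HasPartialDegree x m v)
    (hvy : HasPartialDegree y n v) :
    ∑ s, fischerNormSq (pairAnnihilate x y s v) ≤
      m * ((n : ℝ) + Fintype.card ι - 1) * fischerNormSq v := by
  have h1 : (1 : ℝ) ≤ Fintype.card ι := by exact_mod_cast hι
  induction m generalizing n v with
  | zero =>
    have : ∀ s, pairAnnihilate x y s v = 0 := fun s => by
      refine Finset.sum_eq_zero fun c _ => ?_
      rw [pderiv_comm, hvx.pderiv_eq_zero, map_zero]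
    simp [this]
  | succ m ih =>
    rcases n with _ | n
    · have : ∀ s, pairAnnihilate x y s v = 0 := fun s => by
        refine Finset.sum_eq_zero fun c _ => ?_
        rw [hvy.pderiv_eq_zero, map_zero]
      simp only [this, fischerNormSq_zero, Finset.sum_const_zero]
      refine mul_nonneg (mul_nonneg (by positivity) ?_) (fischerNormSq_nonneg _)
      push_cast; linarith
    set w : S → MvPolynomial σ ℂ := fun s => pairAnnihilate x y s v with hw
    have hwx : ∀ s, HasPartialDegree x m (w s) := fun s => hvx.pairAnnihilate_left hx hxy s
    have hwy : ∀ s, HasPartialDegree y n (w s) := fun s => hvy.pairAnnihilate_right hy hxy s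
    -- With `A` the family of pair annihilations, `w = A v` and `u = A† A v`. Bounding `A†` on the
    -- lower degrees where `w` lives bounds `A` on `v` by duality.
    set u := ∑ s, ∑ c, X (x c) * (X (y (c, s)) * w s) with hu
    have huv : (fischer u v).re = ∑ s, fischerNormSq (w s) := by
      rw [hu, fischer_sum_X_mul_X_mul, Complex.re_sum]; rfl
    have hu' : u = ∑ c, X (x c) * ∑ s, X (y (c, s)) * w s := by
      rw [hu, Finset.sum_comm]; simp only [Finset.mul_sum]
    set C : ℝ := ((m + 1 : ℕ) : ℝ) * (((n + 1 : ℕ) : ℝ) + Fintype.card ι - 1) with hC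
    have hbound : fischerNormSq u ≤ C * ∑ s, fischerNormSq (w s) := by
      rw [hu', fischerNormSq_sum_X_mul x hx, sum_fischer_pderiv_sum_X_mul hy hxy]
      -- The contributions `card ι + n` and, by the induction hypothesis for `w`, `m + m (n + card ι
      -- - 1)` add up to `(m + 1) (n + card ι)`, which is `C`.
      refine (add_le_add (sum_fischerNormSq_sum_X_mul_le hy hwy)
        (re_sum_fischer_pairAnnihilate_le hwx fun s => ih n (hwx s) (hwy s))).trans (le_of_eq ?_)
      rw [hC]; push_cast; ring
    have hCpos : 0 < C := by
      refine mul_pos (by positivity) ?_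
      push_cast
      have : (0 : ℝ) ≤ n := Nat.cast_nonneg n
      linarith
    -- Scaling `v` by `C` balances the two sides: `2 C ‖w‖² ≤ ‖u‖² + C² ‖v‖²` and `‖u‖² ≤ C ‖w‖²`
    -- give `‖w‖² ≤ C ‖v‖²`.
    have h5 := two_mul_re_fischer_le u ((C : ℂ) • v)
    rw [fischer_smul_right, Complex.re_ofReal_mul, huv, fischerNormSq_smul, Complex.normSq_ofReal]
      at h5
    have h6 : C * ∑ s, fischerNormSq (w s) ≤ C * (C * fischerNormSq v) := by linarith
    exact le_of_mul_le_mul_left h6 hCpos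

end PairBounds

end Fischer

/-! ### The Fock space of the cloning problem -/

section CloningFock

open MvPolynomial

/-- The modes of the Fock space: the input, an auxiliary copy of it, one output at each of the `N`
sites, and one marker for each site. -/
inductive CloningMode (d N : ℕ) : Type
  | input (c : Fin d)
  | aux (c : Fin d)
  | output (c : Fin d × Fin N)
  | mark (s : Fin N)

/-- Multiplication by a variable. -/
noncomputable def creation {σ : Type*} (i : σ) : Module.End ℂ (MvPolynomial σ ℂ) :=
  LinearMap.mulLeft ℂ (X i)

/-- The derivative with respect to a variable. -/
noncomputable def annihilation {σ : Type*} (i : σ) : Module.End ℂ (MvPolynomial σ ℂ) :=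
  (pderiv i).toLinearMap

@[simp] theorem creation_apply {σ : Type*} (i : σ) (p : MvPolynomial σ ℂ) :
    creation i p = X i * p := rfl

@[simp] theorem annihilation_apply {σ : Type*} (i : σ) (p : MvPolynomial σ ℂ) :
    annihilation i p = pderiv i p := rfl

theorem commute_creation {σ : Type*} (i j : σ) : Commute (creation i) (creation j) :=
  LinearMap.ext fun p => mul_left_comm (X i) (X j) p

theorem commute_annihilation {σ : Type*} (i j : σ) :
    Commute (annihilation i) (annihilation j) :=
  LinearMap.ext fun p => pderiv_comm i j p

theorem commute_annihilation_creation {σ : Type*} {i j : σ} (h : j ≠ i) :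
    Commute (annihilation i) (creation j) :=
  LinearMap.ext fun p => pderiv_X_mul_of_ne h p

variable {d N : ℕ}

open CloningMode

/-- The polynomial algebra of the modes. -/
abbrev CloningFock (d N : ℕ) : Type := MvPolynomial (CloningMode d N) ℂ

/-- Marks a site and annihilates its output against the input. -/
noncomputable def contractSites (d N : ℕ) : Module.End ℂ (CloningFock d N) :=
  ∑ s, ∑ c, creation (mark s) * (annihilation (input c) * annihilation (output (c, s)))

/-- Marks a site and moves its output into the auxiliary modes. -/
noncomputable def collectSites (d N : ℕ) : Module.End ℂ (CloningFock d N) :=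
  ∑ s, ∑ c, creation (mark s) * (creation (aux c) * annihilation (output (c, s)))

theorem contractSites_apply (p : CloningFock d N) :
    contractSites d N p = ∑ s, X (mark s) * pairAnnihilate input output s p := by
  simp [contractSites, pairAnnihilate, LinearMap.sum_apply, Finset.mul_sum]

theorem collectSites_apply (p : CloningFock d N) :
    collectSites d N p = ∑ s, X (mark s) * ∑ c, X (aux c) * pderiv (output (c, s)) p := by
  simp [collectSites, LinearMap.sum_apply, Finset.mul_sum]

/-- The two operators never create and annihilate in the same mode: the modes created are `mark` and
`aux`, the modes annihilated are `input` and `output`. -/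
theorem commute_collectSites_contractSites :
    Commute (collectSites d N) (contractSites d N) := by
  refine Commute.sum_left _ _ _ fun s _ => Commute.sum_left _ _ _ fun c _ =>
    Commute.sum_right _ _ _ fun t _ => Commute.sum_right _ _ _ fun c' _ => ?_
  refine Commute.mul_left ?_ (Commute.mul_left ?_ ?_) <;>
    refine Commute.mul_right ?_ (Commute.mul_right ?_ ?_)
  · exact commute_creation _ _
  · exact (commute_annihilation_creation (by simp)).symm
  · exact (commute_annihilation_creation (by simp)).symm
  · exact commute_creation _ _
  · exact (commute_annihilation_creation (by simp)).symm
  · exact (commute_annihilation_creation (by simp)).symm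
  · exact commute_annihilation_creation (by simp)
  · exact commute_annihilation _ _
  · exact commute_annihilation _ _

theorem input_injective : Function.Injective (input : Fin d → CloningMode d N) :=
  fun _ _ h => by injection h

theorem aux_injective : Function.Injective (aux : Fin d → CloningMode d N) :=
  fun _ _ h => by injection h

theorem output_injective : Function.Injective (output : Fin d × Fin N → CloningMode d N) :=
  fun _ _ h => by injection h

theorem mark_injective : Function.Injective (mark : Fin N → CloningMode d N) :=
  fun _ _ h => by injection h

/-- The degrees with respect to the four kinds of modes. -/
structure HasCloningDegree (m r n t : ℕ) (p : CloningFock d N) : Prop where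
  input : HasPartialDegree input m p
  aux : HasPartialDegree aux r p
  output : HasPartialDegree output n p
  mark : HasPartialDegree mark t p

variable {m r n t : ℕ} {p : CloningFock d N}

theorem HasCloningDegree.pairAnnihilate (hp : HasCloningDegree m r n t p) (s : Fin N) :
    HasCloningDegree (m - 1) r (n - 1) t
      (pairAnnihilate CloningMode.input CloningMode.output s p) where
  input := hp.input.pairAnnihilate_left input_injective (by simp) s
  output := hp.output.pairAnnihilate_right output_injective (by simp) s
  aux := .sum fun c _ => (hp.aux.pderiv_of_notMem (by simp)).pderiv_of_notMem (by simp)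
  mark := .sum fun c _ => (hp.mark.pderiv_of_notMem (by simp)).pderiv_of_notMem (by simp)

theorem HasCloningDegree.contractSites (hp : HasCloningDegree m r n t p) :
    HasCloningDegree (m - 1) r (n - 1) (t + 1) (contractSites d N p) := by
  rw [contractSites_apply]
  have h := hp.pairAnnihilate
  exact ⟨.sum fun s _ => (h s).input.X_mul_of_notMem (by simp),
    .sum fun s _ => (h s).aux.X_mul_of_notMem (by simp),
    .sum fun s _ => (h s).output.X_mul_of_notMem (by simp),
    .sum fun s _ => (h s).mark.X_mul mark_injective s⟩

theorem HasCloningDegree.collect (hp : HasCloningDegree m r n t p) (s : Fin N) :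
    HasCloningDegree m (r + 1) (n - 1) t
      (∑ c, X (CloningMode.aux c) * pderiv (CloningMode.output (c, s)) p) where
  input := .sum fun c _ => (hp.input.pderiv_of_notMem (by simp)).X_mul_of_notMem (by simp)
  output := .sum fun c _ => (hp.output.pderiv output_injective (c, s)).X_mul_of_notMem (by simp)
  aux := .sum fun c _ => (hp.aux.pderiv_of_notMem (by simp)).X_mul aux_injective c
  mark := .sum fun c _ => (hp.mark.pderiv_of_notMem (by simp)).X_mul_of_notMem (by simp)

theorem HasCloningDegree.collectSites (hp : HasCloningDegree m r n t p) :
    HasCloningDegree m (r + 1) (n - 1) (t + 1) (collectSites d N p) := by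
  rw [collectSites_apply]
  have h := hp.collect
  exact ⟨.sum fun s _ => (h s).input.X_mul_of_notMem (by simp),
    .sum fun s _ => (h s).aux.X_mul_of_notMem (by simp),
    .sum fun s _ => (h s).output.X_mul_of_notMem (by simp),
    .sum fun s _ => (h s).mark.X_mul mark_injective s⟩

theorem HasCloningDegree.contractSites_pow (hp : HasCloningDegree m r n t p) (k : ℕ) :
    HasCloningDegree (m - k) r (n - k) (t + k) ((_root_.contractSites d N ^ k) p) := by
  induction k with
  | zero => simpa using hp
  | succ k ih =>
    rw [pow_succ', Module.End.mul_apply]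
    have := ih.contractSites
    rwa [Nat.sub_sub, Nat.sub_sub, add_assoc] at this

theorem HasCloningDegree.collectSites_pow (hp : HasCloningDegree m r n t p) (k : ℕ) :
    HasCloningDegree m (r + k) (n - k) (t + k) ((_root_.collectSites d N ^ k) p) := by
  induction k with
  | zero => simpa using hp
  | succ k ih =>
    rw [pow_succ', Module.End.mul_apply]
    have := ih.collectSites
    rwa [Nat.sub_sub, add_assoc, add_assoc] at this

/-- The marker costs `t + 1`, and the annihilated pair costs the Casimir factor. -/
theorem fischerNormSq_contractSites_le (hd : 1 ≤ d) (hp : HasCloningDegree m r n t p) :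
    fischerNormSq (contractSites d N p) ≤
      (t + 1) * (m * ((n : ℝ) + d - 1)) * fischerNormSq p := by
  rw [contractSites_apply, mul_assoc]
  refine (fischerNormSq_sum_X_mul_le mark_injective fun s => (hp.pairAnnihilate s).mark).trans ?_
  refine mul_le_mul_of_nonneg_left ?_ (by positivity)
  have := sum_fischerNormSq_pairAnnihilate_le input_injective output_injective (by simp)
    (by simpa using hd) m n hp.input hp.output
  simpa using this

/-- The three factors come from creating a marker, creating an auxiliary letter and removing an
output letter. -/
theorem fischerNormSq_collectSites_le (hp : HasCloningDegree m r n t p) :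
    fischerNormSq (collectSites d N p) ≤ (t + 1) * ((r + 1) * n) * fischerNormSq p := by
  rw [collectSites_apply, mul_assoc]
  refine (fischerNormSq_sum_X_mul_le mark_injective fun s => (hp.collect s).mark).trans ?_
  refine mul_le_mul_of_nonneg_left ?_ (by positivity)
  have h1 : ∀ s, fischerNormSq (∑ c, X (CloningMode.aux c) *
      pderiv (CloningMode.output (c, s)) p) ≤
      (r + 1) * ∑ c, fischerNormSq (pderiv (CloningMode.output (c, s)) p) := fun s =>
    fischerNormSq_sum_X_mul_le aux_injective fun c => hp.aux.pderiv_of_notMem (by simp)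
  refine (Finset.sum_le_sum fun s _ => h1 s).trans (le_of_eq ?_)
  rw [← Finset.mul_sum, mul_assoc, ← hp.output.sum_fischerNormSq_pderiv,
    Fintype.sum_prod_type_right]

/-- Step number `j`, counted from `0`, contributes `(j + 1) (M - j) (n + e - j)`; the assumption `k
≤ n` keeps the truncated subtractions honest. -/
theorem fischerNormSq_contractSites_pow_le {M e : ℕ} (hd : d = e + 1) {k : ℕ} (hk : k ≤ n)
    (hp : HasCloningDegree M r n 0 p) :
    fischerNormSq ((contractSites d N ^ k) p) ≤
      ((k.factorial * M.descFactorial k * (n + e).descFactorial k : ℕ) : ℝ) *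
        fischerNormSq p := by
  induction k with
  | zero => simp
  | succ k ih =>
    rw [pow_succ', Module.End.mul_apply]
    refine (fischerNormSq_contractSites_le (by omega) (hp.contractSites_pow k)).trans ?_
    have h1 : (((n - k : ℕ) : ℝ) + d - 1) = ((n + e - k : ℕ) : ℝ) := by
      rw [show n + e - k = (n - k) + e by omega, hd]; push_cast; ring
    rw [h1]
    refine (mul_le_mul_of_nonneg_left (ih (by omega)) (by positivity)).trans (le_of_eq ?_)
    rw [Nat.factorial_succ, Nat.descFactorial_succ, Nat.descFactorial_succ, zero_add]
    push_cast
    ring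

theorem fischerNormSq_collectSites_pow_le (hp : HasCloningDegree m 0 n t p) (k : ℕ) :
    fischerNormSq ((collectSites d N ^ k) p) ≤
      (((t + 1).ascFactorial k * k.factorial * n.descFactorial k : ℕ) : ℝ) *
        fischerNormSq p := by
  induction k with
  | zero => simp
  | succ k ih =>
    rw [pow_succ', Module.End.mul_apply]
    refine (fischerNormSq_collectSites_le (hp.collectSites_pow k)).trans ?_
    refine (mul_le_mul_of_nonneg_left ih (by positivity)).trans (le_of_eq ?_)
    rw [Nat.factorial_succ, Nat.descFactorial_succ, Nat.ascFactorial_succ, zero_add]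
    push_cast
    ring

/-- The bound on the operator that marks `L` sites and acts there with the normal operators
`aux + ∂ input`. -/
theorem fischerNormSq_add_pow_le {M e L : ℕ} (hd : d = e + 1) (hL : L ≤ n)
    (hp : HasCloningDegree M 0 n 0 p) :
    fischerNormSq (((collectSites d N + contractSites d N) ^ L) p) ≤
      (∑ k ∈ Finset.range (L + 1), (L.choose k : ℝ) ^ 2 *
        (((k + 1).ascFactorial (L - k) * (L - k).factorial * (n - k).descFactorial (L - k) : ℕ) *
          (k.factorial * M.descFactorial k * (n + e).descFactorial k : ℕ))) *
        fischerNormSq p := by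
  have h : ((collectSites d N + contractSites d N) ^ L) p =
      ∑ k ∈ Finset.range (L + 1),
        ((L.choose k : ℂ) • (collectSites d N ^ (L - k)) ((contractSites d N ^ k) p)) := by
    rw [add_comm, commute_collectSites_contractSites.symm.add_pow, LinearMap.sum_apply]
    refine Finset.sum_congr rfl fun k _ => ?_
    rw [(commute_collectSites_contractSites.symm.pow_pow _ _).eq, ← nsmul_eq_mul',
      LinearMap.smul_apply, Module.End.mul_apply, Nat.cast_smul_eq_nsmul]
  have hdeg : ∀ k, HasCloningDegree (M - k) (0 + (L - k)) (n - k - (L - k)) (0 + k + (L - k))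
      ((collectSites d N ^ (L - k)) ((contractSites d N ^ k) p)) := fun k =>
    (hp.contractSites_pow k).collectSites_pow (L - k)
  -- The `k`-th term has degree `L - k` in the auxiliary variables, so the squared norms simply add.
  rw [h, fischerNormSq_sum_of_orthogonal, Finset.sum_mul]
  · refine Finset.sum_le_sum fun k hk => ?_
    have hk : k ≤ L := Nat.lt_succ_iff.mp (Finset.mem_range.mp hk)
    rw [fischerNormSq_smul, mul_assoc, ← Complex.ofReal_natCast, Complex.normSq_ofReal, ← sq]
    refine mul_le_mul_of_nonneg_left ?_ (by positivity)
    refine (fischerNormSq_collectSites_pow_le (hp.contractSites_pow k) _).trans ?_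
    rw [zero_add, mul_assoc (Nat.cast _ : ℝ)]
    exact mul_le_mul_of_nonneg_left
      (fischerNormSq_contractSites_pow_le hd (hk.trans hL) hp) (Nat.cast_nonneg _)
  · intro i hi j hj hij
    have hi : i ≤ L := Nat.lt_succ_iff.mp (Finset.mem_range.mp hi)
    have hj : j ≤ L := Nat.lt_succ_iff.mp (Finset.mem_range.mp hj)
    refine fischer_eq_zero_of_partialDegree_ne (m := 0 + (L - i)) (n := 0 + (L - j)) (by omega)
      ((hdeg i).aux.smul _) ((hdeg j).aux.smul _)

end CloningFock

/-! ### Symmetric tensors -/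

section SymmetricTensors

variable {ι κ : Type*} [Fintype ι]

/-- Equal letter counts make the fibres of `a` and `b` over each letter equinumerous; bijections of
the fibres glue to a permutation. -/
theorem exists_perm_of_sum_single_eq {a b : ι → κ}
    (h : ∑ i, Finsupp.single (a i) 1 = (∑ i, Finsupp.single (b i) 1 : κ →₀ ℕ)) :
    ∃ π : Equiv.Perm ι, b ∘ π = a := by
  classical
  have hcard : ∀ c, Nonempty ({i // a i = c} ≃ {i // b i = c}) := fun c => by
    have hc := DFunLike.congr_fun h c
    simp only [Finsupp.finsetSum_apply, Finsupp.single_apply] at hc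
    rw [← Fintype.card_eq, Fintype.card_subtype, Fintype.card_subtype, Finset.card_filter,
      Finset.card_filter]
    exact hc
  have e := fun c => (hcard c).some
  refine ⟨((Equiv.sigmaFiberEquiv a).symm.trans (Equiv.sigmaCongrRight e)).trans
    (Equiv.sigmaFiberEquiv b), funext fun i => ?_⟩
  exact (e (a i) ⟨i, rfl⟩).2

theorem prod_comp_perm {R : Type*} [CommMonoid R] (φ : κ → R) (π : Equiv.Perm ι) (a : ι → κ) :
    ∏ i, φ ((a ∘ π) i) = ∏ i, φ (a i) := Equiv.prod_comp π fun i => φ (a i)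

variable [DecidableEq ι]

section

variable [Fintype κ]

theorem sum_pi_prod_mul {R : Type*} [CommSemiring R] (f : ι → κ → R) :
    ∑ a : ι → κ, ∏ i, f i (a i) = ∏ i, ∑ c, f i c := by
  rw [Finset.prod_univ_sum, Fintype.piFinset_univ]

/-- Polarization: a symmetric tensor is determined by its values on powers. -/
theorem eq_zero_of_symmetric {f : (ι → κ) → ℂ} (hf : ∀ (π : Equiv.Perm ι) a, f (a ∘ π) = f a)
    (h : ∀ φ : κ → ℂ, ∑ a, f a * ∏ i, φ (a i) = 0) : f = 0 := by
  classical
  -- The hypothesis says that this polynomial vanishes at every point. Its coefficient at the letter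
  -- count of `a` is `f a` times the number of rearrangements of `a`.
  have hQ : (∑ a : ι → κ, MvPolynomial.monomial (∑ i, Finsupp.single (a i) 1) (f a)) = 0 := by
    refine MvPolynomial.funext fun φ => ?_
    rw [map_sum, map_zero, ← h φ]
    refine Finset.sum_congr rfl fun a _ => ?_
    rw [MvPolynomial.eval_monomial, Finsupp.prod_fintype _ _ fun _ => pow_zero _]
    congr 1
    simp only [Finsupp.finsetSum_apply, Finsupp.single_apply]
    rw [← Finset.prod_fiberwise_of_maps_to (t := Finset.univ) (g := a) fun _ _ => Finset.mem_univ _]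
    refine Finset.prod_congr rfl fun c _ => ?_
    rw [Finset.prod_congr rfl (g := fun _ => φ c) fun i hi => by rw [(Finset.mem_filter.mp hi).2],
      Finset.prod_const, Finset.card_filter]
  funext a
  have hc := congrArg (MvPolynomial.coeff (∑ i, Finsupp.single (a i) 1)) hQ
  rw [MvPolynomial.coeff_sum, MvPolynomial.coeff_zero] at hc
  have h1 : ∀ b : ι → κ, MvPolynomial.coeff (∑ i, Finsupp.single (a i) 1)
      (MvPolynomial.monomial (∑ i, Finsupp.single (b i) 1) (f b)) =
      if (∑ i, Finsupp.single (b i) 1 : κ →₀ ℕ) = ∑ i, Finsupp.single (a i) 1 then f a else 0 :=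
    fun b => by
      rw [MvPolynomial.coeff_monomial]
      split_ifs with hb
      · obtain ⟨π, rfl⟩ := exists_perm_of_sum_single_eq hb
        exact hf π a
      · rfl
  rw [Finset.sum_congr rfl fun b _ => h1 b, ← Finset.sum_filter, Finset.sum_const, nsmul_eq_mul,
    mul_eq_zero] at hc
  rcases hc with hc | hc
  · rw [Nat.cast_eq_zero, Finset.card_eq_zero, Finset.filter_eq_empty_iff] at hc
    exact absurd rfl (hc (Finset.mem_univ a))
  · exact hc

end

variable [DecidableEq κ]

/-- The projection onto symmetric tensors. -/
noncomputable def symProj (ι κ : Type*) [Fintype ι] [DecidableEq ι] [DecidableEq κ] :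
    Matrix (ι → κ) (ι → κ) ℂ :=
  Matrix.of fun a b =>
    ((Fintype.card ι).factorial : ℂ)⁻¹ * ∑ π : Equiv.Perm ι, if a ∘ π = b then 1 else 0

theorem symProj_apply (a b : ι → κ) : symProj ι κ a b =
    ((Fintype.card ι).factorial : ℂ)⁻¹ * ∑ π : Equiv.Perm ι, if a ∘ π = b then 1 else 0 := rfl

theorem symProj_comm (a b : ι → κ) : symProj ι κ a b = symProj ι κ b a := by
  rw [symProj_apply, symProj_apply, ← Equiv.sum_comp (Equiv.inv (Equiv.Perm ι))]
  refine congrArg _ (Finset.sum_congr rfl fun π _ => ?_)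
  refine if_congr ⟨?_, ?_⟩ rfl rfl
  · rintro rfl
    funext i
    simp
  · rintro rfl
    funext i
    simp

theorem symProj_comp_perm_left (π : Equiv.Perm ι) (a b : ι → κ) :
    symProj ι κ (a ∘ π) b = symProj ι κ a b := by
  rw [symProj_apply, symProj_apply, ← Equiv.sum_comp (Equiv.mulLeft π⁻¹)]
  refine congrArg _ (Finset.sum_congr rfl fun τ _ => ?_)
  refine if_congr (iff_of_eq (congrArg (· = b) (funext fun i => ?_))) rfl rfl
  simp

theorem symProj_comp_perm_right (π : Equiv.Perm ι) (a b : ι → κ) :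
    symProj ι κ a (b ∘ π) = symProj ι κ a b := by
  rw [symProj_comm, symProj_comp_perm_left, symProj_comm]

theorem conj_symProj (a b : ι → κ) :
    (starRingEnd ℂ) (symProj ι κ a b) = symProj ι κ a b := by
  rw [symProj_apply, map_mul, map_inv₀, map_natCast, map_sum]
  simp only [apply_ite (starRingEnd ℂ), map_one, map_zero]

theorem symProj_conjTranspose : (symProj ι κ).conjTranspose = symProj ι κ := by
  ext a b
  rw [Matrix.conjTranspose_apply, ← symProj_comm, ← starRingEnd_apply, conj_symProj]

variable [Fintype κ]

theorem sum_symProj_mul (a : ι → κ) (f : (ι → κ) → ℂ) :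
    ∑ b, symProj ι κ a b * f b =
      ((Fintype.card ι).factorial : ℂ)⁻¹ * ∑ π : Equiv.Perm ι, f (a ∘ π) := by
  simp only [symProj_apply, mul_assoc, ← Finset.mul_sum, Finset.sum_mul]
  rw [Finset.sum_comm]
  simp

theorem sum_symProj_mul_of_symmetric (a : ι → κ) {f : (ι → κ) → ℂ}
    (hf : ∀ (π : Equiv.Perm ι) a, f (a ∘ π) = f a) : ∑ b, symProj ι κ a b * f b = f a := by
  rw [sum_symProj_mul, Finset.sum_congr rfl fun π _ => hf π a, Finset.sum_const, Finset.card_univ,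
    Fintype.card_perm, nsmul_eq_mul, ← mul_assoc, inv_mul_cancel₀, one_mul]
  exact_mod_cast Nat.factorial_ne_zero _

theorem sum_symProj_mul_prod (a : ι → κ) (φ : κ → ℂ) :
    ∑ b, symProj ι κ a b * ∏ i, φ (b i) = ∏ i, φ (a i) :=
  sum_symProj_mul_of_symmetric a fun π a => prod_comp_perm φ π a

theorem symProj_mul_self : symProj ι κ * symProj ι κ = symProj ι κ := by
  ext a b
  rw [Matrix.mul_apply]
  exact sum_symProj_mul_of_symmetric a fun π a => symProj_comp_perm_left π a b

/-- A matrix that is symmetric in both indices and agrees with the symmetric projection on powers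
of vectors is the symmetric projection. -/
theorem eq_smul_symProj {A : Matrix (ι → κ) (ι → κ) ℂ} {c : ℂ}
    (hl : ∀ (π : Equiv.Perm ι) a b, A (a ∘ π) b = A a b)
    (hr : ∀ (π : Equiv.Perm ι) a b, A a (b ∘ π) = A a b)
    (h : ∀ x y : κ → ℂ, ∑ a, ∑ b, A a b * ((∏ i, x (a i)) * ∏ i, y (b i)) =
      c * (∑ k, x k * y k) ^ Fintype.card ι) : A = c • symProj ι κ := by
  have hP : ∀ x y : κ → ℂ, ∑ a, ∑ b, symProj ι κ a b * ((∏ i, x (a i)) * ∏ i, y (b i)) =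
      (∑ k, x k * y k) ^ Fintype.card ι := fun x y => by
    have : ∀ a : ι → κ, ∑ b, symProj ι κ a b * ((∏ i, x (a i)) * ∏ i, y (b i)) =
        ∏ i, x (a i) * y (a i) := fun a => by
      rw [Finset.prod_mul_distrib, ← sum_symProj_mul_prod a y, Finset.mul_sum]
      exact Finset.sum_congr rfl fun b _ => by ring
    rw [Finset.sum_congr rfl fun a _ => this a, sum_pi_prod_mul fun _ k => x k * y k,
      Finset.prod_const, Finset.card_univ]
  -- Polarize in the first index with a power of `y` held fixed in the second, then polarize in the
  -- second.
  have h1 : ∀ y : κ → ℂ, (fun a => ∑ b, (A a b - c * symProj ι κ a b) * ∏ i, y (b i)) = 0 :=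
    fun y => by
      refine eq_zero_of_symmetric (fun π a => ?_) fun x => ?_
      · simp only [hl, symProj_comp_perm_left]
      · have h2 := h x y
        rw [← hP, ← sub_eq_zero, Finset.mul_sum, ← Finset.sum_sub_distrib] at h2
        rw [← h2]
        refine Finset.sum_congr rfl fun a _ => ?_
        rw [Finset.mul_sum, ← Finset.sum_sub_distrib, Finset.sum_mul]
        exact Finset.sum_congr rfl fun b _ => by ring
  ext a b
  have h3 : (fun b => A a b - c * symProj ι κ a b) = 0 := by
    refine eq_zero_of_symmetric (fun π b => ?_) fun y => ?_
    · simp only [hr, symProj_comp_perm_right]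
    · exact congrFun (h1 y) a
  simpa [sub_eq_zero] using congrFun h3 b

end SymmetricTensors

/-! ### Fischer products of monomials and the dimension of the symmetric subspace. -/

section FischerTensors

open MvPolynomial

variable {ι κ σ : Type*} [Fintype ι] [DecidableEq ι] [Fintype κ]

/-- Moving the variables across one by one differentiates the power of a linear form: each
derivative lowers the exponent and releases one value `φ (a i)`. -/
theorem fischer_prod_X_pow {x : κ → σ} (hx : Function.Injective x) {τ : Type*} (s : Finset τ)
    (a : τ → κ) (φ : κ → ℂ) :
    fischer (∏ i ∈ s, X (x (a i))) ((∑ c, φ c • X (x c)) ^ s.card) =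
      s.card.factorial * ∏ i ∈ s, φ (a i) := by
  classical
  induction s using Finset.induction_on with
  | empty =>
    rw [Finset.prod_empty, Finset.card_empty, pow_zero, ← C_1, ← monomial_zero',
      fischer_monomial_left]
    simp
  | insert i s hi ih =>
    have hd : pderiv (x (a i)) (∑ c, φ c • X (x c)) = C (φ (a i)) := by
      rw [map_sum, Finset.sum_eq_single (a i)]
      · rw [Derivation.map_smul, pderiv_X_self, smul_eq_C_mul, mul_one]
      · intro c _ hc
        rw [Derivation.map_smul, pderiv_X_of_ne fun h => hc (hx h), smul_zero]
      · exact fun h => absurd (Finset.mem_univ _) h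
    rw [Finset.prod_insert hi, fischer_X_mul_left, Finset.card_insert_of_notMem hi, pderiv_pow,
      hd, Nat.add_sub_cancel, Finset.prod_insert hi, Nat.factorial_succ]
    rw [show ((s.card + 1 : ℕ) : MvPolynomial σ ℂ) * (∑ c, φ c • X (x c)) ^ s.card * C (φ (a i)) =
      (((s.card + 1 : ℕ) : ℂ) * φ (a i)) • (∑ c, φ c • X (x c)) ^ s.card by
        rw [smul_eq_C_mul, C_mul, map_natCast]; ring, fischer_smul_right, ih]
    push_cast
    ring

variable [DecidableEq κ]

/-- Both sides are invariant under permuting either string, so by `eq_smul_symProj` it suffices to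
compare them on powers of vectors, where `fischer_prod_X_pow` applies. -/
theorem fischer_prod_X_prod_X {x : κ → σ} (hx : Function.Injective x) (a b : ι → κ) :
    fischer (∏ i, X (x (a i))) (∏ i, X (x (b i))) =
      (Fintype.card ι).factorial * symProj ι κ a b := by
  have h := eq_smul_symProj (ι := ι) (κ := κ)
    (A := Matrix.of fun a b => fischer (∏ i, X (x (a i))) (∏ i, X (x (b i))))
    (c := (Fintype.card ι).factorial)
    (fun π a b => by
      simp only [Matrix.of_apply]
      rw [prod_comp_perm (fun c => (X (x c) : MvPolynomial σ ℂ)) π a])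
    (fun π a b => by
      simp only [Matrix.of_apply]
      rw [prod_comp_perm (fun c => (X (x c) : MvPolynomial σ ℂ)) π b])
    (fun φ y => by
      have h1 : ∀ a : ι → κ, ∑ b : ι → κ, fischer (∏ i, X (x (a i))) (∏ i, X (x (b i))) *
          ((∏ i, φ (a i)) * ∏ i, y (b i)) =
          (Fintype.card ι).factorial * ∏ i, φ (a i) * y (a i) := fun a => by
        have h2 := fischer_prod_X_pow hx Finset.univ a y
        rw [← Finset.prod_const, ← sum_pi_prod_mul (fun _ c => y c • (X (x c) : MvPolynomial σ ℂ)),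
          fischer_sum_right] at h2
        rw [Finset.prod_mul_distrib, mul_left_comm, ← Finset.card_univ, ← h2, Finset.mul_sum]
        refine Finset.sum_congr rfl fun b _ => ?_
        simp only [smul_eq_C_mul, Finset.prod_mul_distrib]
        rw [← map_prod C, ← smul_eq_C_mul, fischer_smul_right]
        ring
      simp only [Matrix.of_apply, h1]
      rw [← Finset.mul_sum, sum_pi_prod_mul fun _ k => φ k * y k, Finset.prod_const,
        Finset.card_univ])
  have := congrFun (congrFun h a) b
  simpa using this

/-- The dimension of the symmetric subspace. -/
theorem trace_symProj (n : ℕ) : ((n.factorial : ℕ) : ℂ) * (symProj (Fin n) κ).trace =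
    (Fintype.card κ).ascFactorial n := by
  rw [Matrix.trace, Finset.mul_sum]
  have h : ∀ a : Fin n → κ, (n.factorial : ℂ) * (symProj (Fin n) κ).diag a =
      fischer (∏ i, X (id (a i))) (∏ i, X (id (a i))) := fun a => by
    rw [fischer_prod_X_prod_X Function.injective_id, Fintype.card_fin]; rfl
  simp only [h, id]
  clear h
  induction n with
  | zero =>
    simp only [Finset.univ_eq_empty, Finset.prod_empty]
    rw [← C_1, ← monomial_zero', fischer_monomial_left]
    simp
  | succ n ih =>
    have hdeg : ∀ a : Fin n → κ, HasPartialDegree id n (∏ i, X (a i) : MvPolynomial κ ℂ) := by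
      clear ih
      intro a
      induction n with
      | zero => simp [HasPartialDegree]
      | succ n ih =>
        rw [Fin.prod_univ_succ]
        exact (ih fun i => a i.succ).X_mul Function.injective_id (a 0)
    rw [Nat.ascFactorial_succ, Nat.cast_mul, ← ih, Finset.mul_sum,
      ← (Fin.consEquiv fun _ => κ).sum_comp, Fintype.sum_prod_type, Finset.sum_comm]
    refine Finset.sum_congr rfl fun a _ => ?_
    -- Splitting off the first letter and summing over it multiplies each term by `card κ + n`: the
    -- contraction occurs `card κ` times and Euler's identity supplies `n`.
    have h1 : ∀ c : κ, fischer (∏ i, X ((Fin.consEquiv fun _ => κ) (c, a) i))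
        (∏ i, X ((Fin.consEquiv fun _ => κ) (c, a) i)) =
        fischer (∏ i, X (a i)) (∏ i, X (a i)) +
          fischer (∏ i, X (a i)) (X c * pderiv c (∏ i, X (a i))) := fun c => by
      rw [Fin.prod_univ_succ]
      simp only [Fin.consEquiv, Equiv.coe_fn_mk, Fin.cons_zero, Fin.cons_succ]
      rw [fischer_X_mul_left, pderiv_X_mul_self, fischer_add_right]
    have h2 := hdeg a
    simp only [HasPartialDegree, id] at h2
    simp only [h1, Finset.sum_add_distrib]
    rw [Finset.sum_const, Finset.card_univ, nsmul_eq_mul, ← fischer_sum_right, h2,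
      fischer_smul_right]
    push_cast
    ring

end FischerTensors

/-! ### Moments of a Haar distributed pure state -/

section HaarMoments

instance (d : ℕ) : IsProbabilityMeasure (haarSU d) :=
  ⟨by rw [haarSU, ← TopologicalSpace.PositiveCompacts.coe_top]; exact Measure.haarMeasure_self⟩

instance (d : ℕ) : Measure.IsMulLeftInvariant (haarSU d) := by
  unfold haarSU; infer_instance

theorem integrable_haarSU {d : ℕ} {E : Type*} [NormedAddCommGroup E]
    [SecondCountableTopologyEither (SUGroup d) E] {f : SUGroup d → E} (hf : Continuous f) :
    Integrable f (haarSU d) :=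
  hf.integrable_of_hasCompactSupport (HasCompactSupport.of_compactSpace f)

variable {d : ℕ} [NeZero d]

/-- The state vector `U |0⟩`. -/
def stateVector (U : SUGroup d) (i : Fin d) : ℂ := (U : Matrix (Fin d) (Fin d) ℂ) i 0

theorem continuous_stateVector (i : Fin d) : Continuous fun U : SUGroup d => stateVector U i :=
  continuous_subtype_val.matrix_elem i 0

theorem pureState_apply (U : SUGroup d) (i j : Fin d) :
    pureState U i j = stateVector U i * (starRingEnd ℂ) (stateVector U j) := by
  simp [pureState, stateVector, Matrix.mul_apply, Matrix.single_apply, ite_and]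

theorem sum_stateVector (U : SUGroup d) :
    ∑ i, stateVector U i * (starRingEnd ℂ) (stateVector U i) = 1 := by
  have h := congrFun (congrFun (Matrix.mem_unitaryGroup_iff'.mp
    (Matrix.specialUnitaryGroup_le_unitaryGroup U.2)) 0) 0
  rw [Matrix.star_eq_conjTranspose, Matrix.mul_apply, Matrix.one_apply_eq] at h
  rw [← h]
  exact Finset.sum_congr rfl fun i _ => mul_comm _ _

/-- Up to a phase, every unit vector is a row of a matrix in `SU(d)`. -/
theorem exists_row_eq {z : Fin d → ℂ} (hz : ∑ i, Complex.normSq (z i) = 1) :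
    ∃ (V : SUGroup d) (c : ℂ), ‖c‖ = 1 ∧ ∀ i, z i = c * (V : Matrix (Fin d) (Fin d) ℂ) 0 i := by
  set v : EuclideanSpace ℂ (Fin d) := WithLp.toLp 2 z with hv
  have hnorm : ‖v‖ = 1 := by
    rw [EuclideanSpace.norm_eq, Real.sqrt_eq_one, ← hz]
    exact Finset.sum_congr rfl fun i _ => (Complex.normSq_eq_norm_sq _).symm
  have hon : Orthonormal ℂ (({0} : Set (Fin d)).domRestrict fun _ => v) := by
    refine ⟨fun _ => hnorm, fun i j hij => absurd (Subsingleton.elim i j) hij⟩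
  obtain ⟨b, hb⟩ := hon.exists_orthonormalBasis_extension_of_card_eq (by simp)
  set W : Matrix (Fin d) (Fin d) ℂ := Matrix.of fun i j => b i j with hW
  have hWu : W * star W = 1 := by
    ext i j
    have := orthonormal_iff_ite.mp b.orthonormal j i
    rw [PiLp.inner_apply] at this
    rw [Matrix.mul_apply, Matrix.one_apply, eq_comm]
    simp only [Matrix.star_apply, hW, Matrix.of_apply]
    rw [← if_congr (eq_comm (a := j) (b := i)) rfl rfl, ← this]
    exact Finset.sum_congr rfl fun k _ => by simp
  have hdet : ‖W.det‖ = 1 := by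
    have h := congrArg Matrix.det hWu
    rw [Matrix.det_mul, Matrix.star_eq_conjTranspose, Matrix.det_conjTranspose, Matrix.det_one] at h
    have h2 := congrArg norm h
    rw [norm_mul, norm_star, norm_one] at h2
    nlinarith [norm_nonneg W.det]
  have hdet0 : W.det ≠ 0 := fun h => by simp [h] at hdet
  -- Scaling by a `d`-th root of the inverse determinant makes the determinant `1`; this is the
  -- source of the phase.
  obtain ⟨μ, hμ⟩ := IsAlgClosed.exists_pow_nat_eq (W.det)⁻¹ (NeZero.pos d)
  have hμn : ‖μ‖ = 1 := by
    have h := congrArg norm hμ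
    rw [norm_pow, norm_inv, hdet, inv_one] at h
    exact (pow_eq_one_iff_of_nonneg (norm_nonneg _) (NeZero.ne d)).mp h
  have hμ0 : μ ≠ 0 := fun h => by simp [h] at hμn
  refine ⟨⟨μ • W, ?_⟩, μ⁻¹, by rw [norm_inv, hμn, inv_one], fun i => ?_⟩
  · rw [Matrix.mem_specialUnitaryGroup_iff, Matrix.mem_unitaryGroup_iff]
    constructor
    · rw [star_smul, smul_mul_smul_comm, hWu, Complex.star_def, Complex.mul_conj,
        Complex.normSq_eq_norm_sq, hμn]
      simp
    · rw [Matrix.det_smul, Fintype.card_fin, hμ, inv_mul_cancel₀ hdet0]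
  · change z i = μ⁻¹ * (μ • W) 0 i
    rw [Matrix.smul_apply, smul_eq_mul, ← mul_assoc, inv_mul_cancel₀ hμ0, one_mul, hW,
      Matrix.of_apply, hb 0 rfl]

/-- For a unit vector `z`, left invariance under a matrix with first row `z` (up to a phase, which
the norm ignores) turns the linear form into the coordinate `0`. Homogeneity handles the other
vectors. -/
theorem integral_norm_sum_mul_stateVector_pow (n : ℕ) (z : Fin d → ℂ) :
    ∫ U, ‖∑ i, z i * stateVector U i‖ ^ (2 * n) ∂(haarSU d) =
      (∑ i, Complex.normSq (z i)) ^ n * ∫ U, ‖stateVector U 0‖ ^ (2 * n) ∂(haarSU d) := by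
  have hunit : ∀ w : Fin d → ℂ, ∑ i, Complex.normSq (w i) = 1 →
      ∫ U, ‖∑ i, w i * stateVector U i‖ ^ (2 * n) ∂(haarSU d) =
        ∫ U, ‖stateVector U 0‖ ^ (2 * n) ∂(haarSU d) := fun w hw => by
    obtain ⟨V, c, hc, hV⟩ := exists_row_eq hw
    rw [← integral_mul_left_eq_self (fun U => ‖stateVector U 0‖ ^ (2 * n)) V]
    refine integral_congr_ae (Filter.Eventually.of_forall fun U => ?_)
    have : ∑ i, w i * stateVector U i = c * stateVector (V * U) 0 := by
      simp only [stateVector, Submonoid.coe_mul, Matrix.mul_apply, Finset.mul_sum, hV, mul_assoc]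
    simp only [this, norm_mul, hc, one_mul]
  set R := ∑ i, Complex.normSq (z i) with hR
  have hR0 : 0 ≤ R := Finset.sum_nonneg fun i _ => Complex.normSq_nonneg _
  rcases hR0.eq_or_lt with h0 | hpos
  · have hz : ∀ i, z i = 0 := fun i => by
      have := (Finset.sum_eq_zero_iff_of_nonneg fun i _ => Complex.normSq_nonneg (z i)).mp h0.symm i
        (Finset.mem_univ i)
      exact Complex.normSq_eq_zero.mp this
    rcases n with _ | n
    · simp
    · simp [hz, ← h0]
  · have hs : (Real.sqrt R) ^ 2 = R := Real.sq_sqrt hR0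
    have hs0 : Real.sqrt R ≠ 0 := (Real.sqrt_pos.mpr hpos).ne'
    have hw := hunit (fun i => ((Real.sqrt R)⁻¹ : ℝ) * z i) (by
      simp only [map_mul, Complex.normSq_ofReal, ← Finset.mul_sum, ← hR]
      rw [← sq, inv_pow, hs, inv_mul_cancel₀ hpos.ne'])
    rw [← hw, ← integral_const_mul]
    refine integral_congr_ae (Filter.Eventually.of_forall fun U => ?_)
    simp only [mul_assoc, ← Finset.mul_sum, norm_mul, mul_pow, Complex.norm_real, norm_inv,
      Real.norm_eq_abs, abs_of_nonneg (Real.sqrt_nonneg R)]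
    rw [pow_mul (Real.sqrt R)⁻¹, inv_pow, hs, inv_pow, ← mul_assoc,
      mul_inv_cancel₀ (pow_ne_zero _ hpos.ne'), one_mul]

/-- A polynomial identity in `x` and `y` follows from its special case `y = conj x`. -/
theorem eval_eq_zero_of_conj {σ : Type*} {P : MvPolynomial (σ ⊕ σ) ℂ}
    (h : ∀ x : σ → ℂ,
      MvPolynomial.eval (Sum.elim x fun i => (starRingEnd ℂ) (x i)) P = 0) (x y : σ → ℂ) :
    MvPolynomial.eval (Sum.elim x y) P = 0 := by
  -- Substitute `x = u + I v` and `y = u - I v`. Real `u`, `v` give exactly `y = conj x`, and a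
  -- polynomial that vanishes at all real points is zero.
  set Q : MvPolynomial (σ ⊕ σ) ℂ := MvPolynomial.bind₁ (Sum.elim
    (fun i => MvPolynomial.X (Sum.inl i) + MvPolynomial.C Complex.I * MvPolynomial.X (Sum.inr i))
    (fun i => MvPolynomial.X (Sum.inl i) - MvPolynomial.C Complex.I * MvPolynomial.X (Sum.inr i))) P
    with hQ
  have heval : ∀ s : σ ⊕ σ → ℂ, MvPolynomial.eval s Q = MvPolynomial.eval (Sum.elim
      (fun i => s (Sum.inl i) + Complex.I * s (Sum.inr i))
      (fun i => s (Sum.inl i) - Complex.I * s (Sum.inr i))) P := fun s => by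
    rw [hQ, MvPolynomial.eval, MvPolynomial.eval₂Hom_bind₁]
    congr 2
    funext i
    rcases i with i | i <;> simp
  have hQ0 : Q = 0 := by
    refine MvPolynomial.funext_set (fun _ => Set.range ((↑) : ℝ → ℂ))
      (fun _ => Set.infinite_range_of_injective Complex.ofReal_injective) fun s hs => ?_
    rw [heval, map_zero, ← h fun i => s (Sum.inl i) + Complex.I * s (Sum.inr i)]
    congr 2
    congr 1
    funext i
    obtain ⟨p, hp⟩ := hs (Sum.inl i) trivial
    obtain ⟨q, hq⟩ := hs (Sum.inr i) trivial
    rw [← hp, ← hq]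
    simp [sub_eq_add_neg]
  have h1 := heval (Sum.elim (fun i => (x i + y i) / 2) (fun i => (x i - y i) / (2 * Complex.I)))
  rw [hQ0, map_zero] at h1
  rw [h1]
  have hI : Complex.I ≠ 0 := Complex.I_ne_zero
  congr 2
  congr 1 <;> funext i <;> simp only [Sum.elim_inl, Sum.elim_inr] <;> field_simp <;> ring

section

variable {ι : Type*} [Fintype ι]

theorem integrable_stateVector_mul (a b : ι → Fin d) : Integrable (fun U =>
    (∏ i, stateVector U (a i)) * (starRingEnd ℂ) (∏ i, stateVector U (b i))) (haarSU d) :=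
  integrable_haarSU ((continuous_finsetProd _ fun i _ => continuous_stateVector (a i)).mul
    (Complex.continuous_conj.comp
      (continuous_finsetProd _ fun i _ => continuous_stateVector (b i))))

variable [DecidableEq ι]

/-- Pairing the moments with powers of `x` and `conj x` gives a norm moment, a constant times `(∑ |x
i|²) ^ n` by invariance. `eval_eq_zero_of_conj` frees `y` from `conj x`, after which
`eq_smul_symProj` applies. -/
theorem exists_haar_moment : ∃ κ : ℂ, ∀ a b : ι → Fin d,
    ∫ U, (∏ i, stateVector U (a i)) * (starRingEnd ℂ) (∏ i, stateVector U (b i)) ∂(haarSU d) =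
      κ * symProj ι (Fin d) a b := by
  set n := Fintype.card ι with hn
  set S : Matrix (ι → Fin d) (ι → Fin d) ℂ := Matrix.of fun a b =>
    ∫ U, (∏ i, stateVector U (a i)) * (starRingEnd ℂ) (∏ i, stateVector U (b i)) ∂(haarSU d) with hS
  set κ : ℂ := ((∫ U, ‖stateVector U 0‖ ^ (2 * n) ∂(haarSU d) : ℝ) : ℂ) with hκ
  have hint : ∀ x y : Fin d → ℂ, ∑ a, ∑ b, S a b * ((∏ i, x (a i)) * ∏ i, y (b i)) =
      ∫ U, (∑ i, x i * stateVector U i) ^ n *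
        (∑ i, y i * (starRingEnd ℂ) (stateVector U i)) ^ n ∂(haarSU d) := fun x y => by
    simp only [hS, Matrix.of_apply, ← integral_mul_const]
    rw [Finset.sum_congr rfl fun a _ => (integral_finsetSum _ fun b _ =>
      (integrable_stateVector_mul a b).mul_const _).symm,
      ← integral_finsetSum _ fun a _ => integrable_finsetSum _ fun b _ =>
      (integrable_stateVector_mul a b).mul_const _]
    refine integral_congr_ae (Filter.Eventually.of_forall fun U => ?_)
    simp only [hn, ← Finset.card_univ (α := ι)]
    rw [← Finset.prod_const, ← Finset.prod_const, ← sum_pi_prod_mul, ← sum_pi_prod_mul,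
      Finset.sum_mul_sum]
    refine Finset.sum_congr rfl fun a _ => Finset.sum_congr rfl fun b _ => ?_
    rw [Finset.prod_mul_distrib, Finset.prod_mul_distrib, map_prod]
    ring
  have hconj : ∀ x : Fin d → ℂ,
      ∑ a, ∑ b, S a b * ((∏ i, x (a i)) * ∏ i, (starRingEnd ℂ) (x (b i))) =
        κ * (∑ i, x i * (starRingEnd ℂ) (x i)) ^ n := fun x => by
    rw [hint x fun i => (starRingEnd ℂ) (x i)]
    have h1 := integral_norm_sum_mul_stateVector_pow n x
    have h2 := congrArg (fun r : ℝ => (r : ℂ)) h1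
    simp only [← integral_complex_ofReal, Complex.ofReal_mul, Complex.ofReal_pow,
      Complex.ofReal_sum] at h2
    rw [hκ, ← integral_complex_ofReal, mul_comm]
    simp only [Complex.ofReal_pow, Complex.mul_conj]
    rw [← h2]
    refine integral_congr_ae (Filter.Eventually.of_forall fun U => ?_)
    simp only [← map_mul, ← map_sum]
    rw [← mul_pow, Complex.mul_conj, pow_mul, Complex.normSq_eq_norm_sq, Complex.ofReal_pow]
  have hpoly : ∀ x y : Fin d → ℂ, ∑ a, ∑ b, S a b * ((∏ i, x (a i)) * ∏ i, y (b i)) =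
      κ * (∑ i, x i * y i) ^ n := fun x y => by
    have := eval_eq_zero_of_conj (P := ∑ a, ∑ b, MvPolynomial.C (S a b) *
        ((∏ i, MvPolynomial.X (Sum.inl (a i))) * ∏ i, MvPolynomial.X (Sum.inr (b i))) -
      MvPolynomial.C κ * (∑ i, MvPolynomial.X (Sum.inl i) * MvPolynomial.X (Sum.inr i)) ^ n)
      (fun x => by
        simp only [map_sub, map_sum, map_mul, map_prod, map_pow, MvPolynomial.eval_C,
          MvPolynomial.eval_X, Sum.elim_inl, Sum.elim_inr]
        rw [hconj, sub_self]) x y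
    simpa [map_sub, sub_eq_zero] using this
  have hmain := eq_smul_symProj (A := S) (c := κ)
    (fun π a b => by
      simp only [hS, Matrix.of_apply]
      refine integral_congr_ae (Filter.Eventually.of_forall fun U => ?_)
      simp only [prod_comp_perm (fun c => stateVector U c) π a])
    (fun π a b => by
      simp only [hS, Matrix.of_apply]
      refine integral_congr_ae (Filter.Eventually.of_forall fun U => ?_)
      simp only [prod_comp_perm (fun c => stateVector U c) π b])
    hpoly
  exact ⟨κ, fun a b => congrFun (congrFun hmain a) b⟩

theorem ascFactorial_pos_of_pos {m : ℕ} (hm : 0 < m) (n : ℕ) : 0 < m.ascFactorial n := by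
  obtain ⟨e, rfl⟩ := Nat.exists_eq_succ_of_ne_zero hm.ne'
  exact Nat.ascFactorial_pos e n

/-- The moments of the uniform distribution on pure states. -/
theorem haar_moment_fin {n : ℕ} (a b : Fin n → Fin d) :
    ∫ U, (∏ i, stateVector U (a i)) * (starRingEnd ℂ) (∏ i, stateVector U (b i)) ∂(haarSU d) =
      (n.factorial : ℂ) / (d.ascFactorial n : ℕ) * symProj (Fin n) (Fin d) a b := by
  obtain ⟨κ, hκ⟩ := exists_haar_moment (d := d) (ι := Fin n)
  -- The constant is found from the trace, since the diagonal moments sum to the integral of `1`.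
  have htr : κ * (symProj (Fin n) (Fin d)).trace = 1 := by
    rw [Matrix.trace, Finset.mul_sum]
    simp only [Matrix.diag, ← hκ]
    rw [← integral_finsetSum _ fun a _ => integrable_stateVector_mul a a]
    have : ∀ U : SUGroup d, ∑ a : Fin n → Fin d,
        (∏ i, stateVector U (a i)) * (starRingEnd ℂ) (∏ i, stateVector U (a i)) = 1 := fun U => by
      simp only [map_prod, ← Finset.prod_mul_distrib]
      rw [sum_pi_prod_mul fun _ k => stateVector U k * (starRingEnd ℂ) (stateVector U k),
        sum_stateVector, Finset.prod_const_one]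
    simp only [this]
    simp
  have h2 := trace_symProj (κ := Fin d) n
  rw [Fintype.card_fin] at h2
  have h3 : ((d.ascFactorial n : ℕ) : ℂ) ≠ 0 := by
    exact_mod_cast (ascFactorial_pos_of_pos (NeZero.pos d) n).ne'
  rw [hκ, ← h2]
  have hf : (n.factorial : ℂ) ≠ 0 := by exact_mod_cast n.factorial_ne_zero
  have ht : (symProj (Fin n) (Fin d)).trace ≠ 0 := fun h => by simp [h] at htr
  rw [← div_div, div_self hf, ← htr, mul_div_cancel_right₀ _ ht]

theorem symProj_comp_equiv {ι' κ : Type*} [Fintype ι'] [DecidableEq ι'] [DecidableEq κ]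
    (e : ι' ≃ ι) (a b : ι → κ) : symProj ι' κ (a ∘ e) (b ∘ e) = symProj ι κ a b := by
  rw [symProj_apply, symProj_apply, Fintype.card_congr e, ← Equiv.sum_comp e.permCongr]
  refine congrArg _ (Finset.sum_congr rfl fun π _ => if_congr ⟨fun h => ?_, fun h => ?_⟩ rfl rfl)
  · funext i
    have := congrFun h (e.symm i)
    simpa using this
  · funext i
    have := congrFun h (e i)
    simpa using this

theorem haar_moment (a b : ι → Fin d) :
    ∫ U, (∏ i, stateVector U (a i)) * (starRingEnd ℂ) (∏ i, stateVector U (b i)) ∂(haarSU d) =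
      ((Fintype.card ι).factorial : ℂ) / (d.ascFactorial (Fintype.card ι) : ℕ) *
        symProj ι (Fin d) a b := by
  rw [← symProj_comp_equiv (Fintype.equivFin ι).symm, ← haar_moment_fin]
  refine integral_congr_ae (Filter.Eventually.of_forall fun U => ?_)
  simp only [Function.comp_apply]
  rw [Equiv.prod_comp (Fintype.equivFin ι).symm fun i => stateVector U (a i),
    Equiv.prod_comp (Fintype.equivFin ι).symm fun i => stateVector U (b i)]

end

end HaarMoments

/-! ### States with marked sites. -/

section CloningStates

open MvPolynomial CloningMode

/-- Each set with `L + 1` elements arises once from each choice of its last inserted element. -/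
theorem sum_powersetCard_sum_insert {α R : Type*} [Fintype α] [DecidableEq α] [Semiring R]
    {V : Type*} [AddCommMonoid V] [Module R V] (L : ℕ) (f : Finset α → V) :
    ∑ S ∈ Finset.powersetCard L Finset.univ, ∑ t ∈ Sᶜ, f (insert t S) =
      ((L + 1 : ℕ) : R) • ∑ S ∈ Finset.powersetCard (L + 1) Finset.univ, f S := by
  have h : ∀ S ∈ Finset.powersetCard (L + 1) (Finset.univ : Finset α),
      ((L + 1 : ℕ) : R) • f S = ∑ _t ∈ S, f S := fun S hS => by
    rw [Finset.sum_const, (Finset.mem_powersetCard.mp hS).2, Nat.cast_smul_eq_nsmul]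
  rw [Finset.smul_sum, Finset.sum_congr rfl h, Finset.sum_sigma', Finset.sum_sigma']
  refine Finset.sum_bij' (fun x _ => ⟨insert x.2 x.1, x.2⟩) (fun x _ => ⟨x.1.erase x.2, x.2⟩)
    ?_ ?_ ?_ ?_ ?_
  · rintro ⟨S, t⟩ h
    simp only [Finset.mem_sigma, Finset.mem_powersetCard, Finset.mem_compl] at h ⊢
    exact ⟨⟨Finset.subset_univ _, by rw [Finset.card_insert_of_notMem h.2, h.1.2]⟩,
      Finset.mem_insert_self _ _⟩
  · rintro ⟨S, t⟩ h
    simp only [Finset.mem_sigma, Finset.mem_powersetCard, Finset.mem_compl] at h ⊢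
    exact ⟨⟨Finset.subset_univ _, by rw [Finset.card_erase_of_mem h.2, h.1.2]; rfl⟩,
      Finset.notMem_erase _ _⟩
  · rintro ⟨S, t⟩ h
    simp only [Finset.mem_sigma, Finset.mem_compl] at h
    simp [Finset.erase_insert h.2]
  · rintro ⟨S, t⟩ h
    simp only [Finset.mem_sigma] at h
    simp [Finset.insert_erase h.2]
  · intros; rfl

theorem pderiv_prod_X_mul {σ τ : Type*} {i : σ} {s : Finset τ} {g : τ → σ}
    (h : ∀ t ∈ s, g t ≠ i) (q : MvPolynomial σ ℂ) :
    pderiv i ((∏ t ∈ s, X (g t)) * q) = (∏ t ∈ s, X (g t)) * pderiv i q := by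
  classical
  induction s using Finset.induction_on with
  | empty => simp
  | insert t s ht ih =>
    rw [Finset.prod_insert ht, mul_assoc, pderiv_X_mul_of_ne (h t (Finset.mem_insert_self _ _)),
      ih fun u hu => h u (Finset.mem_insert_of_mem hu), mul_assoc]

/-- The hypotheses prevent `∂ (g t)` from acting on anything in the right factor except `X (g' t)`,
so the variables are matched one at a time. -/
theorem fischer_prod_X_mul_prod_X_mul {σ τ : Type*} [DecidableEq σ] {s : Finset τ} {g g' : τ → σ}
    (h : ∀ t ∈ s, ∀ u ∈ s, t ≠ u → g t ≠ g' u) (p : MvPolynomial σ ℂ) {q : MvPolynomial σ ℂ}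
    (hq : ∀ t ∈ s, pderiv (g t) q = 0) :
    fischer ((∏ t ∈ s, X (g t)) * p) ((∏ t ∈ s, X (g' t)) * q) =
      if ∀ t ∈ s, g t = g' t then fischer p q else 0 := by
  classical
  induction s using Finset.induction_on with
  | empty => simp
  | insert t s ht ih =>
    have hd : pderiv (g t) ((∏ u ∈ s, X (g' u)) * q) = 0 := by
      rw [pderiv_prod_X_mul (fun u hu => (h t (Finset.mem_insert_self _ _) u
        (Finset.mem_insert_of_mem hu) (fun e => ht (e ▸ hu))).symm),
        hq t (Finset.mem_insert_self _ _), mul_zero]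
    rw [Finset.prod_insert ht, Finset.prod_insert ht, mul_assoc, mul_assoc, fischer_X_mul_left]
    simp only [Finset.forall_mem_insert]
    by_cases hg : g t = g' t
    · rw [hg, pderiv_X_mul_self, ← hg, hd, mul_zero, add_zero,
        ih (fun u hu v hv => h u (Finset.mem_insert_of_mem hu) v (Finset.mem_insert_of_mem hv))
        fun u hu => hq u (Finset.mem_insert_of_mem hu)]
      simp only [true_and]
    · rw [pderiv_X_mul_of_ne (Ne.symm hg), hd, mul_zero, fischer_zero_right, if_neg fun h => hg h.1]

variable {d N : ℕ}

/-- The operator `aux c + ∂ (input c)`, which represents multiplication by the conjugate of a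
coordinate of the state. -/
noncomputable def conjCoord (N : ℕ) (c : Fin d) : Module.End ℂ (CloningFock d N) :=
  creation (aux c) + annihilation (input c)

theorem conjCoord_apply (c : Fin d) (p : CloningFock d N) :
    conjCoord N c p = X (aux c) * p + pderiv (input c) p := rfl

/-- The adjoint of `conjCoord`. -/
noncomputable def coord (N : ℕ) (c : Fin d) : Module.End ℂ (CloningFock d N) :=
  annihilation (aux c) + creation (input c)

theorem coord_apply (c : Fin d) (p : CloningFock d N) :
    coord N c p = pderiv (aux c) p + X (input c) * p := rfl

theorem fischer_conjCoord_left (c : Fin d) (p q : CloningFock d N) :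
    fischer (conjCoord N c p) q = fischer p (coord N c q) := by
  rw [conjCoord_apply, coord_apply, fischer_add_left, fischer_add_right, fischer_X_mul_left,
    fischer_X_mul_right]

theorem fischer_conjCoord_right (c : Fin d) (p q : CloningFock d N) :
    fischer p (conjCoord N c q) = fischer (coord N c p) q := by
  rw [← fischer_conj, fischer_conjCoord_left, fischer_conj]

theorem commute_conjCoord (c c' : Fin d) : Commute (conjCoord N c) (conjCoord N c') := by
  refine Commute.add_left (Commute.add_right (commute_creation _ _) ?_)
    (Commute.add_right ?_ (commute_annihilation _ _))
  · exact (commute_annihilation_creation (by simp)).symm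
  · exact commute_annihilation_creation (by simp)

/-- The commutator of `∂ aux` with `aux` is `1` and that of `input` with `∂ input` is `-1`; they
cancel. This cancellation is the purpose of the auxiliary modes. -/
theorem commute_coord_conjCoord (c c' : Fin d) : Commute (coord N c) (conjCoord N c') := by
  refine LinearMap.ext fun p => ?_
  simp only [Module.End.mul_apply, coord_apply, conjCoord_apply, map_add]
  by_cases h : c = c'
  · subst h
    rw [pderiv_X_mul_self, pderiv_X_mul_self, pderiv_comm (aux c)]
    ring
  · rw [pderiv_X_mul_of_ne fun h' => h (aux_injective h').symm,
      pderiv_X_mul_of_ne fun h' => h (input_injective h'), pderiv_comm (aux c)]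
    ring

/-- The product of the operators `conjCoord (b s)` over the sites in `S`. -/
noncomputable def conjCoords (S : Finset (Fin N)) (b : Fin N → Fin d) :
    Module.End ℂ (CloningFock d N) :=
  S.noncommProd (fun s => conjCoord N (b s)) fun _ _ _ _ _ => commute_conjCoord _ _

@[simp] theorem conjCoords_empty (b : Fin N → Fin d) : conjCoords ∅ b = 1 :=
  Finset.noncommProd_empty _ _

theorem conjCoords_insert {S : Finset (Fin N)} {s : Fin N} (hs : s ∉ S) (b : Fin N → Fin d) :
    conjCoords (insert s S) b = conjCoord N (b s) * conjCoords S b :=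
  Finset.noncommProd_insert_of_notMem _ _ _ _ hs

theorem commute_conjCoords {T : Module.End ℂ (CloningFock d N)}
    (hT : ∀ c, Commute T (conjCoord N c)) (S : Finset (Fin N)) (b : Fin N → Fin d) :
    Commute T (conjCoords S b) :=
  Finset.noncommProd_commute _ _ _ _ fun s _ => hT (b s)

theorem pderiv_conjCoords {i : CloningMode d N} (hi : ∀ c, aux c ≠ i) (S : Finset (Fin N))
    (b : Fin N → Fin d) (p : CloningFock d N) :
    pderiv i (conjCoords S b p) = conjCoords S b (pderiv i p) :=
  LinearMap.congr_fun (commute_conjCoords (T := annihilation i) (fun c =>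
    Commute.add_right (commute_annihilation_creation (hi c)) (commute_annihilation _ _)) S b) p

/-- Each `conjCoord` crosses to the other side as a `coord`, which commutes past the remaining
operators and, in the absence of auxiliary variables, only multiplies by an input variable. Crossing
sides exchanges the roles of `a` and `b`. -/
theorem fischer_conjCoords (S : Finset (Fin N)) (a b : Fin N → Fin d) {p q : CloningFock d N}
    (hp : ∀ c, pderiv (aux c) p = 0) (hq : ∀ c, pderiv (aux c) q = 0) :
    fischer (conjCoords S a p) (conjCoords S b q) =
      fischer ((∏ s ∈ S, X (input (b s))) * p) ((∏ s ∈ S, X (input (a s))) * q) := by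
  induction S using Finset.induction_on generalizing p q with
  | empty => simp
  | insert s S hs ih =>
    have hcoord : ∀ (c : Fin d) (r : CloningFock d N), (∀ c, pderiv (aux c) r = 0) →
        coord N c r = X (input c) * r := fun c r hr => by rw [coord_apply, hr, zero_add]
    have hfree : ∀ (c : Fin d) (r : CloningFock d N), (∀ c, pderiv (aux c) r = 0) →
        ∀ c', pderiv (aux c') (X (input c) * r) = 0 := fun c r hr c' => by
      rw [pderiv_X_mul_of_ne (by simp), hr, mul_zero]
    have h1 : ∀ (c : Fin d) (f : Fin N → Fin d) (r : CloningFock d N),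
        coord N c (conjCoords S f r) = conjCoords S f (coord N c r) := fun c f r =>
      LinearMap.congr_fun (commute_conjCoords (commute_coord_conjCoord c) S f) r
    rw [conjCoords_insert hs, conjCoords_insert hs, Module.End.mul_apply, Module.End.mul_apply,
      fischer_conjCoord_left, ← Module.End.mul_apply, (commute_coord_conjCoord _ _).eq,
      Module.End.mul_apply, fischer_conjCoord_right, h1, h1, hcoord _ _ hp, hcoord _ _ hq,
      ih (hfree _ _ hp) (hfree _ _ hq), Finset.prod_insert hs, Finset.prod_insert hs,
      mul_left_comm, mul_left_comm (∏ s ∈ S, X (input (a s))), mul_assoc, mul_assoc]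

/-- The state in which the sites in `S` have been marked and absorbed, and the others carry the
output string `b`. -/
noncomputable def markedState (b : Fin N → Fin d) (S : Finset (Fin N)) (p : CloningFock d N) :
    CloningFock d N :=
  (∏ s ∈ S, X (mark s)) * ((∏ s ∈ Sᶜ, X (output (b s, s))) * conjCoords S b p)

theorem add_sites_apply (p : CloningFock d N) :
    (collectSites d N + contractSites d N) p =
      ∑ s, ∑ c, X (mark s) * conjCoord N c (pderiv (output (c, s)) p) := by
  rw [LinearMap.add_apply, collectSites_apply, contractSites_apply, ← Finset.sum_add_distrib]
  refine Finset.sum_congr rfl fun s _ => ?_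
  simp only [pairAnnihilate, Finset.mul_sum, conjCoord_apply, mul_add, Finset.sum_add_distrib]

theorem add_sites_markedState (b : Fin N → Fin d) (S : Finset (Fin N)) {p : CloningFock d N}
    (hp : ∀ c, pderiv (output c) p = 0) :
    (collectSites d N + contractSites d N) (markedState b S p) =
      ∑ t ∈ Sᶜ, markedState b (insert t S) p := by
  classical
  have hp' : ∀ c, pderiv (output c) (conjCoords S b p) = 0 := fun c => by
    rw [pderiv_conjCoords (by simp), hp, map_zero]
  -- Only the output variables of unmarked sites with the matching letter are present, so all other
  -- derivatives vanish.
  have h0 : ∀ (c : Fin d) (t : Fin N), ¬ (t ∈ Sᶜ ∧ b t = c) →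
      pderiv (output (c, t)) (markedState b S p) = 0 := fun c t h => by
    rw [markedState, pderiv_prod_X_mul (by simp), pderiv_prod_X_mul, hp', mul_zero, mul_zero]
    intro s hs he
    have := output_injective he
    rw [Prod.mk.injEq] at this
    obtain ⟨h1, rfl⟩ := this
    exact h ⟨hs, h1⟩
  have h1 : ∀ t ∈ Sᶜ, X (mark t) * conjCoord N (b t) (pderiv (output (b t, t))
      (markedState b S p)) = markedState b (insert t S) p := fun t ht => by
    have htS : t ∉ S := Finset.mem_compl.mp ht
    have hcompl : (insert t S)ᶜ = Sᶜ.erase t := Finset.compl_insert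
    have hd : pderiv (output (b t, t)) ((∏ s ∈ Sᶜ, X (output (b s, s))) * conjCoords S b p) =
        (∏ s ∈ (insert t S)ᶜ, X (output (b s, s))) * conjCoords S b p := by
      rw [← Finset.mul_prod_erase _ _ ht, mul_assoc, pderiv_X_mul_self, pderiv_prod_X_mul, hp',
        mul_zero, mul_zero, add_zero, hcompl]
      intro s hs he
      exact Finset.ne_of_mem_erase hs (congrArg Prod.snd (output_injective he))
    rw [markedState, pderiv_prod_X_mul (by simp), hd, markedState, Finset.prod_insert htS,
      conjCoords_insert htS, Module.End.mul_apply, conjCoord_apply, conjCoord_apply,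
      pderiv_prod_X_mul (by simp), pderiv_prod_X_mul (by simp)]
    ring
  rw [add_sites_apply, ← Finset.sum_subset (Finset.subset_univ Sᶜ)]
  · refine Finset.sum_congr rfl fun t ht => ?_
    rw [← h1 t ht, Finset.sum_eq_single (b t)]
    · intro c _ hc
      rw [h0 c t fun h => hc h.2.symm, map_zero, mul_zero]
    · exact fun h => absurd (Finset.mem_univ _) h
  · intro t _ ht
    refine Finset.sum_eq_zero fun c _ => ?_
    rw [h0 c t fun h => ht h.1, map_zero, mul_zero]

theorem add_sites_pow_markedState (b : Fin N → Fin d) (L : ℕ) {p : CloningFock d N}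
    (hp : ∀ c, pderiv (output c) p = 0) :
    ((collectSites d N + contractSites d N) ^ L) (markedState b ∅ p) =
      (L.factorial : ℂ) • ∑ S ∈ Finset.powersetCard L Finset.univ, markedState b S p := by
  induction L with
  | zero => simp
  | succ L ih =>
    rw [pow_succ', Module.End.mul_apply, ih, map_smul, map_sum,
      Finset.sum_congr rfl fun S _ => add_sites_markedState b S hp,
      sum_powersetCard_sum_insert (R := ℂ) L fun S => markedState b S p, smul_smul, Nat.factorial_succ, mul_comm (L + 1),
      Nat.cast_mul]

/-- Sets of equal size that differ leave a marker on the left that the right side lacks. -/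
theorem fischer_markedState_of_ne (a b : Fin N → Fin d) {S S' : Finset (Fin N)}
    (hcard : S.card = S'.card) (hS : S ≠ S') (p : CloningFock d N) {q : CloningFock d N}
    (hq : ∀ s, pderiv (mark s) q = 0) :
    fischer (markedState a S p) (markedState b S' q) = 0 := by
  obtain ⟨s, hs, hs'⟩ : ∃ s ∈ S, s ∉ S' := by
    by_contra! h
    exact hS (Finset.eq_of_subset_of_card_le h hcard.ge)
  rw [markedState, ← Finset.mul_prod_erase _ _ hs, mul_assoc, fischer_X_mul_left, markedState,
    pderiv_prod_X_mul, pderiv_prod_X_mul (by simp), pderiv_conjCoords (by simp), hq, map_zero,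
    mul_zero, mul_zero, fischer_zero_right]
  exact fun t ht he => hs' (mark_injective he ▸ ht)

theorem fischer_markedState (a b : Fin N → Fin d) (S : Finset (Fin N)) {p q : CloningFock d N}
    (hpa : ∀ c, pderiv (aux c) p = 0) (hqa : ∀ c, pderiv (aux c) q = 0)
    (hqo : ∀ c, pderiv (output c) q = 0) (hqm : ∀ s, pderiv (mark s) q = 0) :
    fischer (markedState a S p) (markedState b S q) =
      if ∀ s ∈ Sᶜ, a s = b s then
        fischer ((∏ s ∈ S, X (input (b s))) * p) ((∏ s ∈ S, X (input (a s))) * q) else 0 := by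
  classical
  rw [markedState, markedState, fischer_prod_X_mul_prod_X_mul, if_pos fun _ _ => rfl,
    fischer_prod_X_mul_prod_X_mul, fischer_conjCoords S a b hpa hqa]
  · by_cases h : ∀ s ∈ Sᶜ, a s = b s
    · rw [if_pos h, if_pos fun s hs => by rw [h s hs]]
    · rw [if_neg h, if_neg fun h' => h fun s hs =>
        congrArg Prod.fst (output_injective (h' s hs))]
  · intro s _ t _ hst h
    exact hst (congrArg Prod.snd (output_injective h))
  · intro s _
    rw [pderiv_conjCoords (by simp), hqo, map_zero]
  · intro s _ t _ hst h
    exact hst (mark_injective h)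
  · intro s _
    rw [pderiv_prod_X_mul (by simp), pderiv_conjCoords (by simp), hqm, map_zero, mul_zero]

end CloningStates

theorem sum_comm_three {α β γ A : Type*} [Fintype α] [Fintype β] [Fintype γ] [AddCommMonoid A]
    (f : α → β → γ → A) : ∑ k, ∑ i, ∑ j, f k i j = ∑ i, ∑ j, ∑ k, f k i j := by
  rw [Finset.sum_comm]
  exact Finset.sum_congr rfl fun _ _ => Finset.sum_comm

/-! ### The Choi matrix -/

section Choi

variable {ι κ : Type} [DecidableEq ι]

/-- The Choi matrix of a linear map between matrix algebras. -/
def choiMatrix (E : Matrix ι ι ℂ →ₗ[ℂ] Matrix κ κ ℂ) : Matrix (κ × ι) (κ × ι) ℂ :=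
  Matrix.of fun x y => E (Matrix.single x.2 y.2 1) x.1 y.1

variable [Fintype ι]

theorem apply_eq_sum_choiMatrix (E : Matrix ι ι ℂ →ₗ[ℂ] Matrix κ κ ℂ) (ρ : Matrix ι ι ℂ)
    (a b : κ) : E ρ a b = ∑ i, ∑ j, ρ i j * choiMatrix E (a, i) (b, j) := by
  conv_lhs => rw [Matrix.matrix_eq_sum_single ρ]
  simp only [map_sum, Matrix.sum_apply]
  refine Finset.sum_congr rfl fun i _ => Finset.sum_congr rfl fun j _ => ?_
  rw [show Matrix.single i j (ρ i j) = ρ i j • Matrix.single i j (1 : ℂ) by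
    rw [Matrix.smul_single, smul_eq_mul, mul_one], map_smul]
  rfl

variable [Fintype κ]

/-- Apply the ampliation of order `card ι` to the unnormalized maximally entangled state `v`. -/
theorem IsCompletelyPositive.posSemidef_choiMatrix {E : Matrix ι ι ℂ →ₗ[ℂ] Matrix κ κ ℂ}
    (hE : IsCompletelyPositive E) : (choiMatrix E).PosSemidef := by
  set e := Fintype.equivFin ι with he
  set v : ι × Fin (Fintype.card ι) → ℂ := fun x => if e x.1 = x.2 then 1 else 0 with hv
  have h := hE (Fintype.card ι) (Matrix.vecMulVec v (star v)) (Matrix.posSemidef_vecMulVec_self_star v)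
  have h2 := h.submatrix fun x : κ × ι => (x.1, e x.2)
  have h3 : ∀ x y : κ × ι, (Matrix.of fun i j => Matrix.vecMulVec v (star v) (i, e x.2) (j, e y.2)) =
      Matrix.single x.2 y.2 1 := fun x y => by
    ext i j
    simp only [Matrix.vecMulVec_apply, hv, Matrix.of_apply, Matrix.single_apply, Pi.star_apply,
      EmbeddingLike.apply_eq_iff_eq]
    by_cases h1 : x.2 = i
    · by_cases h2 : y.2 = j
      · simp [h1, h2]
      · simp [h1, h2, Ne.symm h2]
    · simp [h1, Ne.symm h1]
  convert h2 using 1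
  ext x y
  exact congrArg (fun r => E r x.1 y.1) (h3 x y).symm

open scoped MatrixOrder in
theorem Matrix.PosSemidef.exists_eq_star_mul_self {n : Type*} [Fintype n] {A : Matrix n n ℂ}
    (hA : A.PosSemidef) : ∃ B : Matrix n n ℂ, A = star B * B := by
  classical
  exact CStarAlgebra.nonneg_iff_eq_star_mul_self.mp hA.nonneg

/-- A Kraus type decomposition of the Choi matrix. -/
theorem IsCompletelyPositive.exists_choiMatrix_eq {E : Matrix ι ι ℂ →ₗ[ℂ] Matrix κ κ ℂ}
    (hE : IsCompletelyPositive E) : ∃ B : κ × ι → κ → ι → ℂ, ∀ a i b j,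
      choiMatrix E (a, i) (b, j) = ∑ k, (starRingEnd ℂ) (B k a i) * B k b j := by
  obtain ⟨B, hB⟩ := hE.posSemidef_choiMatrix.exists_eq_star_mul_self
  refine ⟨fun k b j => B k (b, j), fun a i b j => ?_⟩
  rw [hB, Matrix.mul_apply]
  rfl

end Choi

/-! ### The fidelity as a Fischer norm -/

section FidelityNorm

open MvPolynomial CloningMode

variable {d M N : ℕ}

/-- The input polynomial of a tensor of rank `M`. -/
noncomputable def inputPoly (N : ℕ) (c : (Fin M → Fin d) → ℂ) : CloningFock d N :=
  ∑ j, c j • ∏ m, X (input (j m))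

theorem pderiv_inputPoly {i : CloningMode d N} (hi : ∀ c, input c ≠ i)
    (c : (Fin M → Fin d) → ℂ) : pderiv i (inputPoly N c) = 0 := by
  rw [inputPoly, map_sum]
  refine Finset.sum_eq_zero fun j _ => ?_
  have h : pderiv i ((∏ m, X (input (j m))) * 1 : CloningFock d N) = 0 := by
    rw [pderiv_prod_X_mul fun m _ => hi (j m), pderiv_one, mul_zero]
  rw [Derivation.map_smul, ← mul_one (∏ m, X (input (j m))), h, smul_zero]

theorem hasPartialDegree_of_pderiv_eq_zero {σ ι : Type*} [Fintype ι] {x : ι → σ}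
    {p : MvPolynomial σ ℂ} (h : ∀ i, pderiv (x i) p = 0) : HasPartialDegree x 0 p := by
  simp [HasPartialDegree, h]

theorem hasPartialDegree_prod_X_mul {σ ι τ : Type*} [Fintype ι] {x : ι → σ}
    (hx : Function.Injective x) (s : Finset τ) (a : τ → ι) {n : ℕ} {p : MvPolynomial σ ℂ}
    (hp : HasPartialDegree x n p) :
    HasPartialDegree x (n + s.card) ((∏ t ∈ s, X (x (a t))) * p) := by
  classical
  induction s using Finset.induction_on with
  | empty => simpa using hp
  | insert t s ht ih =>
    rw [Finset.prod_insert ht, Finset.card_insert_of_notMem ht, mul_assoc, ← add_assoc]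
    exact ih.X_mul hx (a t)

theorem hasPartialDegree_inputPoly (c : (Fin M → Fin d) → ℂ) :
    HasPartialDegree input M (inputPoly N c) := by
  refine .sum fun j _ => .smul _ ?_
  have h := hasPartialDegree_prod_X_mul (input_injective (N := N)) Finset.univ j
    (hasPartialDegree_of_pderiv_eq_zero (p := 1) fun _ => pderiv_one)
  simpa using h

/-- The vector of the Fock space with the coefficients `B b j`. -/
noncomputable def cloningVector (B : (Fin N → Fin d) → (Fin M → Fin d) → ℂ) : CloningFock d N :=
  ∑ b, markedState b ∅ (inputPoly N (B b))

theorem hasCloningDegree_cloningVector (B : (Fin N → Fin d) → (Fin M → Fin d) → ℂ) :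
    HasCloningDegree M 0 N 0 (cloningVector B) := by
  have h : ∀ b, markedState b ∅ (inputPoly N (B b)) =
      (∏ s, X (CloningMode.output (b s, s))) * inputPoly N (B b) := fun b => by
    simp [markedState]
  have h0 : ∀ b (i : CloningMode d N), (∀ c, CloningMode.input c ≠ i) →
      (∀ c, CloningMode.output c ≠ i) →
      pderiv i (markedState b ∅ (inputPoly N (B b))) = 0 := fun b i h1 h2 => by
    rw [h, pderiv_prod_X_mul fun s _ => h2 _, pderiv_inputPoly h1, mul_zero]
  refine ⟨.sum fun b _ => ?_, .sum fun b _ => ?_, .sum fun b _ => ?_, .sum fun b _ => ?_⟩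
  · rw [h]
    have hd := hasPartialDegree_inputPoly (N := N) (B b)
    rw [HasPartialDegree] at hd ⊢
    rw [Finset.sum_congr rfl fun i _ => by rw [pderiv_prod_X_mul (by simp)], ← mul_smul_comm, ← hd, Finset.mul_sum]
    exact Finset.sum_congr rfl fun i _ => mul_left_comm _ _ _
  · exact hasPartialDegree_of_pderiv_eq_zero fun c => h0 b _ (by simp) (by simp)
  · rw [h]
    have := hasPartialDegree_prod_X_mul (output_injective (d := d)) Finset.univ
      (fun s : Fin N => (b s, s)) (hasPartialDegree_of_pderiv_eq_zero
        (x := (CloningMode.output : _ → CloningMode d N)) fun c =>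
        pderiv_inputPoly (N := N) (by simp) (B b))
    simpa using this
  · exact hasPartialDegree_of_pderiv_eq_zero fun c => h0 b _ (by simp) (by simp)

/-- The overlap of two input strings that are extended by the letters of two output strings at the
sites in `S`. -/
noncomputable def extendedOverlap (S : Finset (Fin N)) (b a : Fin N → Fin d)
    (i j : Fin M → Fin d) : ℂ :=
  fischer (σ := CloningMode d N)
    ((∏ s ∈ S, X (input (b s))) * ∏ m, X (input (i m)))
    ((∏ s ∈ S, X (input (a s))) * ∏ m, X (input (j m)))

theorem fischerNormSq_sum_markedState (B : (Fin N → Fin d) → (Fin M → Fin d) → ℂ)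
    (S : Finset (Fin N)) :
    (fischerNormSq (∑ b, markedState b S (inputPoly N (B b))) : ℂ) =
      ∑ a, ∑ b, ∑ i, ∑ j, (if ∀ s ∈ Sᶜ, a s = b s then extendedOverlap S b a i j else 0) *
        ((starRingEnd ℂ) (B a i) * B b j) := by
  rw [← fischer_self, fischer_sum_left]
  refine Finset.sum_congr rfl fun a _ => ?_
  rw [fischer_sum_right]
  refine Finset.sum_congr rfl fun b _ => ?_
  rw [fischer_markedState]
  · by_cases h : ∀ s ∈ Sᶜ, a s = b s
    · simp only [if_pos h, inputPoly, Finset.mul_sum, fischer_sum_left, fischer_sum_right,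
        mul_smul_comm, fischer_smul_left, fischer_smul_right]
      rw [Finset.sum_comm]
      refine Finset.sum_congr rfl fun i _ => Finset.sum_congr rfl fun j _ => ?_
      rw [extendedOverlap]; ring
    · simp only [if_neg h, zero_mul, Finset.sum_const_zero]
  all_goals intro c; exact pderiv_inputPoly (by simp) _

/-- The moment and the Gram matrix are taken over the `S.card + M` letters indexed by `S ⊕ Fin M`;
the factorial in the one cancels that in the other and only the rising factorial remains. -/
theorem extendedOverlap_eq_integral [NeZero d] (S : Finset (Fin N)) (b a : Fin N → Fin d)
    (i j : Fin M → Fin d) :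
    ∫ U, ((∏ s ∈ S, stateVector U (b s)) * ∏ m, stateVector U (i m)) *
      (starRingEnd ℂ) ((∏ s ∈ S, stateVector U (a s)) * ∏ m, stateVector U (j m)) ∂(haarSU d) =
      ((d.ascFactorial (S.card + M) : ℕ) : ℂ)⁻¹ * extendedOverlap S b a i j := by
  have h := haar_moment (ι := S ⊕ Fin M) (Sum.elim (fun s => b s) i) (Sum.elim (fun s => a s) j)
  have h2 := fischer_prod_X_prod_X (ι := S ⊕ Fin M) (input_injective (d := d) (N := N))
    (Sum.elim (fun s => b s) i) (Sum.elim (fun s => a s) j)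
  have hc : ∀ (f : Fin N → Fin d) (U : SUGroup d), ∏ s : S, stateVector U (f s) =
      ∏ s ∈ S, stateVector U (f s) := fun f U => Finset.prod_coe_sort S fun s => stateVector U (f s)
  simp only [Fintype.prod_sum_type, Sum.elim_inl, Sum.elim_inr, hc, Fintype.card_sum, Fintype.card_coe, Fintype.card_fin] at h
  rw [h]
  simp only [Fintype.prod_sum_type, Sum.elim_inl, Sum.elim_inr, Finset.prod_coe_sort S
    (fun s => (X (input (b s)) : CloningFock d N)), Finset.prod_coe_sort S
    (fun s => (X (input (a s)) : CloningFock d N)),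
    Fintype.card_sum, Fintype.card_coe, Fintype.card_fin] at h2
  rw [extendedOverlap, h2]
  ring

theorem siteTest_mul_copies [NeZero d] (S : Finset (Fin N)) (b a : Fin N → Fin d)
    (i j : Fin M → Fin d) (U : SUGroup d) :
    siteTest S (pureState U) b a * copies M (pureState U) i j =
      if ∀ s ∈ Sᶜ, a s = b s then
        ((∏ s ∈ S, stateVector U (b s)) * ∏ m, stateVector U (i m)) *
        (starRingEnd ℂ) ((∏ s ∈ S, stateVector U (a s)) * ∏ m, stateVector U (j m)) else 0 := by
  have h1 : siteTest S (pureState U) b a = if ∀ s ∈ Sᶜ, a s = b s then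
      (∏ s ∈ S, stateVector U (b s)) * (starRingEnd ℂ) (∏ s ∈ S, stateVector U (a s)) else 0 := by
    rw [siteTest, tensorProd, Matrix.of_apply, ← Finset.prod_mul_prod_compl S,
      Finset.prod_congr rfl (g := fun s => stateVector U (b s) * (starRingEnd ℂ)
        (stateVector U (a s))) fun s hs => by rw [if_pos hs, pureState_apply],
      Finset.prod_mul_distrib, map_prod]
    split_ifs with h
    · rw [Finset.prod_eq_one (s := Sᶜ), mul_one]
      intro s hs
      rw [if_neg (Finset.mem_compl.mp hs), h s hs, Matrix.one_apply_eq]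
    · push Not at h
      obtain ⟨s, hs, hne⟩ := h
      rw [Finset.prod_eq_zero hs, mul_zero]
      rw [if_neg (Finset.mem_compl.mp hs), Matrix.one_apply_ne hne.symm]
  have h2 : copies M (pureState U) i j = (∏ m, stateVector U (i m)) *
      (starRingEnd ℂ) (∏ m, stateVector U (j m)) := by
    simp only [copies, tensorProd, Matrix.of_apply, pureState_apply, Finset.prod_mul_distrib,
      map_prod]
  rw [h1, h2]
  split_ifs
  · rw [map_mul]; ring
  · rw [zero_mul]

theorem integrable_siteTest_mul_copies [NeZero d] (S : Finset (Fin N)) (b a : Fin N → Fin d)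
    (i j : Fin M → Fin d) : Integrable (fun U =>
      siteTest S (pureState U) b a * copies M (pureState U) i j) (haarSU d) := by
  simp only [siteTest_mul_copies]
  split_ifs
  · have h : ∀ (b : Fin N → Fin d) (i : Fin M → Fin d), Continuous fun U : SUGroup d =>
        (∏ s ∈ S, stateVector U (b s)) * ∏ m, stateVector U (i m) := fun b i =>
      (continuous_finsetProd _ fun s _ => continuous_stateVector (b s)).mul
        (continuous_finsetProd _ fun m _ => continuous_stateVector (i m))
    exact integrable_haarSU ((h b i).mul (Complex.continuous_conj.comp (h a j)))
  · exact integrable_zero _ _ _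

theorem trace_siteTest_mul_apply (E : TensorOp d M →ₗ[ℂ] TensorOp d N) (T : TensorOp d N)
    (ρ : TensorOp d M) : (T * E ρ).trace = ∑ a, ∑ b, ∑ i, ∑ j,
      T b a * ρ i j * choiMatrix E (a, i) (b, j) := by
  rw [Matrix.trace, Finset.sum_comm]
  refine Finset.sum_congr rfl fun b _ => ?_
  rw [Matrix.diag, Matrix.mul_apply]
  refine Finset.sum_congr rfl fun a _ => ?_
  rw [apply_eq_sum_choiMatrix]
  simp only [Finset.mul_sum, mul_assoc]

theorem integrable_trace_siteTest [NeZero d] (S : Finset (Fin N))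
    (E : TensorOp d M →ₗ[ℂ] TensorOp d N) : Integrable (fun U =>
      (siteTest S (pureState U) * E (copies M (pureState U))).trace) (haarSU d) := by
  simp only [trace_siteTest_mul_apply]
  exact integrable_finsetSum _ fun a _ => integrable_finsetSum _ fun b _ =>
    integrable_finsetSum _ fun i _ => integrable_finsetSum _ fun j _ =>
      (integrable_siteTest_mul_copies S b a i j).mul_const _

theorem integral_trace_siteTest [NeZero d] (S : Finset (Fin N))
    (E : TensorOp d M →ₗ[ℂ] TensorOp d N) :
    ∫ U, (siteTest S (pureState U) * E (copies M (pureState U))).trace ∂(haarSU d) =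
      ((d.ascFactorial (S.card + M) : ℕ) : ℂ)⁻¹ * ∑ a, ∑ b, ∑ i, ∑ j,
        (if ∀ s ∈ Sᶜ, a s = b s then extendedOverlap S b a i j else 0) *
          choiMatrix E (a, i) (b, j) := by
  simp only [trace_siteTest_mul_apply]
  have hi := fun a b i j => (integrable_siteTest_mul_copies (d := d) (M := M) S b a i j).mul_const
    (choiMatrix E (a, i) (b, j))
  rw [integral_finsetSum _ fun a _ => integrable_finsetSum _ fun b _ =>
    integrable_finsetSum _ fun i _ => integrable_finsetSum _ fun j _ => hi a b i j, Finset.mul_sum]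
  refine Finset.sum_congr rfl fun a _ => ?_
  rw [integral_finsetSum _ fun b _ =>
    integrable_finsetSum _ fun i _ => integrable_finsetSum _ fun j _ => hi a b i j, Finset.mul_sum]
  refine Finset.sum_congr rfl fun b _ => ?_
  rw [integral_finsetSum _ fun i _ => integrable_finsetSum _ fun j _ => hi a b i j, Finset.mul_sum]
  refine Finset.sum_congr rfl fun i _ => ?_
  rw [integral_finsetSum _ fun j _ => hi a b i j, Finset.mul_sum]
  refine Finset.sum_congr rfl fun j _ => ?_
  rw [integral_mul_const, ← mul_assoc]
  congr 1
  simp only [siteTest_mul_copies]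
  split_ifs
  · exact extendedOverlap_eq_integral S b a i j
  · simp

theorem cloningFidelity_siteTest_eq [NeZero d] (S : Finset (Fin N))
    (E : TensorOp d M →ₗ[ℂ] TensorOp d N) : cloningFidelity (siteTest S) E =
      (∫ U, (siteTest S (pureState U) * E (copies M (pureState U))).trace ∂(haarSU d)).re := by
  have := integral_re (𝕜 := ℂ) (integrable_trace_siteTest S E)
  exact this

theorem cloningFidelity_symTest [NeZero d] (L : ℕ) (E : TensorOp d M →ₗ[ℂ] TensorOp d N) :
    cloningFidelity (symTest N L) E = ((N.choose L : ℕ) : ℝ)⁻¹ *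
      ∑ S ∈ Finset.powersetCard L (Finset.univ : Finset (Fin N)),
        cloningFidelity (siteTest S) E := by
  simp only [cloningFidelity]
  have hint : ∀ S : Finset (Fin N), Integrable (fun U =>
      (siteTest S (pureState U) * E (copies M (pureState U))).trace.re) (haarSU d) := fun S =>
    (integrable_trace_siteTest S E).re
  rw [← integral_finsetSum _ fun S _ => hint S, ← integral_const_mul]
  refine integral_congr_ae (Filter.Eventually.of_forall fun U => ?_)
  simp only [symTest]
  rw [smul_mul_assoc, Matrix.trace_smul, Finset.sum_mul, Matrix.trace_sum, smul_eq_mul,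
    ← Complex.ofReal_natCast, ← Complex.ofReal_inv, Complex.re_ofReal_mul, Complex.re_sum]

/-- The same coefficients `B` serve all `S`, so the fidelities on different sets can be added inside
the Fock space. -/
theorem IsCompletelyPositive.exists_cloningFidelity_eq [NeZero d]
    {E : TensorOp d M →ₗ[ℂ] TensorOp d N} (hE : IsCompletelyPositive E) :
    ∃ B : (Fin N → Fin d) × (Fin M → Fin d) → (Fin N → Fin d) → (Fin M → Fin d) → ℂ,
      (∀ a i b j, choiMatrix E (a, i) (b, j) = ∑ k, (starRingEnd ℂ) (B k a i) * B k b j) ∧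
      ∀ S : Finset (Fin N), cloningFidelity (siteTest S) E =
        ((d.ascFactorial (S.card + M) : ℕ) : ℝ)⁻¹ *
          ∑ k, fischerNormSq (∑ b, markedState b S (inputPoly N (B k b))) := by
  obtain ⟨B, hB⟩ := hE.exists_choiMatrix_eq
  refine ⟨B, hB, fun S => ?_⟩
  rw [cloningFidelity_siteTest_eq, integral_trace_siteTest]
  have h : ∑ a, ∑ b, ∑ i, ∑ j, (if ∀ s ∈ Sᶜ, a s = b s then extendedOverlap S b a i j else 0) *
      choiMatrix E (a, i) (b, j) =
      ((∑ k, fischerNormSq (∑ b, markedState b S (inputPoly N (B k b))) : ℝ) : ℂ) := by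
    rw [Complex.ofReal_sum]
    simp only [fischerNormSq_sum_markedState, hB, Finset.mul_sum]
    refine Eq.symm ((sum_comm_three _).trans ?_)
    exact Finset.sum_congr rfl fun a _ => Finset.sum_congr rfl fun b _ => sum_comm_three _
  rw [h, ← Complex.ofReal_natCast, ← Complex.ofReal_inv, Complex.re_ofReal_mul, Complex.ofReal_re]

theorem fischerNormSq_cloningVector (B : (Fin N → Fin d) → (Fin M → Fin d) → ℂ) :
    (fischerNormSq (cloningVector B) : ℂ) = ∑ b, ∑ i, ∑ j,
      (M.factorial * symProj (Fin M) (Fin d) i j) * ((starRingEnd ℂ) (B b i) * B b j) := by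
  rw [cloningVector, fischerNormSq_sum_markedState]
  refine Finset.sum_congr rfl fun a _ => ?_
  rw [Finset.sum_eq_single a]
  · refine Finset.sum_congr rfl fun i _ => Finset.sum_congr rfl fun j _ => ?_
    rw [if_pos fun _ _ => rfl, extendedOverlap, Finset.prod_empty (f := fun s => X (CloningMode.input (a s))), one_mul,
      one_mul, fischer_prod_X_prod_X input_injective, Fintype.card_fin]
  · intro b _ hb
    refine Finset.sum_eq_zero fun i _ => Finset.sum_eq_zero fun j _ => ?_
    rw [if_neg fun h => hb (funext fun s => (h s (by simp)).symm), zero_mul]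
  · exact fun h => absurd (Finset.mem_univ _) h

/-- Trace preservation says that the output trace of the Choi matrix is the identity, so the norms
add up to `M!` times the trace of the symmetric projection. -/
theorem IsChannel.sum_fischerNormSq_cloningVector {E : TensorOp d M →ₗ[ℂ] TensorOp d N}
    (hE : IsChannel E)
    {B : (Fin N → Fin d) × (Fin M → Fin d) → (Fin N → Fin d) → (Fin M → Fin d) → ℂ}
    (hB : ∀ a i b j, choiMatrix E (a, i) (b, j) = ∑ k, (starRingEnd ℂ) (B k a i) * B k b j) :
    ∑ k, fischerNormSq (cloningVector (B k)) = (d.ascFactorial M : ℕ) := by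
  have hC : ∀ i j : Fin M → Fin d, ∑ b, choiMatrix E (b, i) (b, j) = if i = j then 1 else 0 :=
    fun i j => by
      have := hE.2 (Matrix.single i j 1)
      split_ifs with h
      · subst h
        rw [Matrix.trace_single_eq_same] at this
        exact this
      · rw [Matrix.trace_single_eq_of_ne _ _ _ h] at this
        exact this
  have h : ((∑ k, fischerNormSq (cloningVector (B k)) : ℝ) : ℂ) = (d.ascFactorial M : ℕ) := by
    rw [Complex.ofReal_sum]
    simp only [fischerNormSq_cloningVector]
    have h1 : ∑ k, ∑ b, ∑ i, ∑ j,
        (M.factorial * symProj (Fin M) (Fin d) i j) * ((starRingEnd ℂ) (B k b i) * B k b j) =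
        ∑ i, ∑ j, (M.factorial * symProj (Fin M) (Fin d) i j) *
          ∑ b, choiMatrix E (b, i) (b, j) := by
      simp only [hB, Finset.mul_sum]
      rw [Finset.sum_comm, Finset.sum_congr rfl fun b _ => sum_comm_three _, sum_comm_three]
    rw [h1]
    simp only [hC, mul_ite, mul_one, mul_zero, Finset.sum_ite_eq, Finset.mem_univ, if_true]
    rw [← Finset.mul_sum]
    have := trace_symProj (κ := Fin d) M
    rw [Fintype.card_fin] at this
    exact this
  exact_mod_cast h

/-- The upper bound for the average fidelity. -/
theorem IsChannel.cloningFidelity_symTest_le [NeZero d] {e L : ℕ} (hd : d = e + 1) (hL : L ≤ N)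
    {E : TensorOp d M →ₗ[ℂ] TensorOp d N} (hE : IsChannel E) :
    cloningFidelity (symTest N L) E ≤ ((N.choose L : ℕ) : ℝ)⁻¹ *
      (((d.ascFactorial (L + M) : ℕ) : ℝ)⁻¹ * (((L.factorial : ℝ) ^ 2)⁻¹ *
      ((∑ k ∈ Finset.range (L + 1), (L.choose k : ℝ) ^ 2 *
        (((k + 1).ascFactorial (L - k) * (L - k).factorial * (N - k).descFactorial (L - k) : ℕ) *
          (k.factorial * M.descFactorial k * (N + e).descFactorial k : ℕ))) *
        (d.ascFactorial M : ℕ)))) := by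
  obtain ⟨B, hB, hF⟩ := hE.1.exists_cloningFidelity_eq
  -- Every `L`-set is reached in `L!` orders, and the states of different sets are orthogonal.
  have hS : ∀ k, ((L.factorial : ℝ) ^ 2) *
      ∑ S ∈ Finset.powersetCard L (Finset.univ : Finset (Fin N)),
        fischerNormSq (∑ b, markedState b S (inputPoly N (B k b))) =
      fischerNormSq (((collectSites d N + contractSites d N) ^ L) (cloningVector (B k))) :=
    fun k => by
      rw [cloningVector, map_sum, Finset.sum_congr rfl fun b _ =>
        add_sites_pow_markedState b L fun c => pderiv_inputPoly (by simp) (B k b),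
        ← Finset.smul_sum, Finset.sum_comm, fischerNormSq_smul, fischerNormSq_sum_of_orthogonal,
        ← Complex.ofReal_natCast, Complex.normSq_ofReal, ← sq]
      intro S hS S' hS' hne
      rw [fischer_sum_left]
      refine Finset.sum_eq_zero fun a _ => ?_
      rw [fischer_sum_right]
      refine Finset.sum_eq_zero fun b _ => fischer_markedState_of_ne a b ?_ hne _ fun s =>
        pderiv_inputPoly (by simp) _
      rw [(Finset.mem_powersetCard.mp hS).2, (Finset.mem_powersetCard.mp hS').2]
  have hL0 : (0 : ℝ) < (L.factorial : ℝ) ^ 2 := by positivity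
  rw [cloningFidelity_symTest]
  refine mul_le_mul_of_nonneg_left ?_ (by positivity)
  rw [Finset.sum_congr rfl fun S hS => by rw [hF S, (Finset.mem_powersetCard.mp hS).2],
    ← Finset.mul_sum, Finset.sum_comm]
  refine mul_le_mul_of_nonneg_left ?_ (by positivity)
  rw [← hE.sum_fischerNormSq_cloningVector hB, le_inv_mul_iff₀ hL0, Finset.mul_sum, Finset.mul_sum]
  refine Finset.sum_le_sum fun k _ => ?_
  rw [hS k]
  exact fischerNormSq_add_pow_le hd hL (hasCloningDegree_cloningVector (B k))

end FidelityNorm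

/-! ### Kraus operators -/

section Kraus

variable {ι κ τ : Type} [Fintype ι] [Fintype τ]

/-- The map with the Kraus operators `K t`. -/
noncomputable def krausMap (K : τ → Matrix κ ι ℂ) : Matrix ι ι ℂ →ₗ[ℂ] Matrix κ κ ℂ where
  toFun ρ := ∑ t, K t * ρ * (K t).conjTranspose
  map_add' ρ ρ' := by simp only [Matrix.mul_add, Matrix.add_mul, Finset.sum_add_distrib]
  map_smul' c ρ := by
    simp only [Matrix.mul_smul, Matrix.smul_mul, ← Finset.smul_sum, RingHom.id_apply]

theorem krausMap_apply (K : τ → Matrix κ ι ℂ) (ρ : Matrix ι ι ℂ) :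
    krausMap K ρ = ∑ t, K t * ρ * (K t).conjTranspose := rfl

/-- The ampliation has the Kraus operators `A t = K t ⊗ 1`, so each summand is a congruence of `X`.
-/
theorem isCompletelyPositive_krausMap [Fintype κ] (K : τ → Matrix κ ι ℂ) :
    IsCompletelyPositive (krausMap K) := by
  classical
  intro k X hX
  obtain ⟨A, hA⟩ : ∃ A : τ → Matrix (κ × Fin k) (ι × Fin k) ℂ, ∀ t x y,
      A t x y = if x.2 = y.2 then K t x.1 y.1 else 0 :=
    ⟨fun t => Matrix.of fun x y => if x.2 = y.2 then K t x.1 y.1 else 0, fun _ _ _ => rfl⟩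
  have h : (Matrix.of fun a b : κ × Fin k =>
      krausMap K (Matrix.of fun i j => X (i, a.2) (j, b.2)) a.1 b.1) =
      ∑ t, A t * X * (A t).conjTranspose := by
    ext a b
    rw [Matrix.of_apply, krausMap_apply, Matrix.sum_apply, Matrix.sum_apply]
    refine Finset.sum_congr rfl fun t _ => ?_
    rw [Matrix.mul_apply, Matrix.mul_apply, Fintype.sum_prod_type]
    refine Finset.sum_congr rfl fun j _ => ?_
    rw [Finset.sum_eq_single b.2]
    · rw [Matrix.conjTranspose_apply, Matrix.conjTranspose_apply, hA t b, if_pos rfl]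
      congr 1
      rw [Matrix.mul_apply, Matrix.mul_apply, Fintype.sum_prod_type]
      refine Finset.sum_congr rfl fun i _ => ?_
      rw [Finset.sum_eq_single a.2]
      · rw [hA, if_pos rfl, Matrix.of_apply]
      · intro y _ hy
        rw [hA, if_neg hy.symm, zero_mul]
      · exact fun h => absurd (Finset.mem_univ _) h
    · intro y _ hy
      rw [Matrix.conjTranspose_apply, hA t b, if_neg hy.symm, star_zero, mul_zero]
    · exact fun h => absurd (Finset.mem_univ _) h
  rw [h]
  exact Matrix.posSemidef_sum _ fun t _ => hX.mul_mul_conjTranspose_same (A t)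

theorem isChannel_krausMap [Fintype κ] [DecidableEq ι] {K : τ → Matrix κ ι ℂ}
    (hK : ∑ t, (K t).conjTranspose * K t = 1) : IsChannel (krausMap K) := by
  refine ⟨isCompletelyPositive_krausMap K, fun X => ?_⟩
  rw [krausMap_apply, Matrix.trace_sum]
  calc ∑ t, (K t * X * (K t).conjTranspose).trace
      = ∑ t, ((K t).conjTranspose * K t * X).trace := Finset.sum_congr rfl fun t _ => by
        rw [Matrix.trace_mul_comm, ← Matrix.mul_assoc]
    _ = X.trace := by rw [← Matrix.trace_sum, ← Finset.sum_mul, hK, Matrix.one_mul]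

end Kraus

/-! ### The symmetric projection and pure states -/

section Cloner

/-- The dimension of the symmetric subspace of `(ℂ^d)^{⊗ n}`. -/
noncomputable def symDim (d n : ℕ) : ℝ := (d.ascFactorial n : ℕ) / (n.factorial : ℕ)

theorem symDim_pos (d : ℕ) [NeZero d] (n : ℕ) : 0 < symDim d n :=
  div_pos (Nat.cast_pos.mpr (ascFactorial_pos_of_pos (NeZero.pos d) n))
    (Nat.cast_pos.mpr n.factorial_pos)

variable {d : ℕ}

theorem tensorProd_mul {n : ℕ} (A B : Fin n → Matrix (Fin d) (Fin d) ℂ) :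
    tensorProd A * tensorProd B = tensorProd fun i => A i * B i := by
  ext a b
  rw [Matrix.mul_apply]
  simp only [tensorProd, Matrix.of_apply, ← Finset.prod_mul_distrib, Matrix.mul_apply]
  exact sum_pi_prod_mul fun i k => A i (a i) k * B i k (b i)

/-- Permutation invariant operators commute with the symmetric projection. -/
theorem mul_symProj_comm {n : ℕ} {A : TensorOp d n}
    (hA : ∀ (π : Equiv.Perm (Fin n)) a b, A (a ∘ π) (b ∘ π) = A a b) :
    A * symProj (Fin n) (Fin d) = symProj (Fin n) (Fin d) * A := by
  ext a b
  have h1 : (A * symProj (Fin n) (Fin d)) a b =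
      ((Fintype.card (Fin n)).factorial : ℂ)⁻¹ * ∑ π : Equiv.Perm (Fin n), A a (b ∘ π) := by
    rw [Matrix.mul_apply, ← sum_symProj_mul b fun c => A a c]
    exact Finset.sum_congr rfl fun c _ => by rw [symProj_comm, mul_comm]
  rw [h1, Matrix.mul_apply, sum_symProj_mul a fun c => A c b,
    ← Equiv.sum_comp (Equiv.inv (Equiv.Perm (Fin n)))]
  refine congrArg _ (Finset.sum_congr rfl fun π _ => ?_)
  rw [← hA π]
  congr 1
  funext i
  simp

theorem siteTest_comp_perm {n : ℕ} (S : Finset (Fin n)) (ρ : Matrix (Fin d) (Fin d) ℂ)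
    (π : Equiv.Perm (Fin n)) (a b : Fin n → Fin d) :
    siteTest S ρ (a ∘ π) (b ∘ π) = siteTest (S.map π.toEmbedding) ρ a b := by
  simp only [siteTest, tensorProd, Matrix.of_apply]
  rw [← Equiv.prod_comp π fun j => (if j ∈ S.map π.toEmbedding then ρ else 1) (a j) (b j)]
  refine Finset.prod_congr rfl fun i _ => ?_
  simp

theorem symTest_comp_perm {n : ℕ} (L : ℕ) (ρ : Matrix (Fin d) (Fin d) ℂ)
    (π : Equiv.Perm (Fin n)) (a b : Fin n → Fin d) :
    symTest n L ρ (a ∘ π) (b ∘ π) = symTest n L ρ a b := by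
  simp only [symTest, Matrix.smul_apply, Matrix.sum_apply, siteTest_comp_perm]
  congr 1
  refine Finset.sum_bij' (fun S _ => S.map π.toEmbedding) (fun S _ => S.map π.symm.toEmbedding)
    ?_ ?_ ?_ ?_ ?_
  · intro S hS; simpa using hS
  · intro S hS; simpa using hS
  · intro S _; ext x; simp
  · intro S _; ext x; simp
  · intros; rfl

variable [NeZero d]

theorem haar_moment_eq_symDim {n : ℕ} (a b : Fin n → Fin d) :
    ∫ U, (∏ i, stateVector U (a i)) * (starRingEnd ℂ) (∏ i, stateVector U (b i)) ∂(haarSU d) =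
      (symDim d n : ℂ)⁻¹ * symProj (Fin n) (Fin d) a b := by
  rw [haar_moment_fin, symDim, Complex.ofReal_div, Complex.ofReal_natCast, Complex.ofReal_natCast,
    inv_div]

theorem symProj_eq_integral {n : ℕ} (a b : Fin n → Fin d) : symProj (Fin n) (Fin d) a b =
    (symDim d n : ℂ) * ∫ U, (∏ i, stateVector U (a i)) *
      (starRingEnd ℂ) (∏ i, stateVector U (b i)) ∂(haarSU d) := by
  rw [haar_moment_eq_symDim, mul_inv_cancel_left₀]
  exact_mod_cast (symDim_pos d n).ne'

/-- The partial trace of the symmetric projection. -/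
theorem sum_symProj_append {M R : ℕ} (i j : Fin M → Fin d) :
    ∑ r : Fin R → Fin d, symProj (Fin (M + R)) (Fin d) (Fin.append i r) (Fin.append j r) =
      (symDim d (M + R) / symDim d M : ℝ) * symProj (Fin M) (Fin d) i j := by
  simp only [symProj_eq_integral (n := M + R)]
  rw [← Finset.mul_sum, ← integral_finsetSum _ fun r _ => integrable_stateVector_mul _ _]
  -- As an integral over product states, the symmetric projection loses the traced sites as factors
  -- `1`.
  have h : ∀ U : SUGroup d, ∑ r : Fin R → Fin d,
      (∏ s, stateVector U (Fin.append i r s)) *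
        (starRingEnd ℂ) (∏ s, stateVector U (Fin.append j r s)) =
      (∏ m, stateVector U (i m)) * (starRingEnd ℂ) (∏ m, stateVector U (j m)) := fun U => by
    have h1 : ∑ r : Fin R → Fin d, ∏ s, stateVector U (r s) * (starRingEnd ℂ) (stateVector U (r s))
        = 1 := by
      rw [sum_pi_prod_mul fun _ k => stateVector U k * (starRingEnd ℂ) (stateVector U k),
        sum_stateVector, Finset.prod_const_one]
    rw [← mul_one ((∏ m, stateVector U (i m)) * (starRingEnd ℂ) (∏ m, stateVector U (j m))), ← h1,
      Finset.mul_sum]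
    refine Finset.sum_congr rfl fun r _ => ?_
    simp only [Fin.prod_univ_add, Fin.append_left, Fin.append_right, map_mul, map_prod,
      Finset.prod_mul_distrib]
    ring
  simp only [h]
  rw [haar_moment_eq_symDim, Complex.ofReal_div]
  ring

theorem pureState_mul_self (U : SUGroup d) : pureState U * pureState U = pureState U := by
  ext i j
  rw [Matrix.mul_apply]
  simp only [pureState_apply]
  calc ∑ k, stateVector U i * (starRingEnd ℂ) (stateVector U k) *
        (stateVector U k * (starRingEnd ℂ) (stateVector U j))
      = stateVector U i * (starRingEnd ℂ) (stateVector U j) *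
        ∑ k, stateVector U k * (starRingEnd ℂ) (stateVector U k) := by
        rw [Finset.mul_sum]; exact Finset.sum_congr rfl fun k _ => by ring
    _ = _ := by rw [sum_stateVector, mul_one]

variable {n : ℕ}

theorem siteTest_mul_siteTest (S S' : Finset (Fin n)) (U : SUGroup d) :
    siteTest S (pureState U) * siteTest S' (pureState U) =
      siteTest (S ∪ S') (pureState U) := by
  rw [siteTest, siteTest, siteTest, tensorProd_mul]
  congr 1
  funext i
  by_cases h : i ∈ S <;> by_cases h' : i ∈ S' <;> simp [h, h', pureState_mul_self]

/-- The probability that all the sites of a random symmetric product state pass a test. -/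
theorem trace_siteTest_mul_symProj (S : Finset (Fin n)) (U : SUGroup d) :
    (siteTest S (pureState U) * symProj (Fin n) (Fin d)).trace =
      (symDim d n / symDim d S.card : ℝ) := by
  have h0 : ∫ V, ‖stateVector V (0 : Fin d)‖ ^ (2 * S.card) ∂(haarSU d) =
      (symDim d S.card)⁻¹ := by
    have h := haar_moment_eq_symDim (d := d) (n := S.card) (fun _ => 0) fun _ => 0
    have hP : symProj (Fin S.card) (Fin d) (fun _ => 0) (fun _ => 0) = 1 := by
      rw [symProj_apply]
      simp only [Function.comp_def, if_true]
      rw [Finset.sum_const, Finset.card_univ, Fintype.card_perm, nsmul_eq_mul, mul_one, inv_mul_cancel₀]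
      exact_mod_cast Nat.factorial_ne_zero _
    rw [hP, mul_one] at h
    have h2 : ∀ V : SUGroup d, (∏ _i : Fin S.card, stateVector V (0 : Fin d)) *
        (starRingEnd ℂ) (∏ _i : Fin S.card, stateVector V (0 : Fin d)) =
        ((‖stateVector V (0 : Fin d)‖ ^ (2 * S.card) : ℝ) : ℂ) := fun V => by
      rw [Finset.prod_const, Finset.card_univ, Fintype.card_fin, Complex.mul_conj, map_pow,
        Complex.normSq_eq_norm_sq, ← pow_mul]
    simp only [h2] at h
    rw [integral_complex_ofReal] at h
    exact_mod_cast h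
  have hI := integral_norm_sum_mul_stateVector_pow S.card
    fun i => (starRingEnd ℂ) (stateVector U i)
  have hU : ∑ i, Complex.normSq ((starRingEnd ℂ) (stateVector U i)) = 1 := by
    have := sum_stateVector U
    simp only [Complex.mul_conj] at this
    simp only [Complex.normSq_conj]
    exact_mod_cast this
  rw [hU, one_pow, one_mul, h0] at hI
  -- Against a product of copies of a state `φ`, a site in `S` contributes `|⟨ψ, φ⟩|²` and any other
  -- site contributes `1`.
  have hprod : ∀ V : SUGroup d, ∑ a, ∑ b, siteTest S (pureState U) a b *
      ((∏ i, stateVector V (b i)) * (starRingEnd ℂ) (∏ i, stateVector V (a i))) =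
      ((‖∑ i, (starRingEnd ℂ) (stateVector U i) * stateVector V i‖ ^ (2 * S.card) : ℝ) : ℂ) :=
    fun V => by
      have hfac : ∀ ρ : Fin n → Matrix (Fin d) (Fin d) ℂ, ∑ a, ∑ b, tensorProd ρ a b *
          ((∏ i, stateVector V (b i)) * (starRingEnd ℂ) (∏ i, stateVector V (a i))) =
          ∏ i, ∑ k, ∑ l, ρ i k l * (stateVector V l * (starRingEnd ℂ) (stateVector V k)) :=
        fun ρ => by
          rw [← sum_pi_prod_mul]
          refine Finset.sum_congr rfl fun a _ => ?_
          rw [← sum_pi_prod_mul]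
          refine Finset.sum_congr rfl fun b _ => ?_
          rw [tensorProd, Matrix.of_apply, map_prod, ← Finset.prod_mul_distrib,
            ← Finset.prod_mul_distrib]
      have hone : ∑ k, ∑ l, (1 : Matrix (Fin d) (Fin d) ℂ) k l *
          (stateVector V l * (starRingEnd ℂ) (stateVector V k)) = 1 := by
        rw [← sum_stateVector V]
        refine Finset.sum_congr rfl fun k _ => ?_
        simp [Matrix.one_apply]
      have hpure : ∑ k, ∑ l, pureState U k l *
          (stateVector V l * (starRingEnd ℂ) (stateVector V k)) =
          ((‖∑ i, (starRingEnd ℂ) (stateVector U i) * stateVector V i‖ ^ 2 : ℝ) : ℂ) := by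
        rw [← Complex.normSq_eq_norm_sq, ← Complex.mul_conj, map_sum, mul_comm, Finset.sum_mul_sum]
        refine Finset.sum_congr rfl fun k _ => Finset.sum_congr rfl fun l _ => ?_
        rw [pureState_apply, map_mul, Complex.conj_conj]
        ring
      rw [siteTest, hfac, ← Finset.prod_mul_prod_compl S,
        Finset.prod_congr rfl (g := fun _ => ((‖∑ i, (starRingEnd ℂ) (stateVector U i) *
          stateVector V i‖ ^ 2 : ℝ) : ℂ)) fun s hs => by rw [if_pos hs, hpure],
        Finset.prod_eq_one (s := Sᶜ) fun s hs => by rw [if_neg (Finset.mem_compl.mp hs), hone],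
        mul_one, Finset.prod_const, ← Complex.ofReal_pow, ← pow_mul]
  rw [Matrix.trace]
  simp only [Matrix.diag, Matrix.mul_apply, symProj_eq_integral]
  have h3 : ∀ a, ∑ b, siteTest S (pureState U) a b * ((symDim d n : ℂ) *
      ∫ V, (∏ i, stateVector V (b i)) * (starRingEnd ℂ) (∏ i, stateVector V (a i)) ∂(haarSU d)) =
      (symDim d n : ℂ) * ∫ V, ∑ b, siteTest S (pureState U) a b *
        ((∏ i, stateVector V (b i)) * (starRingEnd ℂ) (∏ i, stateVector V (a i))) ∂(haarSU d) :=
    fun a => by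
      rw [integral_finsetSum _ fun b _ => (integrable_stateVector_mul b a).const_mul _,
        Finset.mul_sum]
      refine Finset.sum_congr rfl fun b _ => ?_
      rw [integral_const_mul]
      ring
  have h4 := integral_finsetSum (μ := haarSU d) (Finset.univ : Finset (Fin n → Fin d))
    (f := fun a V => ∑ b, siteTest S (pureState U) a b *
      ((∏ i, stateVector V (b i)) * (starRingEnd ℂ) (∏ i, stateVector V (a i))))
    fun a _ => integrable_finsetSum _ fun b _ => (integrable_stateVector_mul b a).const_mul _
  rw [Finset.sum_congr rfl fun a _ => h3 a, ← Finset.mul_sum, ← h4]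
  simp only [hprod]
  rw [integral_complex_ofReal, hI]
  push_cast
  ring

/-- The tests on different sets of sites of the same size have the same fidelity for a symmetric
output. -/
theorem trace_siteTest_mul_symProj_mul (S S₀ : Finset (Fin n)) (U : SUGroup d) :
    (siteTest S (pureState U) * (symProj (Fin n) (Fin d) * siteTest S₀ (pureState U) *
      symProj (Fin n) (Fin d))).trace =
      (((n.choose S.card : ℕ) : ℝ)⁻¹ * ∑ S' ∈ Finset.powersetCard S.card Finset.univ,
        symDim d n / symDim d (S' ∪ S₀).card : ℝ) := by
  set P := symProj (Fin n) (Fin d) with hP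
  set T : TensorOp d n := siteTest S₀ (pureState U) with hT
  set G : TensorOp d n := P * T * P with hG
  have hGl : ∀ (π : Equiv.Perm (Fin n)) a b, G (a ∘ π) b = G a b := fun π a b => by
    rw [hG, Matrix.mul_assoc, Matrix.mul_apply, Matrix.mul_apply]
    exact Finset.sum_congr rfl fun c _ => by rw [hP, symProj_comp_perm_left]
  have hGr : ∀ (π : Equiv.Perm (Fin n)) a b, G a (b ∘ π) = G a b := fun π a b => by
    rw [hG, Matrix.mul_apply, Matrix.mul_apply]
    exact Finset.sum_congr rfl fun c _ => by rw [hP, symProj_comp_perm_right]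
  -- Since `G` is invariant under permuting either index, the trace depends on `S` only through its
  -- size, and the test may be replaced by the average `symTest`.
  have hmap : ∀ π : Equiv.Perm (Fin n), (siteTest (S.map π.toEmbedding) (pureState U) * G).trace =
      (siteTest S (pureState U) * G).trace := fun π => by
    have ha : ∀ f : (Fin n → Fin d) → ℂ, ∑ a, f a = ∑ a, f (a ∘ π) := fun f =>
      (Equiv.sum_comp (Equiv.arrowCongr π.symm (Equiv.refl (Fin d))) f).symm
    simp only [Matrix.trace, Matrix.diag, Matrix.mul_apply]
    rw [ha fun a => ∑ b, siteTest S (pureState U) a b * G b a]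
    refine Finset.sum_congr rfl fun a _ => ?_
    rw [ha fun b => siteTest S (pureState U) (a ∘ π) b * G b (a ∘ π)]
    exact Finset.sum_congr rfl fun b _ => by rw [hGl, hGr, siteTest_comp_perm]
  have hsame : ∀ S' ∈ Finset.powersetCard S.card (Finset.univ : Finset (Fin n)),
      (siteTest S' (pureState U) * G).trace = (siteTest S (pureState U) * G).trace := fun S' hS' => by
    obtain ⟨π, rfl⟩ := Equiv.Perm.exists_map_finset_eq S S' (Finset.mem_powersetCard.mp hS').2.symm
    exact hmap π
  have hc : ((n.choose S.card : ℕ) : ℂ) ≠ 0 := by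
    have := Nat.choose_pos (card_finset_fin_le S)
    exact_mod_cast this.ne'
  have hsym : (symTest n S.card (pureState U) * G).trace =
      (siteTest S (pureState U) * G).trace := by
    rw [symTest, smul_mul_assoc, Matrix.trace_smul, Finset.sum_mul, Matrix.trace_sum,
      Finset.sum_congr rfl hsame, Finset.sum_const, Finset.card_powersetCard, Finset.card_univ,
      Fintype.card_fin, nsmul_eq_mul, smul_eq_mul, inv_mul_cancel_left₀ hc]
  -- The averaged test commutes with `P`, so cyclicity of the trace removes one `P`, and the
  -- adjacent tests merge into tests on unions.
  have hcomm : symTest n S.card (pureState U) * P = P * symTest n S.card (pureState U) :=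
    mul_symProj_comm fun π a b => symTest_comp_perm _ _ π a b
  have hmain : (symTest n S.card (pureState U) * G).trace =
      (symTest n S.card (pureState U) * T * P).trace := by
    calc (symTest n S.card (pureState U) * G).trace
        = (P * (symTest n S.card (pureState U) * P) * T).trace := by
          rw [hG, ← Matrix.mul_assoc, Matrix.trace_mul_comm, ← Matrix.mul_assoc, ← Matrix.mul_assoc,
            ← Matrix.mul_assoc]
      _ = (P * (symTest n S.card (pureState U) * T)).trace := by
          rw [hcomm, ← Matrix.mul_assoc, symProj_mul_self, Matrix.mul_assoc]
      _ = _ := Matrix.trace_mul_comm _ _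
  rw [← hsym, hmain, symTest, smul_mul_assoc, smul_mul_assoc, Matrix.trace_smul, Finset.sum_mul,
    Finset.sum_mul, Matrix.trace_sum, smul_eq_mul]
  simp only [hT, siteTest_mul_siteTest, hP, trace_siteTest_mul_symProj]
  push_cast
  rfl

end Cloner

/-! ### The optimal cloner -/

/-- Sums over sets of a given size, sorted by the number of elements outside a given set. -/
theorem sum_powersetCard_card_union {n : ℕ} (L : ℕ) (S₀ : Finset (Fin n)) (g : ℕ → ℝ) :
    ∑ S ∈ Finset.powersetCard L (Finset.univ : Finset (Fin n)), g (S ∪ S₀).card =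
      ∑ j ∈ Finset.range (L + 1),
        (S₀.card.choose (L - j) * (n - S₀.card).choose j : ℕ) * g (S₀.card + j) := by
  have h : ∀ j ∈ Finset.range (L + 1),
      ((S₀.card.choose (L - j) * (n - S₀.card).choose j : ℕ) : ℝ) * g (S₀.card + j) =
      ∑ _p ∈ Finset.powersetCard (L - j) S₀ ×ˢ Finset.powersetCard j S₀ᶜ, g (S₀.card + j) :=
    fun j _ => by
      rw [Finset.sum_const, nsmul_eq_mul, Finset.card_product, Finset.card_powersetCard,
        Finset.card_powersetCard, Finset.card_compl, Fintype.card_fin]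
  rw [Finset.sum_congr rfl h, Finset.sum_sigma']
  refine Finset.sum_bij' (fun S _ => ⟨(S \ S₀).card, S ∩ S₀, S \ S₀⟩) (fun p _ => p.2.1 ∪ p.2.2)
    ?_ ?_ ?_ ?_ ?_
  · intro S hS
    have hc := Finset.card_sdiff_add_card_inter S S₀
    rw [(Finset.mem_powersetCard.mp hS).2] at hc
    simp only [Finset.mem_sigma, Finset.mem_range, Finset.mem_product, Finset.mem_powersetCard,
      Finset.inter_subset_right, true_and, and_true]
    refine ⟨by omega, by omega, fun x hx => ?_⟩
    simpa using (Finset.mem_sdiff.mp hx).2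
  · rintro ⟨j, A, B⟩ h
    simp only [Finset.mem_sigma, Finset.mem_range, Finset.mem_product, Finset.mem_powersetCard] at h
    obtain ⟨hj, ⟨hA, hAc⟩, hB, hBc⟩ := h
    have hd : Disjoint A B := Finset.disjoint_of_subset_left hA
      (Finset.disjoint_of_subset_right hB disjoint_compl_right)
    simp only [Finset.mem_powersetCard, Finset.subset_univ, true_and]
    rw [Finset.card_union_of_disjoint hd]
    omega
  · intro S _
    ext x
    simp only [Finset.mem_union, Finset.mem_inter, Finset.mem_sdiff]
    tauto
  · rintro ⟨j, A, B⟩ h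
    simp only [Finset.mem_sigma, Finset.mem_range, Finset.mem_product, Finset.mem_powersetCard] at h
    obtain ⟨hj, ⟨hA, hAc⟩, hB, hBc⟩ := h
    have h1 : (A ∪ B) ∩ S₀ = A := by
      ext x
      have := @hA x
      have := @hB x
      simp only [Finset.mem_union, Finset.mem_inter, Finset.mem_compl] at *
      tauto
    have h2 : (A ∪ B) \ S₀ = B := by
      ext x
      have := @hA x
      have := @hB x
      simp only [Finset.mem_union, Finset.mem_sdiff, Finset.mem_compl] at *
      tauto
    simp only [h1, h2, hBc]
  · intro S _
    rw [Finset.union_comm, ← Finset.card_union_of_disjoint (Finset.disjoint_sdiff),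
      Finset.union_sdiff_self_eq_union]

section Cloner

variable {d M R : ℕ} [NeZero d]

/-- The Kraus operators of the cloner that appends completely mixed states to a symmetric input,
projects onto the symmetric subspace and renormalizes. -/
noncomputable def clonerKraus (d M R : ℕ) [NeZero d] : (Fin R → Fin d) ⊕ (Fin M → Fin d) →
    Matrix (Fin (M + R) → Fin d) (Fin M → Fin d) ℂ
  | Sum.inl r => (Real.sqrt (symDim d M / symDim d (M + R)) : ℂ) •
      Matrix.of fun b i => symProj (Fin (M + R)) (Fin d) b (Fin.append i r)
  -- These operators only complete trace preservation on the complement of the symmetric subspace;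
  -- they annihilate the inputs `copies M (pureState U)`.
  | Sum.inr j => Matrix.of fun b i =>
      if b = 0 then (1 - symProj (Fin M) (Fin d)) j i else 0

theorem clonerKraus_inl (r : Fin R → Fin d) (b : Fin (M + R) → Fin d) (i : Fin M → Fin d) :
    clonerKraus d M R (Sum.inl r) b i = (Real.sqrt (symDim d M / symDim d (M + R)) : ℂ) *
      symProj (Fin (M + R)) (Fin d) b (Fin.append i r) := rfl

theorem clonerKraus_inr (j : Fin M → Fin d) (b : Fin (M + R) → Fin d) (i : Fin M → Fin d) :
    clonerKraus d M R (Sum.inr j) b i =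
      if b = 0 then (1 - symProj (Fin M) (Fin d)) j i else 0 := rfl

theorem sqrt_symDim_mul_self (d m n : ℕ) [NeZero d] :
    (Real.sqrt (symDim d m / symDim d n) : ℂ) * (Real.sqrt (symDim d m / symDim d n) : ℂ) =
      (symDim d m / symDim d n : ℝ) := by
  rw [← Complex.ofReal_mul, Real.mul_self_sqrt (div_pos (symDim_pos d m) (symDim_pos d n)).le]

theorem sum_conjTranspose_mul_clonerKraus :
    ∑ t, (clonerKraus d M R t).conjTranspose * clonerKraus d M R t = 1 := by
  have h1 : ∑ r : Fin R → Fin d, (clonerKraus d M R (Sum.inl r)).conjTranspose *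
      clonerKraus d M R (Sum.inl r) = symProj (Fin M) (Fin d) := by
    ext i j
    have h : ∀ r : Fin R → Fin d, ((clonerKraus d M R (Sum.inl r)).conjTranspose *
        clonerKraus d M R (Sum.inl r)) i j = (symDim d M / symDim d (M + R) : ℝ) *
        symProj (Fin (M + R)) (Fin d) (Fin.append i r) (Fin.append j r) := fun r => by
      have hP := congrFun (congrFun (symProj_mul_self (ι := Fin (M + R)) (κ := Fin d))
        (Fin.append i r)) (Fin.append j r)
      rw [Matrix.mul_apply] at hP
      rw [Matrix.mul_apply, ← hP, ← sqrt_symDim_mul_self, Finset.mul_sum]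
      refine Finset.sum_congr rfl fun b _ => ?_
      rw [Matrix.conjTranspose_apply, clonerKraus_inl, clonerKraus_inl, ← starRingEnd_apply,
        map_mul, Complex.conj_ofReal, conj_symProj, symProj_comm b (Fin.append i r)]
      ring
    have h0 : (symDim d M / symDim d (M + R)) * (symDim d (M + R) / symDim d M) = 1 := by
      have := (symDim_pos d M).ne'
      have := (symDim_pos d (M + R)).ne'
      field_simp
    rw [Matrix.sum_apply, Finset.sum_congr rfl fun r _ => h r, ← Finset.mul_sum,
      sum_symProj_append, ← mul_assoc, ← Complex.ofReal_mul, h0, Complex.ofReal_one, one_mul]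
  have h2 : ∑ j : Fin M → Fin d, (clonerKraus d M R (Sum.inr j)).conjTranspose *
      clonerKraus d M R (Sum.inr j) = 1 - symProj (Fin M) (Fin d) := by
    have hQ : (1 - symProj (Fin M) (Fin d)).conjTranspose * (1 - symProj (Fin M) (Fin d)) =
        1 - symProj (Fin M) (Fin d) := by
      rw [Matrix.conjTranspose_sub, Matrix.conjTranspose_one, symProj_conjTranspose,
        Matrix.mul_sub, Matrix.mul_one, Matrix.sub_mul, Matrix.one_mul, symProj_mul_self, sub_self,
        sub_zero]
    rw [← hQ]
    ext i j
    rw [Matrix.sum_apply, Matrix.mul_apply]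
    refine Finset.sum_congr rfl fun k _ => ?_
    rw [Matrix.mul_apply, Finset.sum_eq_single 0]
    · rw [Matrix.conjTranspose_apply, Matrix.conjTranspose_apply, clonerKraus_inr, clonerKraus_inr,
        if_pos rfl, if_pos rfl]
    · intro b _ hb
      rw [clonerKraus_inr k b j, if_neg hb, mul_zero]
    · exact fun h => absurd (Finset.mem_univ _) h
  rw [Fintype.sum_sum_type, h1, h2]
  abel

theorem isChannel_cloner : IsChannel (krausMap (clonerKraus d M R)) :=
  isChannel_krausMap sum_conjTranspose_mul_clonerKraus

theorem copies_apply {n : ℕ} (U : SUGroup d) (i j : Fin n → Fin d) :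
    copies n (pureState U) i j =
      (∏ m, stateVector U (i m)) * (starRingEnd ℂ) (∏ m, stateVector U (j m)) := by
  simp only [copies, tensorProd, Matrix.of_apply, pureState_apply, Finset.prod_mul_distrib,
    map_prod]

theorem symProj_mul_copies {n : ℕ} (U : SUGroup d) :
    symProj (Fin n) (Fin d) * copies n (pureState U) = copies n (pureState U) := by
  ext a b
  rw [Matrix.mul_apply]
  simp only [copies_apply, ← mul_assoc]
  rw [← Finset.sum_mul, sum_symProj_mul_prod]

/-- The sites that carry the input of the cloner. -/
def inputSites (M R : ℕ) : Finset (Fin (M + R)) :=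
  (Finset.univ : Finset (Fin M)).map (Fin.castAddEmb R)

theorem card_inputSites (M R : ℕ) : (inputSites M R).card = M := by
  rw [inputSites, Finset.card_map, Finset.card_univ, Fintype.card_fin]

theorem siteTest_inputSites_append (U : SUGroup d) (i j : Fin M → Fin d) (r s : Fin R → Fin d) :
    siteTest (inputSites M R) (pureState U) (Fin.append i r) (Fin.append j s) =
      if r = s then copies M (pureState U) i j else 0 := by
  have h1 : ∀ m : Fin M, Fin.castAdd R m ∈ inputSites M R := fun m =>
    Finset.mem_map_of_mem (Fin.castAddEmb R) (Finset.mem_univ m)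
  have h2 : ∀ m : Fin R, Fin.natAdd M m ∉ inputSites M R := fun m h => by
    obtain ⟨k, _, hk⟩ := Finset.mem_map.mp h
    have := congrArg Fin.val hk
    simp at this
    omega
  simp only [siteTest, tensorProd, Matrix.of_apply, Fin.prod_univ_add, Fin.append_left,
    Fin.append_right, h1, h2, if_true, if_false, copies, Matrix.one_apply]
  split_ifs with h
  · rw [h]; simp
  · obtain ⟨m, hm⟩ := Function.ne_iff.mp h
    rw [Finset.prod_eq_zero (Finset.mem_univ m) (if_neg hm), mul_zero]

/-- Appending the identity to the input copies gives the test on `inputSites`, so the fidelity of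
the cloner becomes the trace computed in `trace_siteTest_mul_symProj_mul`. -/
theorem cloner_copies (U : SUGroup d) :
    krausMap (clonerKraus d M R) (copies M (pureState U)) =
      ((symDim d M / symDim d (M + R) : ℝ) : ℂ) • (symProj (Fin (M + R)) (Fin d) *
        siteTest (inputSites M R) (pureState U) * symProj (Fin (M + R)) (Fin d)) := by
  have h2 : ∀ j : Fin M → Fin d,
      clonerKraus d M R (Sum.inr j) * copies M (pureState U) = 0 := fun j => by
    ext b k
    rw [Matrix.mul_apply, Matrix.zero_apply]
    have h0 : (1 - symProj (Fin M) (Fin d)) * copies M (pureState U) = 0 := by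
      rw [Matrix.sub_mul, Matrix.one_mul, symProj_mul_copies, sub_self]
    have h := congrFun (congrFun h0 j) k
    rw [Matrix.mul_apply, Matrix.zero_apply] at h
    by_cases hb : b = 0
    · simpa only [clonerKraus_inr, if_pos hb] using h
    · simp only [clonerKraus_inr, if_neg hb, zero_mul, Finset.sum_const_zero]
  have hsum : ∀ f : (Fin (M + R) → Fin d) → ℂ,
      ∑ a, f a = ∑ r : Fin R → Fin d, ∑ i : Fin M → Fin d, f (Fin.append i r) := fun f => by
    rw [Finset.sum_comm, ← Fintype.sum_prod_type', ← Equiv.sum_comp (Fin.appendEquiv M R)]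
    rfl
  rw [krausMap_apply, Fintype.sum_sum_type]
  simp only [h2, Matrix.zero_mul, Finset.sum_const_zero, add_zero]
  ext a b
  rw [Matrix.sum_apply, Matrix.smul_apply, smul_eq_mul, Matrix.mul_apply, hsum, Finset.mul_sum]
  refine Finset.sum_congr rfl fun s _ => ?_
  rw [Matrix.mul_apply, Finset.mul_sum]
  refine Finset.sum_congr rfl fun j _ => ?_
  rw [Matrix.mul_apply, Matrix.mul_apply, hsum, Finset.sum_eq_single s]
  · rw [← sqrt_symDim_mul_self, Finset.sum_mul, Finset.sum_mul, Finset.mul_sum]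
    refine Finset.sum_congr rfl fun i _ => ?_
    rw [siteTest_inputSites_append, if_pos rfl, Matrix.conjTranspose_apply, clonerKraus_inl,
      clonerKraus_inl, ← starRingEnd_apply, map_mul, Complex.conj_ofReal, conj_symProj,
      symProj_comm b]
    ring
  · intro r _ hr
    refine Finset.sum_eq_zero fun i _ => ?_
    rw [siteTest_inputSites_append, if_neg hr, mul_zero]
  · exact fun h => absurd (Finset.mem_univ _) h

theorem cloningFidelity_cloner (S : Finset (Fin (M + R))) :
    cloningFidelity (siteTest S) (krausMap (clonerKraus d M R)) =
      symDim d M / ((M + R).choose S.card : ℕ) * ∑ j ∈ Finset.range (S.card + 1),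
        (M.choose (S.card - j) * R.choose j : ℕ) * (symDim d (M + j))⁻¹ := by
  have h : ∀ U : SUGroup d, (siteTest S (pureState U) *
      krausMap (clonerKraus d M R) (copies M (pureState U))).trace.re =
      symDim d M / ((M + R).choose S.card : ℕ) * ∑ j ∈ Finset.range (S.card + 1),
        (M.choose (S.card - j) * R.choose j : ℕ) * (symDim d (M + j))⁻¹ := fun U => by
    rw [cloner_copies, Matrix.mul_smul, Matrix.trace_smul, trace_siteTest_mul_symProj_mul,
      smul_eq_mul, ← Complex.ofReal_mul, Complex.ofReal_re,
      sum_powersetCard_card_union S.card (inputSites M R) fun k => symDim d (M + R) / symDim d k,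
      card_inputSites, Nat.add_sub_cancel_left, Finset.mul_sum, Finset.mul_sum, Finset.mul_sum]
    refine Finset.sum_congr rfl fun j _ => ?_
    have := (symDim_pos d (M + R)).ne'
    field_simp
  simp only [cloningFidelity, h]
  rw [integral_const, probReal_univ, one_smul]

end Cloner

/-! ### Sums of products of binomial coefficients -/

section Binomial

theorem sum_range_eq_sum_range_of_eq_zero {A : Type*} [AddCommMonoid A] {f : ℕ → A} {m n : ℕ}
    (hm : ∀ k, m ≤ k → f k = 0) (hn : ∀ k, n ≤ k → f k = 0) :
    ∑ k ∈ Finset.range m, f k = ∑ k ∈ Finset.range n, f k := by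
  have h : ∀ p q : ℕ, (∀ k, p ≤ k → f k = 0) →
      ∑ k ∈ Finset.range (p + q), f k = ∑ k ∈ Finset.range p, f k := fun p q hp => by
    rw [Finset.sum_range_add, Finset.sum_eq_zero (s := Finset.range q) fun k _ =>
      hp _ (Nat.le_add_right p k), add_zero]
  rw [← h m n hm, ← h n m hn, add_comm]

/-- Vandermonde's identity. -/
theorem sum_range_choose_mul_choose (m n k : ℕ) :
    ∑ j ∈ Finset.range (k + 1), m.choose j * n.choose (k - j) = (m + n).choose k := by
  rw [Nat.add_choose_eq, Finset.Nat.sum_antidiagonal_eq_sum_range_succ fun i j =>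
    m.choose i * n.choose j]

theorem sum_range_choose_mul_choose_self {j L : ℕ} (x : ℕ) (hj : j ≤ L) :
    ∑ k ∈ Finset.range (L + 1), j.choose k * x.choose k = (x + j).choose j := by
  rw [← sum_range_choose_mul_choose, sum_range_eq_sum_range_of_eq_zero (n := j + 1)]
  · refine Finset.sum_congr rfl fun k hk => ?_
    rw [Nat.choose_symm (Nat.lt_succ_iff.mp (Finset.mem_range.mp hk)), mul_comm]
  · intro k hk
    rw [Nat.choose_eq_zero_of_lt (by omega), zero_mul]
  · intro k hk
    rw [Nat.choose_eq_zero_of_lt (by omega), zero_mul]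

theorem sum_range_choose_mul_choose_mul_choose {k L : ℕ} (m n : ℕ) (hk : k ≤ L) :
    ∑ j ∈ Finset.range (L + 1), m.choose j * j.choose k * n.choose (L - j) =
      m.choose k * (m + n - k).choose (L - k) := by
  obtain ⟨l, rfl⟩ := Nat.exists_eq_add_of_le hk
  rw [add_assoc, Finset.sum_range_add, Finset.sum_eq_zero (s := Finset.range k) fun j hj => by
    rw [Nat.choose_eq_zero_of_lt (Finset.mem_range.mp hj), mul_zero, zero_mul], zero_add]
  have h : ∀ j ∈ Finset.range (l + 1), m.choose (k + j) * (k + j).choose k *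
      n.choose (k + l - (k + j)) = m.choose k * ((m - k).choose j * n.choose (l - j)) :=
    fun j _ => by
      rw [Nat.choose_mul (Nat.le_add_right k j), Nat.add_sub_cancel_left, Nat.add_sub_add_left,
        mul_assoc]
  rw [Finset.sum_congr rfl h, ← Finset.mul_sum, sum_range_choose_mul_choose,
    Nat.add_sub_cancel_left]
  rcases le_or_gt k m with hkm | hkm
  · rw [Nat.sub_add_comm hkm]
  · rw [Nat.choose_eq_zero_of_lt hkm, zero_mul, zero_mul]

/-- The left side is what the expansion of `(A + B) ^ L` yields. Expanding its last factor makes the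
sum over `k` a Vandermonde sum; one more expansion and contraction gives a sum that can be compared
with the cloner term by term. -/
theorem sum_choose_mul_choose_mul_choose_eq (M b e L : ℕ) :
    ∑ k ∈ Finset.range (L + 1),
        M.choose k * (M + b + e).choose k * (M + b - k).choose (L - k) =
      ∑ j ∈ Finset.range (L + 1), b.choose j * (M + L + e).choose (L - j) * (M + j).choose L := by
  calc ∑ k ∈ Finset.range (L + 1),
        M.choose k * (M + b + e).choose k * (M + b - k).choose (L - k)
      = ∑ k ∈ Finset.range (L + 1), ∑ j ∈ Finset.range (L + 1),
          M.choose j * b.choose (L - j) * (j.choose k * (M + b + e).choose k) := by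
        refine Finset.sum_congr rfl fun k hk => ?_
        rw [mul_right_comm, ← sum_range_choose_mul_choose_mul_choose M b
          (Nat.lt_succ_iff.mp (Finset.mem_range.mp hk)), Finset.sum_mul]
        exact Finset.sum_congr rfl fun j _ => by ring
    _ = ∑ j ∈ Finset.range (L + 1), M.choose j * (b.choose (L - j) *
          (M + b + e + j).choose j) := by
        rw [Finset.sum_comm]
        refine Finset.sum_congr rfl fun j hj => ?_
        rw [← Finset.mul_sum, sum_range_choose_mul_choose_self _
          (Nat.lt_succ_iff.mp (Finset.mem_range.mp hj)), mul_assoc]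
    _ = ∑ j ∈ Finset.range (L + 1), ∑ i ∈ Finset.range (L + 1),
          b.choose i * (M + L + e).choose (L - i) * (M.choose j * i.choose (L - j)) := by
        refine Finset.sum_congr rfl fun j hj => ?_
        have hj := Nat.lt_succ_iff.mp (Finset.mem_range.mp hj)
        have h := sum_range_choose_mul_choose_mul_choose b (M + L + e) (Nat.sub_le L j)
        rw [Nat.sub_sub_self hj, show b + (M + L + e) - (L - j) = M + b + e + j by omega] at h
        rw [← h, Finset.mul_sum]
        exact Finset.sum_congr rfl fun i _ => by ring
    _ = _ := by
        rw [Finset.sum_comm]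
        exact Finset.sum_congr rfl fun i _ => by
          rw [← Finset.mul_sum, sum_range_choose_mul_choose]

theorem choose_mul_choose_symDim (M b e j : ℕ) :
    (M + e).choose e * b.choose j * (M + b + e).choose (M + e) =
      (M + j).choose M * (M + b + e).choose (M + j + e) * (M + j + e).choose e := by
  have h1 := Nat.choose_mul (n := M + b + e) (k := M + j + e) (s := M + e) (by omega)
  have h2 := Nat.choose_mul (n := M + j + e) (k := M + e) (s := e) (by omega)
  rw [show M + b + e - (M + e) = b by omega, show M + j + e - (M + e) = j by omega] at h1
  rw [show M + j + e - e = M + j by omega, Nat.add_sub_cancel] at h2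
  calc _ = (M + e).choose e * ((M + b + e).choose (M + e) * b.choose j) := by ring
    _ = (M + b + e).choose (M + j + e) * ((M + j + e).choose (M + e) * (M + e).choose e) := by
      rw [← h1]; ring
    _ = _ := by rw [h2]; ring

/-- Three trinomial revisions; they convert a term of the upper bound into a term of the cloner, up
to a factor that does not depend on `j`. -/
theorem choose_mul_choose_bound {M b e L j : ℕ} (hj : j ≤ L) :
    b.choose j * (M + L + e).choose (L - j) * (M + j).choose L * (M + b + e).choose (M + e) =
      (M + j).choose M * M.choose (L - j) * (M + b + e).choose (M + j + e) *
        (M + L + e).choose L := by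
  obtain ⟨l, rfl⟩ := Nat.exists_eq_add_of_le hj
  rw [Nat.add_sub_cancel_left]
  have h1 := Nat.choose_mul (n := M + b + e) (k := M + j + e) (s := M + e) (by omega)
  have h2 := Nat.choose_mul (n := M + j) (k := j + l) (s := j) (by omega)
  have h3 := Nat.choose_mul (n := M + (j + l) + e) (k := j + l) (s := l) (by omega)
  rw [show M + b + e - (M + e) = b by omega, show M + j + e - (M + e) = j by omega,
    Nat.choose_symm_of_eq_add (show M + j + e = (M + e) + j by omega)] at h1
  rw [Nat.add_sub_cancel, Nat.add_sub_cancel_left, Nat.choose_symm_of_eq_add rfl,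
    ← Nat.choose_symm_of_eq_add (show M + j = M + j from rfl)] at h2
  rw [show M + (j + l) + e - l = M + j + e by omega, Nat.add_sub_cancel] at h3
  calc _ = (M + (j + l) + e).choose l * (M + j).choose (j + l) *
        ((M + b + e).choose (M + e) * b.choose j) := by ring
    _ = ((M + (j + l) + e).choose l * (M + j + e).choose j) * (M + j).choose (j + l) *
        (M + b + e).choose (M + j + e) := by rw [← h1]; ring
    _ = ((M + j).choose (j + l) * (j + l).choose l) * (M + (j + l) + e).choose (j + l) *
        (M + b + e).choose (M + j + e) := by rw [← h3]; ring
    _ = _ := by rw [h2]; ring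

theorem symDim_succ (e n : ℕ) : symDim (e + 1) n = ((n + e).choose e : ℕ) := by
  rw [symDim, Nat.ascFactorial_eq_factorial_mul_choose, Nat.cast_mul,
    mul_div_cancel_left₀ _ (Nat.cast_ne_zero.mpr n.factorial_ne_zero), add_comm e n,
    Nat.choose_symm_of_eq_add rfl]

/-- The fidelity of the optimal cloner as a sum of products of binomial coefficients. -/
theorem symDim_mul_sum_eq (M b e L : ℕ) :
    symDim (e + 1) M / ((M + b).choose L : ℕ) * ∑ j ∈ Finset.range (L + 1),
        (M.choose (L - j) * b.choose j : ℕ) * (symDim (e + 1) (M + j))⁻¹ =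
      (∑ j ∈ Finset.range (L + 1), (M + j).choose M * M.choose (L - j) *
        (M + b + e).choose (M + j + e) : ℕ) /
          (((M + b).choose L : ℕ) * ((M + b + e).choose (M + e) : ℕ) : ℝ) := by
  have h0 : ((M + b + e).choose (M + e) : ℝ) ≠ 0 :=
    Nat.cast_ne_zero.mpr (Nat.choose_pos (by omega)).ne'
  rw [div_mul_eq_mul_div, mul_comm ((M + b).choose L : ℝ), ← div_div]
  congr 1
  rw [eq_div_iff h0, Finset.mul_sum, Finset.sum_mul, Nat.cast_sum]
  refine Finset.sum_congr rfl fun j _ => ?_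
  rw [symDim_succ, symDim_succ]
  have h1 : ((M + j + e).choose e : ℝ) ≠ 0 :=
    Nat.cast_ne_zero.mpr (Nat.choose_pos (by omega)).ne'
  have h2 : ((M + e).choose e : ℝ) * b.choose j * (M + b + e).choose (M + e) =
      (M + j).choose M * (M + b + e).choose (M + j + e) * (M + j + e).choose e := by
    exact_mod_cast choose_mul_choose_symDim M b e j
  field_simp
  push_cast
  linear_combination (M.choose (L - j) : ℝ) * h2

/-- The upper bound for the fidelity is the fidelity of the optimal cloner. -/
theorem fidelityBound_eq (M b e L : ℕ) (hL : L ≤ M + b) :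
    (((M + b).choose L : ℕ) : ℝ)⁻¹ *
      ((((e + 1).ascFactorial (L + M) : ℕ) : ℝ)⁻¹ * (((L.factorial : ℝ) ^ 2)⁻¹ *
      ((∑ k ∈ Finset.range (L + 1), (L.choose k : ℝ) ^ 2 *
        (((k + 1).ascFactorial (L - k) * (L - k).factorial *
            (M + b - k).descFactorial (L - k) : ℕ) *
          (k.factorial * M.descFactorial k * (M + b + e).descFactorial k : ℕ))) *
        ((e + 1).ascFactorial M : ℕ)))) =
    symDim (e + 1) M / ((M + b).choose L : ℕ) * ∑ j ∈ Finset.range (L + 1),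
        (M.choose (L - j) * b.choose j : ℕ) * (symDim (e + 1) (M + j))⁻¹ := by
  have hterm : ∀ k ∈ Finset.range (L + 1), (L.choose k : ℝ) ^ 2 *
        (((k + 1).ascFactorial (L - k) * (L - k).factorial *
            (M + b - k).descFactorial (L - k) : ℕ) *
          (k.factorial * M.descFactorial k * (M + b + e).descFactorial k : ℕ)) =
      (L.factorial : ℝ) ^ 3 *
        (M.choose k * (M + b + e).choose k * (M + b - k).choose (L - k) : ℕ) := fun k hk => by
    have hk := Nat.lt_succ_iff.mp (Finset.mem_range.mp hk)
    have h1 : (L.choose k : ℝ) * k.factorial * (L - k).factorial = L.factorial := by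
      exact_mod_cast Nat.choose_mul_factorial_mul_factorial hk
    have h2 : (k.factorial : ℝ) * (k + 1).ascFactorial (L - k) = L.factorial := by
      have := Nat.factorial_mul_ascFactorial k (L - k)
      rw [Nat.add_sub_cancel' hk] at this
      exact_mod_cast this
    rw [Nat.descFactorial_eq_factorial_mul_choose, Nat.descFactorial_eq_factorial_mul_choose,
      Nat.descFactorial_eq_factorial_mul_choose]
    push_cast
    calc _ = ((L.choose k : ℝ) * k.factorial * (L - k).factorial) ^ 2 *
          ((k.factorial : ℝ) * (k + 1).ascFactorial (L - k)) *
          (M.choose k * (M + b + e).choose k * (M + b - k).choose (L - k)) := by ring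
      _ = _ := by rw [h1, h2]; ring
  -- The factor `L!³` from `hterm`, the `L!²` in the denominator and the factor `L! * (M + L +
  -- e).choose L` from `hasc` leave exactly this identity.
  have hK : ((M + b + e).choose (M + e)) *
      ∑ k ∈ Finset.range (L + 1),
        M.choose k * (M + b + e).choose k * (M + b - k).choose (L - k) =
      (M + L + e).choose L * ∑ j ∈ Finset.range (L + 1), (M + j).choose M * M.choose (L - j) *
        (M + b + e).choose (M + j + e) := by
    rw [sum_choose_mul_choose_mul_choose_eq M b e L, Finset.mul_sum, Finset.mul_sum]
    refine Finset.sum_congr rfl fun j hj => ?_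
    rw [mul_comm, choose_mul_choose_bound (Nat.lt_succ_iff.mp (Finset.mem_range.mp hj)), mul_comm]
  have hasc : ((e + 1).ascFactorial (L + M) : ℝ) =
      (e + 1).ascFactorial M * (L.factorial * (M + L + e).choose L) := by
    have h1 := Nat.factorial_mul_ascFactorial e (L + M)
    have h2 := Nat.factorial_mul_ascFactorial e M
    have h3 := Nat.choose_mul_factorial_mul_factorial (n := M + L + e) (k := L) (by omega)
    rw [show M + L + e - L = e + M by omega, ← h2, show M + L + e = e + (L + M) by omega,
      ← h1] at h3
    have h4 : (e + 1).ascFactorial (L + M) =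
        (e + 1).ascFactorial M * (L.factorial * (M + L + e).choose L) := by
      rw [show M + L + e = e + (L + M) by omega]
      refine Nat.eq_of_mul_eq_mul_left e.factorial_pos ?_
      rw [← h3]
      ring
    exact_mod_cast h4
  have h0 : ((M + b + e).choose (M + e) : ℝ) ≠ 0 :=
    Nat.cast_ne_zero.mpr (Nat.choose_pos (by omega)).ne'
  have h1 : ((M + L + e).choose L : ℝ) ≠ 0 :=
    Nat.cast_ne_zero.mpr (Nat.choose_pos (by omega)).ne'
  have h2 : (L.factorial : ℝ) ≠ 0 := Nat.cast_ne_zero.mpr L.factorial_ne_zero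
  have h3 : ((e + 1).ascFactorial M : ℝ) ≠ 0 :=
    Nat.cast_ne_zero.mpr (ascFactorial_pos_of_pos e.succ_pos M).ne'
  have h4 : ((M + b).choose L : ℝ) ≠ 0 := Nat.cast_ne_zero.mpr (Nat.choose_pos hL).ne'
  rw [symDim_mul_sum_eq, Finset.sum_congr rfl hterm, ← Finset.mul_sum, ← Nat.cast_sum, hasc]
  have hK' := congrArg (Nat.cast (R := ℝ)) hK
  rw [Nat.cast_mul, Nat.cast_mul] at hK'
  rw [eq_div_iff (mul_ne_zero h4 h0)]
  generalize ((∑ k ∈ Finset.range (L + 1),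
        M.choose k * (M + b + e).choose k * (M + b - k).choose (L - k) : ℕ) : ℝ) = x at *
  generalize ((∑ j ∈ Finset.range (L + 1), (M + j).choose M * M.choose (L - j) *
        (M + b + e).choose (M + j + e) : ℕ) : ℝ) = y at *
  field_simp
  linear_combination hK'

end Binomial

/-! ### Closed forms -/

section ClosedForms

theorem zbinom_natCast (n k : ℕ) : zbinom n k = n.choose k := by
  rw [zbinom, if_pos (Int.natCast_nonneg k), Int.toNat_natCast, Ring.choose_natCast]

theorem zbinom_natCast_right (n : ℤ) (k : ℕ) : zbinom n k = Ring.choose n k := by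
  rw [zbinom, if_pos (Int.natCast_nonneg k), Int.toNat_natCast]

theorem zbinom_of_neg (n : ℤ) {k : ℤ} (hk : k < 0) : zbinom n k = 0 := if_neg (not_le.mpr hk)

/-- The symmetry survives out of range: if one lower index is negative, the other exceeds `n` and
both sides vanish. -/
theorem zbinom_symm (n : ℕ) {k l : ℤ} (h : k + l = n) : zbinom n k = zbinom n l := by
  have hneg : ∀ {k l : ℤ}, k + l = n → k < 0 → zbinom n k = zbinom n l := fun {k l} h hk => by
    obtain ⟨m, rfl⟩ := Int.eq_ofNat_of_zero_le (show 0 ≤ l by omega)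
    rw [zbinom_of_neg _ hk, zbinom_natCast, Nat.choose_eq_zero_of_lt (by omega), Nat.cast_zero]
  rcases lt_or_ge k 0 with hk | hk
  · exact hneg h hk
  rcases lt_or_ge l 0 with hl | hl
  · exact (hneg ((add_comm l k).trans h) hl).symm
  obtain ⟨k, rfl⟩ := Int.eq_ofNat_of_zero_le hk
  obtain ⟨l, rfl⟩ := Int.eq_ofNat_of_zero_le hl
  rw [zbinom_natCast, zbinom_natCast, Nat.choose_symm_of_eq_add (show n = k + l by omega)]

theorem sum_Icc_zero_natCast {A : Type*} [AddCommMonoid A] (f : ℤ → A) (n : ℕ) :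
    ∑ i ∈ Finset.Icc (0 : ℤ) n, f i = ∑ i ∈ Finset.range (n + 1), f i := by
  refine (Finset.sum_bij (fun (i : ℕ) _ => (i : ℤ)) ?_ ?_ ?_ ?_).symm
  · intro i hi
    have := Finset.mem_range.mp hi
    exact Finset.mem_Icc.mpr (by omega)
  · exact fun _ _ _ _ h => Int.ofNat_inj.mp h
  · intro i hi
    have := Finset.mem_Icc.mp hi
    exact ⟨i.toNat, Finset.mem_range.mpr (by omega), by omega⟩
  · exact fun _ _ => rfl

/-- Trinomial revision followed by Vandermonde for `Ring.choose`, which allows the negative upper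
index `p = q - M` that is needed later. -/
theorem sum_choose_mul_choose_mul_ringChoose (M s : ℕ) (p : ℤ) :
    ∑ i ∈ Finset.range (M + 1), (M.choose i : ℤ) * i.choose s * Ring.choose p i =
      M.choose s * Ring.choose (p + M - s) M := by
  rcases lt_or_ge M s with hs | hs
  · rw [Nat.choose_eq_zero_of_lt hs, Nat.cast_zero, zero_mul]
    refine Finset.sum_eq_zero fun i hi => ?_
    rw [Nat.choose_eq_zero_of_lt (show i < s from (Finset.mem_range_succ_iff.mp hi).trans_lt hs),
      Nat.cast_zero, mul_zero, zero_mul]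
  · rw [add_sub_assoc, ← Nat.cast_sub hs, Ring.add_choose_eq M (Commute.all _ _),
      Finset.Nat.sum_antidiagonal_eq_sum_range_succ fun i j =>
        Ring.choose p i * Ring.choose ((M - s : ℕ) : ℤ) j, Finset.mul_sum]
    refine Finset.sum_congr rfl fun i hi => ?_
    have hi := Finset.mem_range_succ_iff.mp hi
    have h : M.choose i * i.choose s = M.choose s * (M - s).choose (M - i) := by
      rcases lt_or_ge i s with his | his
      · rw [Nat.choose_eq_zero_of_lt his, Nat.choose_eq_zero_of_lt (show M - s < M - i by omega),
          mul_zero, mul_zero]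
      · rw [Nat.choose_mul his, Nat.choose_symm_of_eq_add (show M - s = (i - s) + (M - i) by omega)]
    rw [Ring.choose_natCast, ← Nat.cast_mul, h, Nat.cast_mul]
    ring

theorem sum_choose_mul_ringChoose_mul_choose (M t : ℕ) (p : ℤ) :
    ∑ i ∈ Finset.range (M + 1), (M.choose i : ℤ) * Ring.choose p i * (M + i).choose t =
      ∑ j ∈ Finset.range (t + 1), (M.choose j : ℤ) * M.choose (t - j) *
        Ring.choose (p + M - (t - j : ℕ)) M := by
  calc _ = ∑ i ∈ Finset.range (M + 1), ∑ j ∈ Finset.range (t + 1),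
        (M.choose j : ℤ) * ((M.choose i : ℤ) * i.choose (t - j) * Ring.choose p i) := by
        refine Finset.sum_congr rfl fun i _ => ?_
        rw [← sum_range_choose_mul_choose, Nat.cast_sum, Finset.mul_sum]
        exact Finset.sum_congr rfl fun j _ => by push_cast; ring
    _ = _ := by
        rw [Finset.sum_comm]
        refine Finset.sum_congr rfl fun j _ => ?_
        rw [← Finset.mul_sum, sum_choose_mul_choose_mul_ringChoose]
        ring

/-- The inner sum of the second closed form of the fidelity. -/
theorem sum_zbinom_eq (M L t : ℕ) :
    ∑ i ∈ Finset.range (M + 1), zbinom M i * zbinom ((L + t : ℕ) - M) i *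
        zbinom (M + i : ℕ) ((L + t : ℕ) - L) =
      (∑ j ∈ Finset.range (t + 1), M.choose j * M.choose (t - j) * (L + j).choose M : ℕ) := by
  have h : (((L + t : ℕ) : ℤ) - L) = (t : ℕ) := by push_cast; ring
  have h2 : ∀ i : ℕ, zbinom M i * zbinom ((L + t : ℕ) - M) i *
      zbinom (M + i : ℕ) ((L + t : ℕ) - L) =
      (M.choose i : ℤ) * Ring.choose (((L + t : ℕ) : ℤ) - M) i * (M + i).choose t := fun i => by
    rw [h, zbinom_natCast, zbinom_natCast_right, zbinom_natCast]
  rw [Finset.sum_congr rfl fun i _ => h2 i, sum_choose_mul_ringChoose_mul_choose, Nat.cast_sum]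
  refine Finset.sum_congr rfl fun j hj => ?_
  have hj := Finset.mem_range_succ_iff.mp hj
  rw [show ((L + t : ℕ) : ℤ) - M + M - (t - j : ℕ) = (L + j : ℕ) by omega, Ring.choose_natCast]
  push_cast
  rfl

/-- For `q < L` each term vanishes. For `L ≤ q < M` the terms have a negative upper index and need
not vanish; only their sum does, as its evaluation `sum_zbinom_eq` shows. -/
theorem sum_zbinom_eq_zero (M L : ℕ) {q : ℕ} (hq : q < L ∨ q < M) :
    ∑ i ∈ Finset.range (M + 1), zbinom M i * zbinom ((q : ℤ) - M) i *
        zbinom (M + i : ℕ) ((q : ℤ) - L) = 0 := by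
  rcases lt_or_ge q L with h | h
  · exact Finset.sum_eq_zero fun i _ => by
      rw [zbinom_of_neg (M + i : ℕ) (show (q : ℤ) - L < 0 by omega), mul_zero]
  · obtain ⟨t, rfl⟩ := Nat.exists_eq_add_of_le h
    rw [sum_zbinom_eq, Finset.sum_eq_zero, Nat.cast_zero]
    intro j hj
    have := Finset.mem_range_succ_iff.mp hj
    rw [Nat.choose_eq_zero_of_lt (show L + j < M by omega), mul_zero]

/-- Put `q = L + t`, evaluate the sum over `i`, and sum over `t` by Vandermonde. The remaining index
is then shifted so that `L + j` becomes `M + j`; the change of range is harmless because the extra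
terms vanish. -/
theorem sum_sum_zbinom_eq {M b L : ℕ} (e : ℕ) (hL : L ≤ M + b) :
    ∑ i ∈ Finset.range (M + 1), ∑ q ∈ Finset.range (M + b + 1),
        zbinom M i * zbinom ((q : ℤ) - M) i * zbinom (b + e : ℕ) ((M + b : ℕ) - q) *
          zbinom (M + i : ℕ) ((q : ℤ) - L) =
      (∑ j ∈ Finset.range (L + 1), (M + j).choose M * M.choose (L - j) *
        (M + b + e).choose (M + j + e) : ℕ) := by
  obtain ⟨T, hT⟩ := Nat.exists_eq_add_of_le hL
  have h1 : ∀ q : ℕ, ∑ i ∈ Finset.range (M + 1),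
        zbinom M i * zbinom ((q : ℤ) - M) i * zbinom (b + e : ℕ) ((M + b : ℕ) - q) *
          zbinom (M + i : ℕ) ((q : ℤ) - L) =
      zbinom (b + e : ℕ) ((M + b : ℕ) - q) * ∑ i ∈ Finset.range (M + 1),
        zbinom M i * zbinom ((q : ℤ) - M) i * zbinom (M + i : ℕ) ((q : ℤ) - L) := fun q => by
    rw [Finset.mul_sum]
    exact Finset.sum_congr rfl fun i _ => by ring
  rw [Finset.sum_comm, Finset.sum_congr rfl fun q _ => h1 q, hT, add_assoc, Finset.sum_range_add,
    Finset.sum_eq_zero (s := Finset.range L) fun q hq => by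
      rw [sum_zbinom_eq_zero M L (Or.inl (Finset.mem_range.mp hq)), mul_zero], zero_add]
  have h2 : ∀ t ∈ Finset.range (T + 1),
      zbinom (b + e : ℕ) ((L + T : ℕ) - (L + t : ℕ)) * ∑ i ∈ Finset.range (M + 1),
        zbinom M i * zbinom ((L + t : ℕ) - M) i * zbinom (M + i : ℕ) ((L + t : ℕ) - L) =
      (∑ j ∈ Finset.range (t + 1), (b + e).choose (T - t) *
        (M.choose j * M.choose (t - j) * (L + j).choose M) : ℕ) := fun t ht => by
    have ht := Finset.mem_range_succ_iff.mp ht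
    rw [sum_zbinom_eq, show ((L + T : ℕ) : ℤ) - (L + t : ℕ) = (T - t : ℕ) by omega, zbinom_natCast,
      ← Finset.mul_sum, Nat.cast_mul]
  rw [Finset.sum_congr rfl h2, ← Nat.cast_sum]
  congr 1
  calc ∑ t ∈ Finset.range (T + 1), ∑ j ∈ Finset.range (t + 1), (b + e).choose (T - t) *
        (M.choose j * M.choose (t - j) * (L + j).choose M)
      = ∑ j ∈ Finset.range (T + 1), ∑ t ∈ Finset.Ico j (T + 1), (b + e).choose (T - t) *
        (M.choose j * M.choose (t - j) * (L + j).choose M) := by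
        refine Finset.sum_comm' fun t j => ?_
        simp only [Finset.mem_range, Finset.mem_Ico]
        omega
    _ = ∑ j ∈ Finset.range (T + 1), M.choose j * (L + j).choose M *
          (M + b + e).choose (L + j + e) := by
        refine Finset.sum_congr rfl fun j hj => ?_
        have hj := Finset.mem_range_succ_iff.mp hj
        rw [Nat.choose_symm_of_eq_add (show M + b + e = (L + j + e) + (T - j) by omega),
          show M + b + e = M + (b + e) by omega,
          ← sum_range_choose_mul_choose M (b + e) (T - j), Finset.sum_Ico_eq_sum_range, Nat.sub_add_comm hj, Finset.mul_sum]
        refine Finset.sum_congr rfl fun t _ => ?_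
        rw [Nat.add_sub_cancel_left, Nat.sub_sub]
        ring
    _ = ∑ j ∈ Finset.range (M + 1), M.choose j * (L + j).choose M *
          (M + b + e).choose (L + j + e) := by
        refine sum_range_eq_sum_range_of_eq_zero (A := ℕ) (fun k hk => ?_) fun k hk => ?_
        · rw [Nat.choose_eq_zero_of_lt (show M + b + e < L + k + e by omega), mul_zero]
        · rw [Nat.choose_eq_zero_of_lt (show M < k by omega), zero_mul, zero_mul]
    _ = ∑ m ∈ Finset.range (M + 1), M.choose m * (L + M - m).choose M *
          (M + b + e).choose (L + M - m + e) := by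
        rw [← Finset.sum_flip]
        refine Finset.sum_congr rfl fun m hm => ?_
        have hm := Finset.mem_range_succ_iff.mp hm
        rw [Nat.choose_symm hm, Nat.add_sub_assoc hm]
    _ = ∑ m ∈ Finset.range (L + 1), M.choose m * (L + M - m).choose M *
          (M + b + e).choose (L + M - m + e) := by
        refine sum_range_eq_sum_range_of_eq_zero (A := ℕ) (fun k hk => ?_) fun k hk => ?_
        · rw [Nat.choose_eq_zero_of_lt (show M < k by omega), zero_mul, zero_mul]
        · rcases lt_or_ge M k with h | h
          · rw [Nat.choose_eq_zero_of_lt h, zero_mul, zero_mul]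
          · rw [Nat.choose_eq_zero_of_lt (show L + M - k < M by omega), mul_zero, zero_mul]
    _ = ∑ j ∈ Finset.range (L + 1), (M + j).choose M * M.choose (L - j) *
          (M + b + e).choose (M + j + e) := by
        rw [← Finset.sum_flip]
        refine Finset.sum_congr rfl fun j hj => ?_
        have hj := Finset.mem_range_succ_iff.mp hj
        rw [show L + M - (L - j) = M + j by omega]
        ring
    _ = _ := by rw [← hT]

/-- Two trinomial revisions absorb the denominator, with `n = a + q`. This turns the inner sum of
the first closed form into one of the kind in the second. -/
theorem sum_zbinom_div_eq (M b e L a : ℕ) :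
    (b.choose a : ℝ) * ∑ q ∈ Finset.Icc (0 : ℤ) ((b : ℤ) - a),
        (zbinom ((b : ℤ) - a) q : ℝ) * (zbinom (M + a : ℕ) (L - q) : ℝ) /
          (zbinom (a + q + e) e : ℝ) =
      ((b + e).choose e : ℝ)⁻¹ * ∑ n ∈ Finset.range (b + 1), (zbinom n a : ℝ) *
        (zbinom (b + e : ℕ) ((b : ℤ) - n) : ℝ) * (zbinom (M + a : ℕ) ((M + n : ℕ) - L) : ℝ) := by
  -- Here the upper summation limit is negative; on the other side every `n.choose a` with `n ≤ b`
  -- vanishes.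
  rcases lt_or_ge b a with h | h
  · rw [Nat.choose_eq_zero_of_lt h, Nat.cast_zero, zero_mul, Finset.sum_eq_zero, mul_zero]
    intro n hn
    have := Finset.mem_range_succ_iff.mp hn
    rw [zbinom_natCast, Nat.choose_eq_zero_of_lt (by omega), Nat.cast_zero, Int.cast_zero, zero_mul,
      zero_mul]
  · obtain ⟨c, rfl⟩ := Nat.exists_eq_add_of_le h
    have hz : ∑ n ∈ Finset.range a, (zbinom n a : ℝ) *
        (zbinom (a + c + e : ℕ) (((a + c : ℕ) : ℤ) - n) : ℝ) *
          (zbinom (M + a : ℕ) ((M + n : ℕ) - L) : ℝ) = 0 :=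
      Finset.sum_eq_zero fun n hn => by
        rw [zbinom_natCast, Nat.choose_eq_zero_of_lt (Finset.mem_range.mp hn), Nat.cast_zero,
          Int.cast_zero, zero_mul, zero_mul]
    rw [show (((a + c : ℕ) : ℤ) - a) = (c : ℕ) by push_cast; ring, sum_Icc_zero_natCast,
      add_assoc a c 1, Finset.sum_range_add _ a (c + 1), hz, zero_add, Finset.mul_sum,
      Finset.mul_sum]
    refine Finset.sum_congr rfl fun q hq => ?_
    have hq := Finset.mem_range_succ_iff.mp hq
    rw [show ((a + c : ℕ) : ℤ) - (a + q : ℕ) = (c - q : ℕ) by omega,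
      show (a : ℤ) + q + e = (a + q + e : ℕ) by push_cast; ring,
      zbinom_symm (M + a) (show ((M + (a + q) : ℕ) : ℤ) - L + (L - q) = (M + a : ℕ) by omega)]
    simp only [zbinom_natCast, Int.cast_natCast]
    have h1 := Nat.choose_mul (n := a + c) (k := a + q) (s := a) (by omega)
    have h2 := Nat.choose_mul (n := a + c + e) (k := a + q + e) (s := e) (by omega)
    rw [Nat.add_sub_cancel_left, Nat.add_sub_cancel_left] at h1
    rw [Nat.add_sub_cancel, Nat.add_sub_cancel,
      Nat.choose_symm_of_eq_add (show a + c + e = (a + q + e) + (c - q) by omega)] at h2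
    have h3 : ((a + c + e).choose e : ℝ) ≠ 0 :=
      Nat.cast_ne_zero.mpr (Nat.choose_pos (by omega)).ne'
    have h4 : ((a + q + e).choose e : ℝ) ≠ 0 :=
      Nat.cast_ne_zero.mpr (Nat.choose_pos (by omega)).ne'
    have h1' : ((a + c).choose (a + q) : ℝ) * (a + q).choose a = (a + c).choose a * c.choose q := by
      exact_mod_cast h1
    have h2' : ((a + c + e).choose (c - q) : ℝ) * (a + q + e).choose e =
        (a + c + e).choose e * (a + c).choose (a + q) := by exact_mod_cast h2
    field_simp
    linear_combination (zbinom (M + a : ℕ) ((L : ℤ) - q) : ℝ) *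
      (-((a + q).choose a : ℝ) * h2' - ((a + c + e).choose e : ℝ) * h1')

/-- The substitutions `i = M - a` and `q = M + n` carry the first closed form into the second, whose
part with `q < M` sums to zero. -/
theorem sum_sum_zbinom_div_eq {M b L : ℕ} (e : ℕ) (hL : L ≤ M + b) :
    ∑ i ∈ Finset.Icc (0 : ℤ) M, (zbinom M i : ℝ) * (zbinom ((M + b : ℕ) - M) (M - i) : ℝ) *
        ∑ q ∈ Finset.Icc (0 : ℤ) ((M + b : ℕ) + i - 2 * M),
          (zbinom ((M + b : ℕ) + i - 2 * M) q : ℝ) * (zbinom (2 * M - i) (L - q) : ℝ) /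
            (zbinom (M + (e + 1 : ℕ) - 1 - i + q) ((e + 1 : ℕ) - 1) : ℝ) =
      ((b + e).choose e : ℝ)⁻¹ * (∑ j ∈ Finset.range (L + 1), (M + j).choose M * M.choose (L - j) *
        (M + b + e).choose (M + j + e) : ℕ) := by
  rw [← Int.cast_natCast (R := ℝ) (∑ j ∈ _, _), ← sum_sum_zbinom_eq e hL, sum_Icc_zero_natCast,
    ← Finset.sum_flip, Int.cast_sum, Finset.mul_sum]
  have hz : ∑ q ∈ Finset.range M, ∑ i ∈ Finset.range (M + 1), zbinom M i *
      zbinom ((q : ℤ) - M) i * zbinom (b + e : ℕ) ((M + b : ℕ) - q) *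
        zbinom (M + i : ℕ) ((q : ℤ) - L) = 0 := by
    refine Finset.sum_eq_zero fun q hq => ?_
    have h := sum_zbinom_eq_zero M L (Or.inr (Finset.mem_range.mp hq))
    rw [← mul_zero (zbinom (b + e : ℕ) ((M + b : ℕ) - q)), ← h, Finset.mul_sum]
    exact Finset.sum_congr rfl fun i _ => by ring
  rw [← Finset.mul_sum, ← Int.cast_sum, Finset.sum_comm, add_assoc M b 1,
    Finset.sum_range_add _ M (b + 1), hz,
    zero_add, Finset.sum_comm, Int.cast_sum, Finset.mul_sum]
  refine Finset.sum_congr rfl fun a ha => ?_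
  have ha := Finset.mem_range_succ_iff.mp ha
  have h := sum_zbinom_div_eq M b e L a
  have hM : ((M - a : ℕ) : ℤ) = (M : ℤ) - a := by omega
  rw [hM, show ((M + b : ℕ) : ℤ) + (M - a) - 2 * M = b - a by push_cast; ring,
    show ((M + b : ℕ) : ℤ) - M = (b : ℕ) by push_cast; ring,
    show (M : ℤ) - (M - a) = (a : ℕ) by ring,
    show 2 * (M : ℤ) - (M - a) = (M + a : ℕ) by push_cast; ring,
    show ((e + 1 : ℕ) : ℤ) - 1 = (e : ℕ) by push_cast; ring,
    zbinom_symm M (show (M : ℤ) - a + a = (M : ℕ) by ring), zbinom_natCast b a, Int.cast_natCast,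
    mul_assoc]
  have h5 : ∀ q : ℤ, (M : ℤ) + (e + 1 : ℕ) - 1 - (M - a) + q = a + q + e := fun q => by
    push_cast; ring
  simp only [h5]
  rw [h, Int.cast_sum, Finset.mul_sum, Finset.mul_sum, Finset.mul_sum]
  refine Finset.sum_congr rfl fun n _ => ?_
  rw [show ((M + n : ℕ) : ℤ) - M = (n : ℕ) by push_cast; ring,
    show ((M + b : ℕ) : ℤ) - (M + n : ℕ) = b - n by push_cast; ring]
  push_cast
  ring

end ClosedForms

/-! ### The dimension ratio for `L = 1` and the main theorem. -/

theorem symDim_mul_inv_symDim_succ (e M : ℕ) :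
    symDim (e + 1) M * (symDim (e + 1) (M + 1))⁻¹ = ((M : ℝ) + 1) / (M + (e + 1 : ℕ)) := by
  have h := Nat.add_one_mul_choose_eq (M + e) M
  have h1 : symDim (e + 1) (M + 1) * (M + 1) = (M + e + 1) * symDim (e + 1) M := by
    rw [symDim_succ, symDim_succ, ← Nat.choose_symm_of_eq_add (show M + e = M + e from rfl),
      ← Nat.choose_symm_of_eq_add (show M + 1 + e = M + 1 + e from rfl),
      show M + 1 + e = M + e + 1 by omega]
    exact_mod_cast h.symm
  have h2 := (symDim_pos (e + 1) (M + 1)).ne'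
  have h3 : (M : ℝ) + (e + 1 : ℕ) ≠ 0 := by positivity
  rw [← div_eq_mul_inv, div_eq_div_iff h2 h3]
  push_cast
  linear_combination -h1

theorem mainTheorem11 (d M N L : ℕ) [NeZero d] (hMN : M < N) (hLN : L ≤ N) :
    ∃ F : ℝ,
      -- the optimum of the fidelity averaged over all sets of `L` output spins
      IsGreatest {f : ℝ | ∃ E : TensorOp d M →ₗ[ℂ] TensorOp d N, IsChannel E ∧
        cloningFidelity (symTest N L) E = f} F ∧
      -- the optimum over channels whose fidelities on the sets of `L` output spins are all equal
      IsGreatest {f : ℝ | ∃ E : TensorOp d M →ₗ[ℂ] TensorOp d N, IsChannel E ∧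
        ∀ S : Finset (Fin N), S.card = L → cloningFidelity (siteTest S) E = f} F ∧
      F = 1 / (zbinom N L : ℝ) * ((zbinom (M + d - 1) M : ℝ) / (zbinom (N + d - 1) M : ℝ)) *
        ∑ i ∈ Finset.Icc (0 : ℤ) M, (zbinom M i : ℝ) * (zbinom (N - M) (M - i) : ℝ) *
          ∑ q ∈ Finset.Icc (0 : ℤ) (N + i - 2 * M),
            (zbinom (N + i - 2 * M) q : ℝ) * (zbinom (2 * M - i) (L - q) : ℝ) /
              (zbinom (M + d - 1 - i + q) (d - 1) : ℝ) ∧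
      F = 1 / ((zbinom N L : ℝ) * (zbinom (N + d - 1) (N - M) : ℝ)) *
        ∑ i ∈ Finset.Icc (0 : ℤ) M, ∑ q ∈ Finset.Icc (0 : ℤ) N,
          (zbinom M i : ℝ) * (zbinom (q - M) i : ℝ) * (zbinom (N - M + d - 1) (N - q) : ℝ) *
            (zbinom (M + i) (q - L) : ℝ) ∧
      (L = 1 → F = (M : ℝ) / N + ((N : ℝ) - M) * (M + 1) / (N * ((M : ℝ) + d))) ∧
      (L = N → F = (zbinom (M + d - 1) M : ℝ) / (zbinom (N + d - 1) N : ℝ)) := by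
  obtain ⟨b, rfl⟩ := Nat.exists_eq_add_of_le hMN.le
  obtain ⟨e, rfl⟩ := Nat.exists_eq_succ_of_ne_zero (NeZero.ne d)
  have hS : ∀ S : Finset (Fin (M + b)), S.card = L →
      cloningFidelity (siteTest S) (krausMap (clonerKraus (e + 1) M b)) =
        symDim (e + 1) M / ((M + b).choose L : ℕ) * ∑ j ∈ Finset.range (L + 1),
          (M.choose (L - j) * b.choose j : ℕ) * (symDim (e + 1) (M + j))⁻¹ := fun S hS => by
    rw [cloningFidelity_cloner, hS]
  -- A common value on all `L`-sets is also the average, so the constrained problem inherits the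
  -- upper bound.
  have hav : ∀ (E : TensorOp (e + 1) M →ₗ[ℂ] TensorOp (e + 1) (M + b)) (f : ℝ),
      (∀ S : Finset (Fin (M + b)), S.card = L → cloningFidelity (siteTest S) E = f) →
      cloningFidelity (symTest (M + b) L) E = f := fun E f h => by
    have h0 : ((M + b).choose L : ℝ) ≠ 0 := Nat.cast_ne_zero.mpr (Nat.choose_pos hLN).ne'
    rw [cloningFidelity_symTest, Finset.sum_congr rfl fun S hS =>
      h S (Finset.mem_powersetCard.mp hS).2, Finset.sum_const, Finset.card_powersetCard,
      Finset.card_univ, Fintype.card_fin, nsmul_eq_mul, inv_mul_cancel_left₀ h0]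
  have hle : ∀ E : TensorOp (e + 1) M →ₗ[ℂ] TensorOp (e + 1) (M + b), IsChannel E →
      cloningFidelity (symTest (M + b) L) E ≤ symDim (e + 1) M / ((M + b).choose L : ℕ) *
        ∑ j ∈ Finset.range (L + 1),
          (M.choose (L - j) * b.choose j : ℕ) * (symDim (e + 1) (M + j))⁻¹ := fun E hE =>
    (hE.cloningFidelity_symTest_le rfl hLN).trans_eq (fidelityBound_eq M b e L hLN)
  have hN : ∀ n k : ℕ, (zbinom (n + (e + 1 : ℕ) - 1) k : ℝ) = ((n + e).choose k : ℕ) :=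
    fun n k => by
      rw [show (n : ℤ) + (e + 1 : ℕ) - 1 = (n + e : ℕ) by push_cast; ring, zbinom_natCast,
        Int.cast_natCast]
  refine ⟨_, ⟨⟨_, isChannel_cloner, hav _ _ hS⟩, ?_⟩, ⟨⟨_, isChannel_cloner, hS⟩, ?_⟩,
    ?_, ?_, ?_, ?_⟩
  · rintro f ⟨E, hE, rfl⟩
    exact hle E hE
  · rintro f ⟨E, hE, hf⟩
    exact hav E f hf ▸ hle E hE
  · rw [sum_sum_zbinom_div_eq e hLN, symDim_mul_sum_eq, hN, hN, zbinom_natCast, Int.cast_natCast]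
    -- This trinomial revision reconciles the prefactor of the closed form with the denominator in
    -- `symDim_mul_sum_eq`.
    have h := Nat.choose_mul (n := M + b + e) (k := M + e) (s := M) (by omega)
    rw [Nat.add_sub_cancel_left, show M + b + e - M = b + e by omega] at h
    have h' : ((M + b + e).choose (M + e) : ℝ) * (M + e).choose M =
        (M + b + e).choose M * (b + e).choose e := by exact_mod_cast h
    have h1 : ((M + b + e).choose (M + e) : ℝ) ≠ 0 :=
      Nat.cast_ne_zero.mpr (Nat.choose_pos (by omega)).ne'
    have h2 : ((M + b + e).choose M : ℝ) ≠ 0 :=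
      Nat.cast_ne_zero.mpr (Nat.choose_pos (by omega)).ne'
    have h3 : ((b + e).choose e : ℝ) ≠ 0 :=
      Nat.cast_ne_zero.mpr (Nat.choose_pos (by omega)).ne'
    have h4 : ((M + b).choose L : ℝ) ≠ 0 := Nat.cast_ne_zero.mpr (Nat.choose_pos hLN).ne'
    generalize ((∑ j ∈ Finset.range (L + 1), (M + j).choose M * M.choose (L - j) *
        (M + b + e).choose (M + j + e) : ℕ) : ℝ) = x
    field_simp
    linear_combination (-x) * h'
  · rw [symDim_mul_sum_eq, ← Int.cast_natCast (R := ℝ) (∑ j ∈ _, _), ← sum_sum_zbinom_eq e hLN,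
      sum_Icc_zero_natCast, Int.cast_sum, zbinom_natCast, Int.cast_natCast,
      show ((M + b : ℕ) : ℤ) - M = (b : ℕ) by push_cast; ring, hN,
      Nat.choose_symm_of_eq_add (show M + b + e = (M + e) + b by omega), div_eq_mul_one_div,
      mul_comm]
    congr 1
    refine Finset.sum_congr rfl fun i _ => ?_
    rw [sum_Icc_zero_natCast, Int.cast_sum]
    refine Finset.sum_congr rfl fun q _ => ?_
    rw [show (b : ℤ) + (e + 1 : ℕ) - 1 = (b + e : ℕ) by push_cast; ring]
    push_cast
    ring
  · rintro rfl
    have h0 : ((M + b : ℕ) : ℝ) ≠ 0 := Nat.cast_ne_zero.mpr (by omega)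
    have h1 := symDim_mul_inv_symDim_succ e M
    have h2 := mul_inv_cancel₀ (symDim_pos (e + 1) M).ne'
    rw [Finset.sum_range_succ, Finset.sum_range_one, Nat.choose_one_right, Nat.choose_zero_right,
      Nat.choose_one_right, Nat.choose_one_right, Nat.sub_self, Nat.choose_zero_right, add_zero,
      mul_one, one_mul]
    have h3 : symDim (e + 1) M / ((M + b : ℕ) : ℝ) * ((M : ℝ) * (symDim (e + 1) M)⁻¹ +
        b * (symDim (e + 1) (M + 1))⁻¹) =
        (M * (symDim (e + 1) M * (symDim (e + 1) M)⁻¹) +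
          b * (symDim (e + 1) M * (symDim (e + 1) (M + 1))⁻¹)) / ((M + b : ℕ) : ℝ) := by ring
    rw [h3, h1, h2]
    have h4 : (M : ℝ) + (e + 1 : ℕ) ≠ 0 := by positivity
    push_cast at h0 h4 ⊢
    field_simp
    ring
  · rintro rfl
    -- For `L = N` only `j = b` survives, since `M.choose (M + b - j)` needs `b ≤ j` and `b.choose
    -- j` needs `j ≤ b`.
    rw [Finset.sum_eq_single b, hN, hN, Nat.choose_self, Nat.add_sub_cancel, Nat.choose_self,
      Nat.choose_self, symDim_succ, symDim_succ, Nat.choose_symm_of_eq_add rfl,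
      Nat.choose_symm_of_eq_add (show M + b + e = M + b + e from rfl)]
    · push_cast
      ring
    · intro j _ hj
      rcases lt_or_gt_of_ne hj with h | h
      · rw [Nat.choose_eq_zero_of_lt (show M < M + b - j by omega), zero_mul, Nat.cast_zero,
          zero_mul]
      · rw [Nat.choose_eq_zero_of_lt h, mul_zero, Nat.cast_zero, zero_mul]
    · exact fun h => absurd (Finset.mem_range.mpr (by omega)) h
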